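/- All modules are right modules. For a $\mathbb{C}$-algebra $\mathrm{A}$ with an idempotent $e$, put $\mathrm{A}_{\mathrm{con}}:=\mathrm{A}/\mathrm{A}e\mathrm{A}$ and let $i^*=-\otimes_{\mathrm{A}}\mathrm{A}_{\mathrm{con}}$ be extension of scalars along $\mathrm{A}\to\mathrm{A}_{\mathrm{con}}$. Say that a simple $\mathrm{A}$-module $S$, finite dimensional over $\mathbb{C}$ and with $i^*S\neq 0$, satisfies condition $(\ast)$ of length $n$ via $\mathcal{Q}$ if \[ \mathcal{Q}=\quad 0\to Q_{n-1}\to Q_{n-2}\to\dots\to Q_1\to Q_0\to 0 \] is a resolution of $S$ by finitely generated projective $\mathrm{A}$-modules ($Q_j$ in degree $-j$) such that $H^{-j}(i^*\mathcal{Q})\cong i^*S$ if $j\in\{0,n-1\}$, and $H^{-j}(i^*\mathcal{Q})=0$ otherwise. Write $\mathcal{E}nd_{\mathrm{A}}(\mathcal{Q})$ for the endomorphism DG-algebra of the complex $\mathcal{Q}$ over $\mathbb{C}$. Let $\mathrm{A}$ and $\mathrm{B}$ be $\mathbb{C}$-algebras with idempotents $e\in\mathrm{A}$ and $e'\in\mathrm{B}$,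 and suppose that $S\in\operatorname{mod}\mathrm{A}$ and $S'\in\operatorname{mod}\mathrm{B}$ satisfy condition $(\ast)$ via complexes $\mathcal{Q}_{\mathrm{A}}$ and $\mathcal{Q}_{\mathrm{B}}$ of the same length $n$. If $\mathrm{A}_{\mathrm{con}}\cong\mathrm{B}_{\mathrm{con}}$ as $\mathbb{C}$-algebras and both are local, then there is an $A_\infty$-quasi-isomorphism between the DG-algebras $\mathcal{E}nd_{\mathrm{A}}(\mathcal{Q}_{\mathrm{A}})$ and $\mathcal{E}nd_{\mathrm{B}}(\mathcal{Q}_{\mathrm{B}})$, viewed as $A_\infty$-algebras over $\mathbb{C}$. -/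

import Mathlib

open scoped DirectSum

namespace AInf

universe w w'

section Defs

variable {k : Type*} [CommRing k]

/-- The finite sequence obtained from `a₀, a₁, …` by replacing the `s` consecutive entries
`a_r, …, a_{r+s-1}` by the single entry `v`. -/
def splice {V : Type*} (a : ℕ → V) (r s : ℕ) (v : V) (i : ℕ) : V :=
  if i < r then a i else if i = r then v else a (i + s - 1)

/-- An `A∞`-algebra structure over `k` on the `ℤ`-graded `k`-module `A`.

The operation `m n` is `k`-multilinear in `n` variables and homogeneous of degree `2 - n`, and the
operations satisfy the Stasheff identities.  The signs are those of the bar construction: `m n` is the operation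
induced on the suspension of `A`, that is
`m n (a₁, …, aₙ) = (-1) ^ (∑ (n - i) |a_i|) • mₙ(a₁ ⊗ ⋯ ⊗ aₙ)` where the `mₙ` are the operations
normalized by `∑ (-1) ^ (r + s t) m_{r+1+t} (1^{⊗ r} ⊗ m_s ⊗ 1^{⊗ t}) = 0`.  The only sign which
remains is `(-1) ^ ((|a₁| - 1) + ⋯ + (|a_r| - 1))`, from moving the inner operation past
`a₁, …, a_r`. -/
structure AInfinityStructure (k : Type*) [CommRing k] (A : ℤ → Type w)
    [∀ i, AddCommGroup (A i)] [∀ i, Module k (A i)] where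
  /-- the operations -/
  m : ∀ n : ℕ, MultilinearMap k (fun _ : Fin n => ⨁ i, A i) (⨁ i, A i)
  /-- there is no curvature term -/
  m_zero : m 0 = 0
  /-- `m n` has degree `2 - n` -/
  degree : ∀ (n : ℕ) (d : Fin n → ℤ) (x : ∀ i, A (d i)),
    ∃ y : A ((∑ i, d i) + 2 - n),
      m n (fun i => DirectSum.lof k ℤ A (d i) (x i)) = DirectSum.lof k ℤ A _ y
  /-- the Stasheff identities -/
  stasheff : ∀ (n : ℕ) (d : ℕ → ℤ) (x : ∀ i, A (d i)) (a : ℕ → ⨁ i, A i)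
    (_ : ∀ i, a i = DirectSum.lof k ℤ A (d i) (x i)),
    ∑ s ∈ Finset.Icc 1 n, ∑ r ∈ Finset.range (n - s + 1),
      (∑ i ∈ Finset.range r, (d i - 1)).negOnePow •
        m (n - s + 1) (fun i => splice a r s (m s (fun j => a (r + j))) i) = 0

/-- An `A∞`-morphism between two `A∞`-algebras, given by its components `f n`, which are
`k`-multilinear in `n` variables and homogeneous of degree `1 - n`.  The signs are again those of
the bar construction. -/
structure AInfinityHom {A : ℤ → Type w} [∀ i, AddCommGroup (A i)] [∀ i, Module k (A i)]
    {B : ℤ → Type w'} [∀ i, AddCommGroup (B i)] [∀ i, Module k (B i)]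
    (𝒜 : AInfinityStructure k A) (ℬ : AInfinityStructure k B) where
  /-- the components -/
  f : ∀ n : ℕ, MultilinearMap k (fun _ : Fin n => ⨁ i, A i) (⨁ i, B i)
  /-- there is no component without inputs -/
  f_zero : f 0 = 0
  /-- `f n` has degree `1 - n` -/
  degree : ∀ (n : ℕ) (d : Fin n → ℤ) (x : ∀ i, A (d i)),
    ∃ y : B ((∑ i, d i) + 1 - n),
      f n (fun i => DirectSum.lof k ℤ A (d i) (x i)) = DirectSum.lof k ℤ B _ y
  /-- compatibility with the operations: on the right-hand side one sums over all ways of cutting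
  `a₁, …, aₙ` into consecutive nonempty blocks -/
  compat : ∀ (n : ℕ) (d : ℕ → ℤ) (x : ∀ i, A (d i)) (a : ℕ → ⨁ i, A i)
    (_ : ∀ i, a i = DirectSum.lof k ℤ A (d i) (x i)),
    ∑ s ∈ Finset.Icc 1 n, ∑ r ∈ Finset.range (n - s + 1),
      (∑ i ∈ Finset.range r, (d i - 1)).negOnePow •
        f (n - s + 1) (fun i => splice a r s (𝒜.m s (fun j => a (r + j))) i) =
    ∑ c : Composition n,
      ℬ.m c.length (fun i => f (c.blocksFun i) (fun j => a (c.embedding i j)))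

/-- An `A∞`-morphism is an `A∞`-quasi-isomorphism if its component `f 1`, which is a morphism of
complexes for the differentials `m 1`, is injective and surjective on cohomology. -/
structure AInfinityHom.IsQuasiIso {A : ℤ → Type w} [∀ i, AddCommGroup (A i)] [∀ i, Module k (A i)]
    {B : ℤ → Type w'} [∀ i, AddCommGroup (B i)] [∀ i, Module k (B i)]
    {𝒜 : AInfinityStructure k A} {ℬ : AInfinityStructure k B} (F : AInfinityHom 𝒜 ℬ) : Prop where
  injective : ∀ x : ⨁ i, A i, 𝒜.m 1 (fun _ => x) = 0 →
    (∃ y, F.f 1 (fun _ => x) = ℬ.m 1 (fun _ => y)) → ∃ z, x = 𝒜.m 1 (fun _ => z)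
  surjective : ∀ y : ⨁ i, B i, ℬ.m 1 (fun _ => y) = 0 →
    ∃ x, 𝒜.m 1 (fun _ => x) = 0 ∧ ∃ z, F.f 1 (fun _ => x) = y + ℬ.m 1 (fun _ => z)

end Defs

section DG

open DirectSum

variable (k : Type*) [CommRing k] (A : ℤ → Type w) [∀ i, AddCommGroup (A i)] [∀ i, Module k (A i)]
  [DirectSum.GRing A]

/-- A differential of degree `1` which makes the `ℤ`-graded unital `k`-algebra `A`
into a (unital) DG-algebra. -/
structure DGStructure where
  /-- the differential -/
  d : ∀ i : ℤ, A i →ₗ[k] A (i + 1)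
  d_d : ∀ (i : ℤ) (x : A i), d (i + 1) (d i x) = 0
  /-- the graded Leibniz rule `d (x * y) = d x * y + (-1) ^ |x| • x * d y` -/
  leibniz : ∀ (i j : ℤ) (x : A i) (y : A j),
    lof k ℤ A (i + j + 1) (d (i + j) (GradedMonoid.GMul.mul x y)) =
      lof k ℤ A (i + 1) (d i x) * lof k ℤ A j y +
        i.negOnePow • (lof k ℤ A i x * lof k ℤ A (j + 1) (d j y))

variable {A}

/-- The linear automorphism `x ↦ (-1) ^ |x| • x` of a graded module. -/
def signMap : (⨁ i, A i) →ₗ[k] ⨁ i, A i :=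
  toModule k ℤ _ fun i => i.negOnePow • lof k ℤ A i

variable {k}

/-- The differential of a DG-algebra on the direct sum of its homogeneous components. -/
def DGStructure.D (𝒟 : DGStructure k A) : (⨁ i, A i) →ₗ[k] ⨁ i, A i :=
  toModule k ℤ _ fun i => lof k ℤ A (i + 1) ∘ₗ 𝒟.d i

/-- The operations of a DG-algebra viewed as an `A∞`-algebra: the differential, the
multiplication (with the sign of the bar construction), and zero. -/
def DGStructure.ops [DirectSum.GAlgebra k A] (𝒟 : DGStructure k A) :
    ∀ n : ℕ, MultilinearMap k (fun _ : Fin n => ⨁ i, A i) (⨁ i, A i)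
  | 1 => MultilinearMap.ofSubsingleton k _ _ 0 𝒟.D
  | 2 => (MultilinearMap.mkPiAlgebraFin k 2 (⨁ i, A i)).compLinearMap ![signMap k, LinearMap.id]
  | _ => 0

theorem DGStructure.ops_one [DirectSum.GAlgebra k A] (𝒟 : DGStructure k A) (v : Fin 1 → ⨁ i, A i) :
    𝒟.ops 1 v = 𝒟.D (v 0) := rfl

theorem DGStructure.ops_two [DirectSum.GAlgebra k A] (𝒟 : DGStructure k A) (v : Fin 2 → ⨁ i, A i) :
    𝒟.ops 2 v = signMap k (v 0) * v 1 := by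
  simp [DGStructure.ops, MultilinearMap.mkPiAlgebraFin_apply]

theorem DGStructure.ops_of_three_le [DirectSum.GAlgebra k A] (𝒟 : DGStructure k A) (n : ℕ) (h : 3 ≤ n) : 𝒟.ops n = 0 := by
  match n, h with
  | n + 3, _ => rfl

end DG

section DGLemmas

open DirectSum

variable {k : Type*} [CommRing k] {A : ℤ → Type w} [∀ i, AddCommGroup (A i)]
  [∀ i, Module k (A i)]

theorem signMap_lof (i : ℤ) (x : A i) :
    signMap k (lof k ℤ A i x) = i.negOnePow • lof k ℤ A i x := by
  simp [signMap, toModule_lof]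

theorem lof_cast {i j : ℤ} (h : i = j) (x : A i) :
    ∃ y : A j, lof k ℤ A i x = lof k ℤ A j y := by
  subst h; exact ⟨x, rfl⟩

theorem lof_units_smul (u : ℤˣ) (i : ℤ) (x : A i) :
    lof k ℤ A i (u • x) = u • lof k ℤ A i x := by
  rcases Int.units_eq_one_or u with rfl | rfl <;> simp

theorem lof_mul_lof [DirectSum.GRing A] (i j : ℤ) (x : A i) (y : A j) :
    lof k ℤ A i x * lof k ℤ A j y = lof k ℤ A (i + j) (GradedMonoid.GMul.mul x y) :=
  of_mul_of x y

theorem signMap_mul_lof [DirectSum.GRing A] (i j : ℤ) (x : A i) (y : A j) :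
    signMap k (lof k ℤ A i x * lof k ℤ A j y) =
      (i.negOnePow * j.negOnePow) • (lof k ℤ A i x * lof k ℤ A j y) := by
  rw [lof_mul_lof, signMap_lof, Int.negOnePow_add]

theorem DGStructure.D_lof [DirectSum.GRing A] (𝒟 : DGStructure k A) (i : ℤ) (x : A i) :
    𝒟.D (lof k ℤ A i x) = lof k ℤ A (i + 1) (𝒟.d i x) := by
  simp [DGStructure.D, toModule_lof]

theorem DGStructure.D_D_lof [DirectSum.GRing A] (𝒟 : DGStructure k A) (i : ℤ) (x : A i) :
    𝒟.D (𝒟.D (lof k ℤ A i x)) = 0 := by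
  rw [D_lof, D_lof, 𝒟.d_d, map_zero]

theorem DGStructure.D_mul_lof [DirectSum.GRing A] (𝒟 : DGStructure k A) (i j : ℤ)
    (x : A i) (y : A j) :
    𝒟.D (lof k ℤ A i x * lof k ℤ A j y) =
      𝒟.D (lof k ℤ A i x) * lof k ℤ A j y +
        i.negOnePow • (lof k ℤ A i x * 𝒟.D (lof k ℤ A j y)) := by
  rw [lof_mul_lof, D_lof, D_lof, D_lof, 𝒟.leibniz]

variable [DirectSum.GRing A] [DirectSum.GAlgebra k A]

/-- A unital DG-algebra, viewed as an `A∞`-algebra. -/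
def DGStructure.toAInfinity (𝒟 : DGStructure k A) : AInfinityStructure k A where
  m := 𝒟.ops
  m_zero := rfl
  degree := by
    intro n d x
    match n with
    | 0 => exact ⟨0, by simp [DGStructure.ops]⟩
    | 1 =>
      rw [DGStructure.ops_one, DGStructure.D_lof]
      apply lof_cast
      simp; ring
    | 2 =>
      rw [DGStructure.ops_two, signMap_lof, smul_mul_assoc, lof_mul_lof]
      obtain ⟨y, hy⟩ := lof_cast (k := k) (A := A) (i := d 0 + d 1)
        (j := (∑ i, d i) + 2 - ((2 : ℕ) : ℤ)) (by simp [Fin.sum_univ_two])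
        (GradedMonoid.GMul.mul (x 0) (x 1))
      exact ⟨(d 0).negOnePow • y, by rw [hy]; simp [Units.smul_def]⟩
    | n + 3 => exact ⟨0, by rw [DGStructure.ops_of_three_le _ _ (by omega)]; simp⟩
  stasheff := by
    intro n d x a ha
    match n with
    | 0 => simp
    | 1 =>
      simp only [Finset.Icc_self, Finset.sum_singleton, Nat.sub_self, zero_add,
        Finset.sum_range_one, Finset.range_zero, Finset.sum_empty, Int.negOnePow_zero, one_smul]
      rw [DGStructure.ops_one, DGStructure.ops_one]
      simp [splice, ha, DGStructure.D_D_lof]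
    | 2 =>
      have e : Finset.Icc 1 2 = {1, 2} := rfl
      rw [e, Finset.sum_pair (by norm_num)]
      simp only [Nat.sub_self, zero_add, Finset.sum_range_succ, Finset.range_zero,
        Finset.sum_empty, Int.negOnePow_zero, one_smul, Nat.reduceSub, Nat.reduceAdd,
        DGStructure.ops_one, DGStructure.ops_two, splice]
      simp only [Fin.isValue, Fin.val_zero, Fin.val_one, lt_self_iff_false, if_true, if_false,
        Nat.not_lt_zero, one_ne_zero, Nat.zero_lt_one, add_zero, zero_add, Nat.add_sub_cancel]
      rw [ha 0, ha 1, signMap_lof, DGStructure.D_lof, signMap_lof, ← DGStructure.D_lof,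
        Int.negOnePow_succ, Int.negOnePow_sub, Int.negOnePow_one]
      rcases Int.units_eq_one_or (d 0).negOnePow with h | h <;>
        (simp [h, DGStructure.D_mul_lof]; try abel)
    | 3 =>
      have e : Finset.Icc 1 3 = {1, 2, 3} := rfl
      rw [e, Finset.sum_insert (by norm_num), Finset.sum_pair (by norm_num)]
      rw [𝒟.ops_of_three_le 3 le_rfl]
      simp only [Nat.sub_self, zero_add, Finset.sum_range_succ, Finset.range_zero,
        Finset.sum_empty, Int.negOnePow_zero, one_smul, Nat.reduceSub, Nat.reduceAdd,
        DGStructure.ops_one, DGStructure.ops_two, splice,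
        _root_.zero_apply, smul_zero]
      simp only [Fin.isValue, Fin.val_zero, Fin.val_one, lt_self_iff_false, if_true, if_false,
        Nat.not_lt_zero, one_ne_zero, Nat.zero_lt_one, add_zero, zero_add]
      simp only [Nat.reduceAdd, Nat.reduceSub, map_zero, add_zero]
      rw [ha 0, ha 1, ha 2, signMap_lof, signMap_lof, smul_mul_assoc, smul_mul_assoc,
        Int.negOnePow_sub, Int.negOnePow_one]
      have e' := signMap_mul_lof (k := k) (d 0) (d 1) (x 0) (x 1)
      rcases Int.units_eq_one_or (d 0).negOnePow with h | h <;>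
      rcases Int.units_eq_one_or (d 1).negOnePow with h' | h' <;>
        simp [h, h', e', mul_assoc]
    | n + 4 =>
      refine Finset.sum_eq_zero fun s hs => Finset.sum_eq_zero fun r hr => ?_
      rw [Finset.mem_Icc] at hs
      rw [Finset.mem_range] at hr
      by_cases h : 3 ≤ s
      · rw [𝒟.ops_of_three_le s h]
        rw [MultilinearMap.map_coord_zero (i := ⟨r, hr⟩), smul_zero]
        simp [splice]
      · rw [𝒟.ops_of_three_le (n + 4 - s + 1) (by omega)]
        simp

end DGLemmas

section EndDG

open CategoryTheory CochainComplex CochainComplex.HomComplex DirectSum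

universe v u

variable {C : Type u} [Category.{v} C] [Preadditive C]

/-- The homogeneous components of the endomorphism DG-algebra of a complex `K`: in degree `i` it is
the group of all families of morphisms `K.X p ⟶ K.X (p + i)`. -/
abbrev EndGr (K : CochainComplex C ℤ) (i : ℤ) : Type v := Cochain K K i

theorem endGr_ext (K : CochainComplex C ℤ) {i j : ℤ} (h : i = j) (x : EndGr K i) (y : EndGr K j)
    (hxy : ∀ (p q : ℤ) (hi : p + i = q) (hj : p + j = q), x.v p q hi = y.v p q hj) :
    (GradedMonoid.mk i x : GradedMonoid (EndGr K)) = GradedMonoid.mk j y := by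
  subst h
  congr 1
  ext p q hpq
  exact hxy p q hpq hpq

theorem endGr_assoc (K : CochainComplex C ℤ) (i j l : ℤ) (x : EndGr K i) (y : EndGr K j)
    (z : EndGr K l) (p q : ℤ) (h : p + (i + j + l) = q) (h' : p + (i + (j + l)) = q) :
    (z.comp (y.comp x (add_comm j i)) (add_comm l (i + j))).v p q h =
      ((z.comp y (add_comm l j)).comp x (add_comm (j + l) i)).v p q h' := by
  rw [Cochain.comp_v _ _ (add_comm l (i + j)) p (p + l) q rfl (by omega),
    Cochain.comp_v _ _ (add_comm j i) (p + l) (p + l + j) q rfl (by omega),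
    Cochain.comp_v _ _ (add_comm (j + l) i) p (p + l + j) q (by omega) (by omega),
    Cochain.comp_v _ _ (add_comm l j) p (p + l) (p + l + j) rfl rfl, Category.assoc]

/-- The product of `x` and `y` in the endomorphism algebra of a complex is the
composition `x ∘ y` (first `y`, then `x`). -/
instance endGMul (K : CochainComplex C ℤ) : GradedMonoid.GMul (EndGr K) where
  mul {i j} x y := y.comp x (add_comm j i)

instance endGOne (K : CochainComplex C ℤ) : GradedMonoid.GOne (EndGr K) where
  one := Cochain.ofHom (𝟙 K)

instance endGMonoid (K : CochainComplex C ℤ) : GradedMonoid.GMonoid (EndGr K) where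
  one_mul := fun ⟨i, x⟩ => endGr_ext K (zero_add i) _ _ fun p q hi hj => by
    change (x.comp (Cochain.ofHom (𝟙 K)) (add_comm i 0)).v p q hi = x.v p q hj
    simp [Cochain.comp_v _ _ (add_comm i 0) p q q hj (add_zero q)]
  mul_one := fun ⟨i, x⟩ => endGr_ext K (add_zero i) _ _ fun p q hi hj => by
    change ((Cochain.ofHom (𝟙 K)).comp x (add_comm 0 i)).v p q hi = x.v p q hj
    simp [Cochain.comp_v _ _ (add_comm 0 i) p p q (add_zero p) hj]
  mul_assoc := fun ⟨i, x⟩ ⟨j, y⟩ ⟨l, z⟩ => endGr_ext K (add_assoc i j l) _ _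
    fun p q hi hj => endGr_assoc K i j l x y z p q hi hj

/-- The endomorphism graded ring of a complex. -/
instance endGRing (K : CochainComplex C ℤ) : DirectSum.GRing (EndGr K) where
  mul_zero _ := Cochain.zero_comp _ _
  zero_mul _ := Cochain.comp_zero _ _
  mul_add _ _ _ := Cochain.add_comp _ _ _ _
  add_mul _ _ _ := Cochain.comp_add _ _ _ _
  natCast n := n • Cochain.ofHom (𝟙 K)
  natCast_zero := zero_smul _ _
  natCast_succ n := by rw [add_smul, one_smul]; rfl
  intCast n := n • Cochain.ofHom (𝟙 K)
  intCast_ofNat n := natCast_zsmul _ _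
  intCast_negSucc_ofNat n := negSucc_zsmul _ _

variable (k : Type*) [CommRing k] [Linear k C]

instance endGAlgebra (K : CochainComplex C ℤ) : DirectSum.GAlgebra k (EndGr K) where
  toFun :=
    { toFun := fun r => r • Cochain.ofHom (𝟙 K)
      map_zero' := zero_smul _ _
      map_add' := fun r s => add_smul _ _ _ }
  map_one := one_smul _ _
  map_mul r s := endGr_ext K (zero_add 0).symm _ _ fun p q hi hj => by
    obtain rfl : p = q := by simpa using hi
    change ((r * s) • Cochain.ofHom (𝟙 K)).v p p hi =
      ((s • Cochain.ofHom (𝟙 K)).comp (r • Cochain.ofHom (𝟙 K)) (add_comm 0 0)).v p p hj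
    rw [Cochain.comp_v _ _ (add_comm 0 0) p p p (add_zero p) (add_zero p)]
    simp [mul_smul]
  commutes r := fun ⟨i, x⟩ => endGr_ext K (add_comm 0 i) _ _ fun p q hi hj => by
    change (x.comp (r • Cochain.ofHom (𝟙 K)) (add_comm i 0)).v p q hi =
      ((r • Cochain.ofHom (𝟙 K)).comp x (add_comm 0 i)).v p q hj
    rw [Cochain.comp_v _ _ (add_comm i 0) p q q (by omega) (add_zero q),
      Cochain.comp_v _ _ (add_comm 0 i) p p q (add_zero p) (by omega)]
    simp
  smul_def r := fun ⟨i, x⟩ => endGr_ext K (zero_add i).symm _ _ fun p q hi hj => by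
    change (r • x).v p q hi = (x.comp (r • Cochain.ofHom (𝟙 K)) (add_comm i 0)).v p q hj
    rw [Cochain.comp_v _ _ (add_comm i 0) p q q hi (add_zero q)]
    simp

theorem lof_mul_lof_endGr (K : CochainComplex C ℤ) {i j m : ℤ} (x : EndGr K i)
    (y : EndGr K j) (h : j + i = m) :
    lof k ℤ (EndGr K) i x * lof k ℤ (EndGr K) j y = lof k ℤ (EndGr K) m (y.comp x h) := by
  obtain rfl : m = i + j := by omega
  exact lof_mul_lof i j x y

/-- The endomorphism DG-algebra of a complex: the differential of `x` is
`d ∘ x - (-1) ^ |x| • x ∘ d`. -/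
def endDG (K : CochainComplex C ℤ) : DGStructure k (EndGr K) where
  d i := δ_hom k K K i (i + 1)
  d_d i x := δ_δ i (i + 1) (i + 1 + 1) x
  leibniz i j x y := by
    rw [lof_mul_lof_endGr k K _ _ (m := i + j + 1) (by ring),
      lof_mul_lof_endGr k K _ _ (m := i + j + 1) (by ring), ← lof_units_smul, ← map_add]
    congr 1
    exact δ_comp y x (add_comm j i) (j + 1) (i + 1) (i + j + 1) rfl rfl rfl

end EndDG

section Contraction

open CategoryTheory MulOpposite

universe u u₂ v

variable {A : Type u} [Ring A]

/-- For an element `e` of a ring `A`, the quotient `A ⧸ AeA` of `A` by the two-sided ideal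
generated by `e`. -/
abbrev ConAlg (e : A) : Type u := (TwoSidedIdeal.span {e}).ringCon.Quotient

/-- The quotient map `A → A ⧸ AeA`. -/
abbrev conMk (e : A) : A →+* ConAlg e := (TwoSidedIdeal.span {e}).ringCon.mk'

/-- For a right `A`-module `M`, the submodule `M · AeA`. -/
def conSubmodule (e : A) (M : Type v) [AddCommGroup M] [Module Aᵐᵒᵖ M] : Submodule Aᵐᵒᵖ M :=
  Submodule.span Aᵐᵒᵖ {x | ∃ a ∈ TwoSidedIdeal.span {e}, ∃ m : M, x = op a • m}

/-- The quotient `M ⧸ M · AeA`, that is `M ⊗_A (A ⧸ AeA)`, for a right `A`-module `M`. -/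
abbrev ConTensor (e : A) (M : Type v) [AddCommGroup M] [Module Aᵐᵒᵖ M] : Type v :=
  M ⧸ conSubmodule e M

section

variable (e : A) (M : Type v) [AddCommGroup M] [Module Aᵐᵒᵖ M]

/-- The right action of `A` on `M ⧸ M · AeA`. -/
def conAction₀ : A →+* (AddMonoid.End (ConTensor e M))ᵐᵒᵖ where
  toFun a := op (Module.toAddMonoidEnd Aᵐᵒᵖ (ConTensor e M) (op a))
  map_one' := by rw [op_one, map_one, op_one]
  map_mul' a b := by rw [op_mul, map_mul, op_mul]
  map_zero' := by rw [op_zero, map_zero, op_zero]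
  map_add' a b := by rw [MulOpposite.op_add, map_add, MulOpposite.op_add]

theorem conAction₀_le : (TwoSidedIdeal.span {e}).ringCon ≤ RingCon.ker (conAction₀ e M) := by
  intro a b hab
  change conAction₀ e M a = conAction₀ e M b
  rw [← sub_eq_zero, ← map_sub]
  refine unop_injective (AddMonoidHom.ext fun x => ?_)
  obtain ⟨m, rfl⟩ := Submodule.Quotient.mk_surjective _ x
  exact (Submodule.Quotient.mk_eq_zero _).2
    (Submodule.subset_span ⟨a - b, (TwoSidedIdeal.rel_iff _ _ _).1 hab, m, rfl⟩)

/-- The right action of `A ⧸ AeA` on `M ⧸ M · AeA`. -/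
def conAction : (ConAlg e)ᵐᵒᵖ →+* AddMonoid.End (ConTensor e M) where
  toFun x := unop (RingCon.lift _ (conAction₀ e M) (conAction₀_le e M) (unop x))
  map_one' := by rw [unop_one, map_one, unop_one]
  map_mul' a b := by rw [unop_mul, map_mul, unop_mul]
  map_zero' := by rw [unop_zero, map_zero, unop_zero]
  map_add' a b := by rw [MulOpposite.unop_add, map_add, MulOpposite.unop_add]

instance conTensorModule : Module (ConAlg e)ᵐᵒᵖ (ConTensor e M) :=
  Module.compHom _ (conAction e M)

theorem con_smul_mk (a : A) (m : M) :
    (op (conMk e a) • (Submodule.Quotient.mk m : ConTensor e M) : ConTensor e M) =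
      Submodule.Quotient.mk (op a • m) := rfl

theorem con_smul (a : A) (x : ConTensor e M) :
    (op (conMk e a) • x : ConTensor e M) = op a • x := rfl

variable {M} {N : Type*} [AddCommGroup N] [Module Aᵐᵒᵖ N]

theorem conSubmodule_le_comap (f : M →ₗ[Aᵐᵒᵖ] N) :
    conSubmodule e M ≤ (conSubmodule e N).comap f := by
  refine Submodule.span_le.2 ?_
  rintro _ ⟨a, ha, m, rfl⟩
  exact Submodule.subset_span ⟨a, ha, f m, map_smul f _ _⟩

/-- The map `M ⧸ M · AeA → N ⧸ N · AeA` induced by a linear map `M → N`. -/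
def conTensorMap (f : M →ₗ[Aᵐᵒᵖ] N) : ConTensor e M →ₗ[(ConAlg e)ᵐᵒᵖ] ConTensor e N where
  toFun := Submodule.mapQ _ _ f (conSubmodule_le_comap e f)
  map_add' := map_add _
  map_smul' x m := by
    obtain ⟨a, ha⟩ := RingCon.mk'_surjective _ (unop x)
    obtain rfl : op (conMk e a) = x := by rw [← op_unop x, ← ha]
    exact map_smul (Submodule.mapQ _ _ f (conSubmodule_le_comap e f)) (op a) m

theorem conTensorMap_mk (f : M →ₗ[Aᵐᵒᵖ] N) (m : M) :
    conTensorMap e f (Submodule.Quotient.mk m : ConTensor e M) =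
      (Submodule.Quotient.mk (f m) : ConTensor e N) := rfl

/-- Linear maps out of `M ⧸ M · AeA` agree if they agree on the classes of elements of `M`. -/
theorem conTensor_ext {P : Type*} [AddCommGroup P] [Module (ConAlg e)ᵐᵒᵖ P]
    (f g : ConTensor e M →ₗ[(ConAlg e)ᵐᵒᵖ] P)
    (h : ∀ m : M, f (Submodule.Quotient.mk m : ConTensor e M) =
      g (Submodule.Quotient.mk m : ConTensor e M)) : f = g := by
  refine LinearMap.ext fun x => ?_
  obtain ⟨m, rfl⟩ := Submodule.Quotient.mk_surjective _ x
  exact h m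

end

variable (e : A)

/-- Extension of scalars `i^* = - ⊗_A (A ⧸ AeA)` from right `A`-modules to right
`A ⧸ AeA`-modules. -/
def iStar : ModuleCat.{v} Aᵐᵒᵖ ⥤ ModuleCat.{v} (ConAlg e)ᵐᵒᵖ where
  obj M := ModuleCat.of _ (ConTensor e M)
  map f := ModuleCat.ofHom (conTensorMap e f.hom)
  map_id _ := ModuleCat.hom_ext (conTensor_ext e _ _ fun _ => rfl)
  map_comp _ _ := ModuleCat.hom_ext (conTensor_ext e _ _ fun _ => rfl)

instance iStar_additive : (iStar.{u, v} e).Additive where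
  map_add := ModuleCat.hom_ext (conTensor_ext e _ _ fun _ => rfl)

/-- Restriction of scalars `i_*` from right `A ⧸ AeA`-modules to right `A`-modules. -/
noncomputable abbrev iLowerStar : ModuleCat.{v} (ConAlg e)ᵐᵒᵖ ⥤ ModuleCat.{v} Aᵐᵒᵖ :=
  ModuleCat.restrictScalars (RingHom.op (conMk e))

theorem conSubmodule_le_ker {M : ModuleCat.{v} Aᵐᵒᵖ} {N : ModuleCat.{v} (ConAlg e)ᵐᵒᵖ}
    (f : M ⟶ (iLowerStar e).obj N) : conSubmodule e M ≤ LinearMap.ker f.hom := by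
  refine Submodule.span_le.2 ?_
  rintro _ ⟨a, ha, m, rfl⟩
  have h : conMk e a = 0 := (RingCon.eq _).2 ha
  have h' : f.hom (op a • m) = (op (conMk e a) • (show N from f.hom m) : N) :=
    map_smul f.hom (op a) m
  rw [SetLike.mem_coe, LinearMap.mem_ker, h', h, op_zero]
  exact zero_smul _ (show N from f.hom m)

/-- A linear map from `M` to a right `A ⧸ AeA`-module, descended to `M ⧸ M · AeA`. -/
noncomputable def conLift {M : ModuleCat.{v} Aᵐᵒᵖ} {N : ModuleCat.{v} (ConAlg e)ᵐᵒᵖ}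
    (f : M ⟶ (iLowerStar e).obj N) : ConTensor e M →ₗ[(ConAlg e)ᵐᵒᵖ] N where
  toFun := Submodule.liftQ (conSubmodule e M) f.hom (conSubmodule_le_ker e f)
  map_add' := map_add _
  map_smul' x m := by
    obtain ⟨a, ha⟩ := RingCon.mk'_surjective _ (unop x)
    obtain rfl : op (conMk e a) = x := by rw [← op_unop x, ← ha]
    exact map_smul (Submodule.liftQ (conSubmodule e M) f.hom (conSubmodule_le_ker e f)) (op a) m

/-- Restriction of a linear map along `M → M ⧸ M · AeA`. -/
noncomputable def conUnlift {M : ModuleCat.{v} Aᵐᵒᵖ} {N : ModuleCat.{v} (ConAlg e)ᵐᵒᵖ}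
    (g : ConTensor e M →ₗ[(ConAlg e)ᵐᵒᵖ] N) : M ⟶ (iLowerStar e).obj N :=
  ModuleCat.ofHom (Y := (iLowerStar e).obj N)
    { toFun := fun m => g (Submodule.Quotient.mk m : ConTensor e M)
      map_add' := fun x y =>
        map_add g (Submodule.Quotient.mk x : ConTensor e M) (Submodule.Quotient.mk y)
      map_smul' := fun a x =>
        map_smul g (op (conMk e (unop a))) (Submodule.Quotient.mk x : ConTensor e M) }

/-- The functor `i^*` is left adjoint to restriction of scalars. -/
noncomputable def iStarAdjunction : iStar.{u, v} e ⊣ iLowerStar.{u, v} e :=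
  Adjunction.mkOfHomEquiv
    { homEquiv := fun _ _ =>
        { toFun := fun g => conUnlift e g.hom
          invFun := fun f => ModuleCat.ofHom (conLift e f)
          left_inv := fun _ => ModuleCat.hom_ext (conTensor_ext e _ _ fun _ => rfl)
          right_inv := fun _ => rfl }
      homEquiv_naturality_left_symm := fun _ _ =>
        ModuleCat.hom_ext (conTensor_ext e _ _ fun _ => rfl)
      homEquiv_naturality_right := fun _ _ => rfl }

/-- Let `A` be a `ℂ`-algebra, `e ∈ A`, and `A_con = A ⧸ AeA`.  This is the condition on a right
`A`-module `S` and a projective resolution `Q` of `S` that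

* `e` is idempotent, and `S` is simple and finite dimensional over `ℂ`;
* `Q` is of the form `0 → Q_{n-1} → ⋯ → Q₁ → Q₀ → 0` with all `Q_j` finitely generated (they are
  projective since `Q` is a projective resolution);
* `S`, viewed over `A_con`, is a (nonzero, hence simple) module, that is `i^* S ≠ 0`;
* `H^{-j}(i^* Q)` is isomorphic to `i^* S` for `j ∈ {0, n - 1}`, and is zero otherwise. -/
structure IsContractionSetup [Algebra ℂ A] (e : A) (n : ℕ) {S : ModuleCat.{u} Aᵐᵒᵖ}
    (Q : ProjectiveResolution S) : Prop where
  idempotent : IsIdempotentElem e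
  simple : IsSimpleModule Aᵐᵒᵖ S
  finiteDimensional : @Module.Finite ℂ S _ _ (ModuleCat.moduleOfAlgebraModule S)
  nontrivial : Nontrivial ((iStar e).obj S)
  finite : ∀ j, Module.Finite Aᵐᵒᵖ (Q.complex.X j)
  length : ∀ j, n ≤ j → Limits.IsZero (Q.complex.X j)
  homology_iso : ∀ j, j = 0 ∨ j + 1 = n →
    Nonempty ((((iStar e).mapHomologicalComplex _).obj Q.complex).homology j ≅ (iStar e).obj S)
  homology_zero : ∀ j, ¬ (j = 0 ∨ j + 1 = n) →
    Limits.IsZero ((((iStar e).mapHomologicalComplex _).obj Q.complex).homology j)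

/-- The endomorphism DG-algebra `𝓔nd_A(Q)` over `ℂ` of (the complex underlying) a projective
resolution `Q` of a right module over the `ℂ`-algebra `A`. -/
noncomputable def resolutionEndDG [Algebra ℂ A] {S : ModuleCat.{u} Aᵐᵒᵖ}
    (Q : ProjectiveResolution S) : DGStructure ℂ (EndGr Q.cochainComplex) :=
  endDG ℂ Q.cochainComplex

end Contraction

end AInf

set_option linter.unusedSectionVars false

/-! Write `Φ`, `Φ'` for the functors `i^*` of the two sides, followed by a transport into the
modules over one local ring `R ≅ A_con ≅ B_con`. The proof compares the endomorphism algebras of `Q`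
and `Q'` through the complexes `ΦQ` and `Φ'Q'`.

These are complexes of projective `R`-modules whose cohomology sits in the lowest and the highest
degree and is there the simple `R`-module `T`, unique because `R` is local. Such spherical complexes
are homotopy equivalent (`IsSpherical.exists_equiv`). A comparison map lifting the identity of `T`
in top degree acts on bottom cohomology by some `a : T ⟶ T`, which by Schur's lemma is zero or
invertible. Composing with a comparison map in the other direction gives `a a' = 1 + ι u`, where `ι`
includes the bottom cohomology and `u` is defined on the bottom term. If `a = 0`, then `ι u = -1`,
and subtracting the map `u ι'` makes the action on bottom cohomology invertible. A further
correction of this kind produces one-sided inverses.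

The algebra `End Q` has no cohomology in negative degrees and only the scalars in degree `0`, since
`Q` resolves `S` and `End S = ℂ`. In positive degrees `Φ` identifies its cohomology with that of
`End (ΦQ)`: injectivity holds because maps from projectives to `S` are the same before and after
`i^*`, and cocycles of degree at least `1` lift because `ΦQ` is exact strictly between its ends
(`exists_δ_eq_of_map`, `exists_map_eq`). Thus both endomorphism algebras have, in positive degrees,
the cohomology of the bimodule `Hom(ΦQ, Φ'Q')`, via the homotopy equivalence `φ`.

To turn this into an `A∞`-morphism, shift `Q` so that `φ` has degree `1`, and use `φ` as the
off-diagonal entry of the differential of a triangular complex with diagonal entries `Q'` and `Q`.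
Its endomorphism algebra `C` maps strictly to `End Q` and to `End Q'`. The kernel of `C → End Q` is,
up to shift and signs, the cone of composition with `φ`, so it is acyclic in degrees at least `2`
and possibly not below (`exists_isQuasiIso_of_cocycle`).

This is enough. A connected DG-algebra has a nonunital subalgebra `U` in positive degrees such that
the algebra retracts, up to homotopy, onto `ℂ ⊕ U`. Obstructions to lifting `U → End Q` to an
`A∞`-morphism `U → C` lie in the kernel in degrees at least `2`, as all inputs have degree at least
`1` (`exists_lift`). Project the lift to `End Q'`, extend it unitally to `ℂ ⊕ U`, and extend it
along the retraction to `End Q` (`exists_extension`). The result is unital and agrees with the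
correspondence on positive cohomology, so it is a quasi-isomorphism.

An `A∞`-morphism is handled throughout as one multilinear function `F` on words, and the equations
it must satisfy as the vanishing of a Maurer–Cartan type `defect`, solved one word length at a time.
-/

namespace AInf

/-! ### Functions on words: bar differential, convolution product, Bianchi identity. -/

/-- A DG-algebra in the normalization of the bar construction: `ρ` is the sign `x ↦ (-1) ^ (|x| - 1) x`,
and `m x y` is `(-1) ^ |x| x y`. -/
structure BarDGA (k : Type*) [CommRing k] (V : Type*) [AddCommGroup V] [Module k V] where
  D : V →ₗ[k] V
  ρ : V →ₗ[k] V
  m : V →ₗ[k] V →ₗ[k] V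
  D_D : ∀ x, D (D x) = 0
  ρ_ρ : ∀ x, ρ (ρ x) = x
  D_ρ : ∀ x, D (ρ x) = -ρ (D x)
  ρ_m : ∀ x y, ρ (m x y) = -m (ρ x) (ρ y)
  D_m : ∀ x y, D (m x y) = -m (D x) y - m (ρ x) (D y)
  m_m : ∀ x y z, m (m x y) z = -m (ρ x) (m y z)

section ListCochain

variable {k : Type*} [CommRing k] {U V : Type*} [AddCommGroup U] [Module k U]
  [AddCommGroup V] [Module k V]

/-- A function on words is multilinear if it is linear in every letter. -/
structure IsMultilin (k : Type*) [CommRing k] {U V : Type*} [AddCommGroup U] [Module k U]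
    [AddCommGroup V] [Module k V] (c : List U → V) : Prop where
  add : ∀ (l₁ l₂ : List U) (x y : U),
    c (l₁ ++ (x + y) :: l₂) = c (l₁ ++ x :: l₂) + c (l₁ ++ y :: l₂)
  smul : ∀ (l₁ l₂ : List U) (r : k) (x : U), c (l₁ ++ (r • x) :: l₂) = r • c (l₁ ++ x :: l₂)

namespace IsMultilin

variable {c c' : List U → V}

theorem cons (h : IsMultilin k c) (x : U) : IsMultilin k fun l => c (x :: l) :=
  ⟨fun l₁ l₂ => h.add (x :: l₁) l₂, fun l₁ l₂ => h.smul (x :: l₁) l₂⟩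

theorem add_head (h : IsMultilin k c) (x y : U) (l : List U) :
    c ((x + y) :: l) = c (x :: l) + c (y :: l) := h.add [] l x y

theorem smul_head (h : IsMultilin k c) (r : k) (x : U) (l : List U) :
    c ((r • x) :: l) = r • c (x :: l) := h.smul [] l r x

theorem zero_mid (h : IsMultilin k c) (l₁ l₂ : List U) : c (l₁ ++ 0 :: l₂) = 0 := by
  simpa using h.smul l₁ l₂ 0 0

theorem zero_head (h : IsMultilin k c) (l : List U) : c (0 :: l) = 0 := h.zero_mid [] l

theorem neg_head (h : IsMultilin k c) (x : U) (l : List U) : c ((-x) :: l) = -c (x :: l) := by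
  simpa using h.smul_head (-1) x l

theorem sub_head (h : IsMultilin k c) (x y : U) (l : List U) :
    c ((x - y) :: l) = c (x :: l) - c (y :: l) := by
  rw [sub_eq_add_neg, h.add_head, h.neg_head, sub_eq_add_neg]

theorem fun_add (h : IsMultilin k c) (h' : IsMultilin k c') : IsMultilin k fun l => c l + c' l :=
  ⟨fun l₁ l₂ x y => by simp only [h.add, h'.add]; abel,
    fun l₁ l₂ r x => by simp only [h.smul, h'.smul, smul_add]⟩

theorem comp (h : IsMultilin k c) {W : Type*} [AddCommGroup W] [Module k W] (f : V →ₗ[k] W) :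
    IsMultilin k fun l => f (c l) :=
  ⟨fun l₁ l₂ x y => by simp only [h.add, map_add],
    fun l₁ l₂ r x => by simp only [h.smul, map_smul]⟩

theorem fun_neg (h : IsMultilin k c) : IsMultilin k fun l => -c l :=
  h.comp (-LinearMap.id)

theorem fun_sub (h : IsMultilin k c) (h' : IsMultilin k c') : IsMultilin k fun l => c l - c' l := by
  simpa only [sub_eq_add_neg] using h.fun_add h'.fun_neg

theorem map {W : Type*} [AddCommGroup W] [Module k W] (h : IsMultilin k c) (f : W →ₗ[k] U) :
    IsMultilin k fun l => c (l.map f) :=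
  ⟨fun l₁ l₂ x y => by simp only [List.map_append, List.map_cons, map_add, h.add],
    fun l₁ l₂ r x => by simp only [List.map_append, List.map_cons, map_smul, h.smul]⟩

theorem ite_length (h : IsMultilin k c) (h' : IsMultilin k c') (n : ℕ) :
    IsMultilin k fun l => if l.length = n then c l else c' l :=
  ⟨fun l₁ l₂ x y => by
      simp only [List.length_append, List.length_cons]; split_ifs; exacts [h.add .., h'.add ..],
    fun l₁ l₂ r x => by
      simp only [List.length_append, List.length_cons]; split_ifs; exacts [h.smul .., h'.smul ..]⟩

theorem diagonal {Fs : ℕ → List U → V} (h : ∀ n, IsMultilin k (Fs n)) :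
    IsMultilin k fun l => Fs l.length l :=
  ⟨fun l₁ l₂ x y => by
      simp only [List.length_append, List.length_cons]; exact (h _).add ..,
    fun l₁ l₂ r x => by
      simp only [List.length_append, List.length_cons]; exact (h _).smul ..⟩

/-- A linear condition on the values of a multilinear function on words may be checked on words
with letters in a spanning set. -/
theorem mem_of_span (h : IsMultilin k c) {s : Set U} (hs : Submodule.span k s = ⊤)
    (T : Submodule k V) (hT : ∀ l : List U, (∀ x ∈ l, x ∈ s) → c l ∈ T) (l : List U) : c l ∈ T := by
  suffices H : ∀ l₂ l₁ : List U, (∀ x ∈ l₁, x ∈ s) → c (l₁ ++ l₂) ∈ T from H l [] (by simp)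
  intro l₂
  induction l₂ with
  | nil => intro l₁ h₁; simpa using hT l₁ h₁
  | cons x l₂ ih =>
    intro l₁ h₁
    have hx : x ∈ Submodule.span k s := hs ▸ Submodule.mem_top
    induction hx using Submodule.span_induction with
    | mem x hx =>
      have := ih (l₁ ++ [x]) (by
        intro y hy
        rcases List.mem_append.1 hy with hy | hy
        · exact h₁ y hy
        · obtain rfl := List.mem_singleton.1 hy
          exact hx)
      simpa using this
    | zero => rw [h.zero_mid]; exact T.zero_mem
    | add x y _ _ hx hy => rw [h.add]; exact T.add_mem hx hy
    | smul r x _ hx => rw [h.smul]; exact T.smul_mem r hx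

end IsMultilin

namespace BarDGA

variable (𝒰 : BarDGA k U) (𝒱 : BarDGA k V)

/-- Precomposition of a function on words with the part of the bar differential which comes from
the differential. -/
def bar₁ : (List U → V) → List U → V
  | _, [] => 0
  | c, x :: l => c (𝒰.D x :: l) + bar₁ (fun t => c (𝒰.ρ x :: t)) l

/-- Precomposition of a function on words with the part of the bar differential which comes from
the multiplication. -/
def bar₂ : (List U → V) → List U → V
  | _, [] => 0
  | _, [_] => 0
  | c, x :: y :: l => c (𝒰.m x y :: l) + bar₂ (fun t => c (𝒰.ρ x :: t)) (y :: l)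

theorem bar₁_nil (c : List U → V) : 𝒰.bar₁ c [] = 0 := by rw [bar₁]
theorem bar₁_cons (c : List U → V) (x : U) (l : List U) :
    𝒰.bar₁ c (x :: l) = c (𝒰.D x :: l) + 𝒰.bar₁ (fun t => c (𝒰.ρ x :: t)) l := by rw [bar₁]
theorem bar₂_nil (c : List U → V) : 𝒰.bar₂ c [] = 0 := by rw [bar₂]
theorem bar₂_singleton (c : List U → V) (x : U) : 𝒰.bar₂ c [x] = 0 := by rw [bar₂]
theorem bar₂_cons_cons (c : List U → V) (x y : U) (l : List U) :
    𝒰.bar₂ c (x :: y :: l) =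
      c (𝒰.m x y :: l) + 𝒰.bar₂ (fun t => c (𝒰.ρ x :: t)) (y :: l) := by rw [bar₂]

variable {𝒰} in
theorem bar₁_congr {c c' : List U → V} {l : List U} (h : ∀ t, t.length = l.length → c t = c' t) :
    𝒰.bar₁ c l = 𝒰.bar₁ c' l := by
  induction l generalizing c c' with
  | nil => rw [bar₁_nil, bar₁_nil]
  | cons x l ih =>
    rw [bar₁_cons, bar₁_cons, h _ (by simp), ih fun t ht => h _ (by simp [ht])]

variable {𝒰} in
theorem bar₂_congr {c c' : List U → V} {l : List U}
    (h : ∀ t, t.length + 1 = l.length → c t = c' t) : 𝒰.bar₂ c l = 𝒰.bar₂ c' l := by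
  induction l generalizing c c' with
  | nil => rw [bar₂_nil, bar₂_nil]
  | cons x l ih =>
    cases l with
    | nil => rw [bar₂_singleton, bar₂_singleton]
    | cons y l =>
      rw [bar₂_cons_cons, bar₂_cons_cons, h _ (by simp),
        ih fun t ht => h _ (by simp at ht ⊢; omega)]

theorem bar₁_map {W : Type*} [AddCommGroup W] [Module k W] (f : V →ₗ[k] W) (c : List U → V)
    (l : List U) : 𝒰.bar₁ (fun t => f (c t)) l = f (𝒰.bar₁ c l) := by
  induction l generalizing c with
  | nil => simp [bar₁_nil]
  | cons x l ih => rw [bar₁_cons, bar₁_cons, map_add, ih fun t => c (𝒰.ρ x :: t)]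

theorem bar₂_map {W : Type*} [AddCommGroup W] [Module k W] (f : V →ₗ[k] W) (c : List U → V)
    (l : List U) : 𝒰.bar₂ (fun t => f (c t)) l = f (𝒰.bar₂ c l) := by
  induction l generalizing c with
  | nil => simp [bar₂_nil]
  | cons x l ih =>
    cases l with
    | nil => simp [bar₂_singleton]
    | cons y l =>
      rw [bar₂_cons_cons, bar₂_cons_cons, map_add, ih fun t => c (𝒰.ρ x :: t)]

theorem bar₁_add (c c' : List U → V) (l : List U) :
    𝒰.bar₁ (fun t => c t + c' t) l = 𝒰.bar₁ c l + 𝒰.bar₁ c' l := by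
  induction l generalizing c c' with
  | nil => simp [bar₁_nil]
  | cons x l ih =>
    rw [bar₁_cons, bar₁_cons, bar₁_cons, ih (fun t => c (𝒰.ρ x :: t)) fun t => c' (𝒰.ρ x :: t)]
    abel

theorem bar₂_add (c c' : List U → V) (l : List U) :
    𝒰.bar₂ (fun t => c t + c' t) l = 𝒰.bar₂ c l + 𝒰.bar₂ c' l := by
  induction l generalizing c c' with
  | nil => simp [bar₂_nil]
  | cons x l ih =>
    cases l with
    | nil => simp [bar₂_singleton]
    | cons y l =>
      rw [bar₂_cons_cons, bar₂_cons_cons, bar₂_cons_cons,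
        ih (fun t => c (𝒰.ρ x :: t)) fun t => c' (𝒰.ρ x :: t)]
      abel

theorem bar₁_zero (l : List U) : 𝒰.bar₁ (fun _ => (0 : V)) l = 0 := by
  simpa using 𝒰.bar₁_map (0 : V →ₗ[k] V) (fun _ => 0) l

theorem bar₂_zero (l : List U) : 𝒰.bar₂ (fun _ => (0 : V)) l = 0 := by
  simpa using 𝒰.bar₂_map (0 : V →ₗ[k] V) (fun _ => 0) l

theorem bar₁_neg (c : List U → V) (l : List U) :
    𝒰.bar₁ (fun t => -c t) l = -𝒰.bar₁ c l :=
  𝒰.bar₁_map (k := k) (-LinearMap.id : V →ₗ[k] V) c l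

theorem bar₂_neg (c : List U → V) (l : List U) :
    𝒰.bar₂ (fun t => -c t) l = -𝒰.bar₂ c l :=
  𝒰.bar₂_map (k := k) (-LinearMap.id : V →ₗ[k] V) c l

theorem bar₁_sub (c c' : List U → V) (l : List U) :
    𝒰.bar₁ (fun t => c t - c' t) l = 𝒰.bar₁ c l - 𝒰.bar₁ c' l := by
  simp only [sub_eq_add_neg]
  rw [bar₁_add, bar₁_neg]

theorem bar₂_sub (c c' : List U → V) (l : List U) :
    𝒰.bar₂ (fun t => c t - c' t) l = 𝒰.bar₂ c l - 𝒰.bar₂ c' l := by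
  simp only [sub_eq_add_neg]
  rw [bar₂_add, bar₂_neg]

theorem bar₁_smul (r : k) (c : List U → V) (l : List U) :
    𝒰.bar₁ (fun t => r • c t) l = r • 𝒰.bar₁ c l :=
  𝒰.bar₁_map (r • LinearMap.id : V →ₗ[k] V) c l

theorem bar₂_smul (r : k) (c : List U → V) (l : List U) :
    𝒰.bar₂ (fun t => r • c t) l = r • 𝒰.bar₂ c l :=
  𝒰.bar₂_map (r • LinearMap.id : V →ₗ[k] V) c l

theorem isMultilin_bar₁ {c : List U → V} (h : IsMultilin k c) : IsMultilin k (𝒰.bar₁ c) := by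
  constructor
  · intro l₁ l₂ x y
    induction l₁ generalizing c with
    | nil =>
      simp only [List.nil_append, bar₁_cons, map_add, h.add_head, bar₁_add]
      abel
    | cons z l₁ ih =>
      simp only [List.cons_append, bar₁_cons, ih (h.cons (𝒰.ρ z))]
      have := h.add (𝒰.D z :: l₁) l₂ x y
      simp only [List.cons_append] at this
      rw [this]; abel
  · intro l₁ l₂ r x
    induction l₁ generalizing c with
    | nil => simp only [List.nil_append, bar₁_cons, map_smul, h.smul_head, bar₁_smul, smul_add]
    | cons z l₁ ih =>
      simp only [List.cons_append, bar₁_cons, ih (h.cons (𝒰.ρ z)), smul_add]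
      have := h.smul (𝒰.D z :: l₁) l₂ r x
      simp only [List.cons_append] at this
      rw [this]

theorem isMultilin_bar₂ {c : List U → V} (h : IsMultilin k c) : IsMultilin k (𝒰.bar₂ c) := by
  constructor
  · intro l₁ l₂ x y
    induction l₁ generalizing c with
    | nil =>
      cases l₂ with
      | nil => simp [bar₂_singleton]
      | cons w l₂ =>
        simp only [List.nil_append, bar₂_cons_cons, map_add, LinearMap.add_apply, h.add_head,
          bar₂_add]
        abel
    | cons z l₁ ih =>
      cases l₁ with
      | nil =>
        have ih := ih (h.cons (𝒰.ρ z))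
        simp only [List.nil_append, List.cons_append, bar₂_cons_cons, map_add, h.add_head] at ih ⊢
        rw [ih]; abel
      | cons z' l₁ =>
        have ih := ih (h.cons (𝒰.ρ z))
        have := h.add (𝒰.m z z' :: l₁) l₂ x y
        simp only [List.cons_append, bar₂_cons_cons] at ih this ⊢
        rw [ih, this]; abel
  · intro l₁ l₂ r x
    induction l₁ generalizing c with
    | nil =>
      cases l₂ with
      | nil => simp [bar₂_singleton]
      | cons w l₂ =>
        simp only [List.nil_append, bar₂_cons_cons, map_smul, LinearMap.smul_apply, h.smul_head,
          bar₂_smul, smul_add]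
    | cons z l₁ ih =>
      cases l₁ with
      | nil =>
        have ih := ih (h.cons (𝒰.ρ z))
        simp only [List.nil_append, List.cons_append, bar₂_cons_cons, map_smul, h.smul_head]
          at ih ⊢
        rw [ih, smul_add]
      | cons z' l₁ =>
        have ih := ih (h.cons (𝒰.ρ z))
        have := h.smul (𝒰.m z z' :: l₁) l₂ r x
        simp only [List.cons_append, bar₂_cons_cons] at ih this ⊢
        rw [ih, this, smul_add]

/-- Differentiating two distinct letters in either order gives opposite signs because `D`
anticommutes with `ρ`; differentiating the same letter twice gives zero. -/
theorem bar₁_bar₁ {c : List U → V} (h : IsMultilin k c) (l : List U) :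
    𝒰.bar₁ (𝒰.bar₁ c) l = 0 := by
  induction l generalizing c with
  | nil => rw [bar₁_nil]
  | cons x l ih =>
    simp only [bar₁_cons, 𝒰.D_D, h.zero_head, bar₁_add, 𝒰.ρ_ρ, 𝒰.D_ρ, h.neg_head, bar₁_neg,
      ih (h.cons x)]
    abel

/-- Unfolding `bar₂ c (x :: t)` requires knowing whether `t` is empty. The summand multiplying `x`
with the first letter of `t` is therefore kept as a case distinction, with value zero on the empty
word, so that the outer recursion can proceed. -/
theorem bar₂_head (c : List U → V) (x y : U) (l : List U) :
    𝒰.bar₂ (fun t => 𝒰.bar₂ c (x :: t)) (y :: l) =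
      𝒰.bar₂ (fun t => t.casesOn 0 fun z t => c (𝒰.m x z :: t)) (y :: l) +
        𝒰.bar₂ (𝒰.bar₂ fun t => c (𝒰.ρ x :: t)) (y :: l) := by
  rw [← bar₂_add]
  refine bar₂_congr fun t ht => ?_
  cases t with
  | nil => simp [bar₂_nil, bar₂_singleton]
  | cons z t => rw [bar₂_cons_cons]

theorem bar₁_head (c : List U → V) (x : U) (y : U) (l : List U) :
    𝒰.bar₁ (fun t => 𝒰.bar₂ c (x :: t)) (y :: l) =
      𝒰.bar₁ (fun t => t.casesOn 0 fun z t => c (𝒰.m x z :: t)) (y :: l) +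
        𝒰.bar₁ (𝒰.bar₂ fun t => c (𝒰.ρ x :: t)) (y :: l) := by
  rw [← bar₁_add]
  refine bar₁_congr fun t ht => ?_
  cases t with
  | nil => simp at ht
  | cons z t => rw [bar₂_cons_cons]

/-- Products at disjoint places cancel by the sign in `ρ_m`; products sharing a letter cancel by
associativity in the form `m_m`. -/
theorem bar₂_bar₂ {c : List U → V} (h : IsMultilin k c) (l : List U) :
    𝒰.bar₂ (𝒰.bar₂ c) l = 0 := by
  induction l generalizing c with
  | nil => rw [bar₂_nil]
  | cons x l ih =>
    cases l with
    | nil => rw [bar₂_singleton]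
    | cons y l =>
      rw [bar₂_cons_cons, bar₂_head]
      simp only [𝒰.ρ_ρ, ih (h.cons x), add_zero]
      cases l with
      | nil => simp [bar₂_singleton]
      | cons z l =>
        simp only [bar₂_cons_cons, 𝒰.m_m, 𝒰.ρ_m, h.neg_head, bar₂_neg]
        abel

/-- The Leibniz rule `D_m` accounts for differentiating a product just formed; at disjoint places
the two operations anticommute by the signs `D_ρ` and `ρ_m`. -/
theorem bar₁_bar₂ {c : List U → V} (h : IsMultilin k c) (l : List U) :
    𝒰.bar₁ (𝒰.bar₂ c) l + 𝒰.bar₂ (𝒰.bar₁ c) l = 0 := by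
  induction l generalizing c with
  | nil => simp [bar₁_nil, bar₂_nil]
  | cons x l ih =>
    cases l with
    | nil => simp [bar₁_cons, bar₁_nil, bar₂_singleton]
    | cons y l =>
      have ih := eq_neg_of_add_eq_zero_left (ih (h.cons x))
      have e₁ (c' : List U → V) : 𝒰.bar₁ (fun t => t.casesOn 0 fun z t => c' (𝒰.m (𝒰.ρ x) z :: t))
          (y :: l) = c' (𝒰.m (𝒰.ρ x) (𝒰.D y) :: l) +
            𝒰.bar₁ (fun t => c' (𝒰.m (𝒰.ρ x) (𝒰.ρ y) :: t)) l := by rw [bar₁_cons]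
      have e₂ : 𝒰.bar₂ (fun t => 𝒰.bar₁ c (𝒰.ρ x :: t)) (y :: l) =
          -𝒰.bar₂ (fun t => c (𝒰.ρ (𝒰.D x) :: t)) (y :: l) +
            𝒰.bar₂ (𝒰.bar₁ fun t => c (x :: t)) (y :: l) := by
        simp only [bar₁_cons _ c, bar₂_add, 𝒰.ρ_ρ, 𝒰.D_ρ, h.neg_head, bar₂_neg]
      rw [bar₁_cons, bar₁_head, bar₂_cons_cons, bar₂_cons_cons, e₁, e₂, 𝒰.ρ_ρ, ih, bar₁_cons,
        𝒰.D_m, h.sub_head, h.neg_head, 𝒰.ρ_m]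
      simp only [h.neg_head, bar₁_neg]
      abel

/-- Precomposition of a function on words with the bar differential. -/
def bar (c : List U → V) (l : List U) : V := 𝒰.bar₁ c l + 𝒰.bar₂ c l

theorem bar_bar {c : List U → V} (h : IsMultilin k c) (l : List U) : 𝒰.bar (𝒰.bar c) l = 0 := by
  have := 𝒰.bar₁_bar₂ h l
  have e : 𝒰.bar c = fun t => 𝒰.bar₁ c t + 𝒰.bar₂ c t := rfl
  rw [bar, e, bar₁_add, bar₂_add, bar₁_bar₁ 𝒰 h, bar₂_bar₂ 𝒰 h, zero_add, add_zero, this]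

/-- The product of two functions on words with values in a DG-algebra. -/
def cup : (List U → V) → (List U → V) → List U → V
  | F, G, [] => 𝒱.m (F []) (G [])
  | F, G, x :: l => 𝒱.m (F []) (G (x :: l)) + cup (fun t => F (x :: t)) G l

theorem cup_nil (F G : List U → V) : 𝒱.cup F G [] = 𝒱.m (F []) (G []) := by rw [cup]
theorem cup_cons (F G : List U → V) (x : U) (l : List U) :
    𝒱.cup F G (x :: l) = 𝒱.m (F []) (G (x :: l)) + 𝒱.cup (fun t => F (x :: t)) G l := by rw [cup]

theorem cup_add_left (F F' G : List U → V) (l : List U) :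
    𝒱.cup (fun t => F t + F' t) G l = 𝒱.cup F G l + 𝒱.cup F' G l := by
  induction l generalizing F F' with
  | nil => simp [cup_nil]
  | cons x l ih =>
    simp only [cup_cons, map_add, LinearMap.add_apply, ih (fun t => F (x :: t))]
    abel

theorem cup_smul_left (r : k) (F G : List U → V) (l : List U) :
    𝒱.cup (fun t => r • F t) G l = r • 𝒱.cup F G l := by
  induction l generalizing F with
  | nil => simp [cup_nil]
  | cons x l ih =>
    simp only [cup_cons, map_smul, LinearMap.smul_apply, ih (fun t => F (x :: t)), smul_add]

theorem cup_neg_left (F G : List U → V) (l : List U) :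
    𝒱.cup (fun t => -F t) G l = -𝒱.cup F G l := by
  simpa using 𝒱.cup_smul_left (-1) F G l

theorem cup_sub_left (F F' G : List U → V) (l : List U) :
    𝒱.cup (fun t => F t - F' t) G l = 𝒱.cup F G l - 𝒱.cup F' G l := by
  simp only [sub_eq_add_neg]
  rw [cup_add_left, cup_neg_left]

theorem cup_add_right (F G G' : List U → V) (l : List U) :
    𝒱.cup F (fun t => G t + G' t) l = 𝒱.cup F G l + 𝒱.cup F G' l := by
  induction l generalizing F with
  | nil => simp [cup_nil]
  | cons x l ih =>
    simp only [cup_cons, map_add, ih]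
    abel

theorem cup_smul_right (r : k) (F G : List U → V) (l : List U) :
    𝒱.cup F (fun t => r • G t) l = r • 𝒱.cup F G l := by
  induction l generalizing F with
  | nil => simp [cup_nil]
  | cons x l ih => simp only [cup_cons, map_smul, ih, smul_add]

theorem cup_neg_right (F G : List U → V) (l : List U) :
    𝒱.cup F (fun t => -G t) l = -𝒱.cup F G l := by
  simpa using 𝒱.cup_smul_right (-1) F G l

theorem cup_sub_right (F G G' : List U → V) (l : List U) :
    𝒱.cup F (fun t => G t - G' t) l = 𝒱.cup F G l - 𝒱.cup F G' l := by
  simp only [sub_eq_add_neg]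
  rw [cup_add_right, cup_neg_right]

/-- The product of two functions on words vanishes if all summands vanish. -/
theorem cup_mem {T : Submodule k V} {F G : List U → V} {l : List U}
    (h : ∀ l₁ l₂, l₁ ++ l₂ = l → 𝒱.m (F l₁) (G l₂) ∈ T) : 𝒱.cup F G l ∈ T := by
  induction l generalizing F with
  | nil => rw [cup_nil]; exact h [] [] rfl
  | cons x l ih =>
    rw [cup_cons]
    exact T.add_mem (h [] _ rfl) (ih fun l₁ l₂ hl => h (x :: l₁) l₂ (by rw [List.cons_append, hl]))

theorem cup_congr {F G F' G' : List U → V} {l : List U}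
    (h : ∀ l₁ l₂, l₁ ++ l₂ = l → 𝒱.m (F l₁) (G l₂) = 𝒱.m (F' l₁) (G' l₂)) :
    𝒱.cup F G l = 𝒱.cup F' G' l := by
  induction l generalizing F F' with
  | nil => rw [cup_nil, cup_nil]; exact h [] [] rfl
  | cons x l ih =>
    rw [cup_cons, cup_cons, h [] _ rfl,
      ih fun l₁ l₂ hl => h (x :: l₁) l₂ (by rw [List.cons_append, hl])]

theorem isMultilin_cup {F G : List U → V} (hF : IsMultilin k F) (hG : IsMultilin k G) :
    IsMultilin k (𝒱.cup F G) := by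
  constructor
  · intro l₁ l₂ x y
    induction l₁ generalizing F with
    | nil =>
      simp only [List.nil_append, cup_cons, hG.add_head, map_add, hF.add_head, cup_add_left]
      abel
    | cons z l₁ ih =>
      have := hG.add (z :: l₁) l₂ x y
      simp only [List.cons_append, cup_cons, ih (hF.cons z)] at this ⊢
      rw [this, map_add]; abel
  · intro l₁ l₂ r x
    induction l₁ generalizing F with
    | nil =>
      simp only [List.nil_append, cup_cons, hG.smul_head, map_smul, hF.smul_head, cup_smul_left,
        smul_add]
    | cons z l₁ ih =>
      have := hG.smul (z :: l₁) l₂ r x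
      simp only [List.cons_append, cup_cons, ih (hF.cons z)] at this ⊢
      rw [this, map_smul, smul_add]

theorem D_cup (F G : List U → V) (l : List U) :
    𝒱.D (𝒱.cup F G l) =
      -𝒱.cup (fun t => 𝒱.D (F t)) G l - 𝒱.cup (fun t => 𝒱.ρ (F t)) (fun t => 𝒱.D (G t)) l := by
  induction l generalizing F with
  | nil => simp [cup_nil, 𝒱.D_m]
  | cons x l ih =>
    simp only [cup_cons, map_add, 𝒱.D_m, ih]
    abel

theorem cup_m_left (v : V) (G H : List U → V) (l : List U) :
    𝒱.cup (fun t => 𝒱.m v (G t)) H l = -𝒱.m (𝒱.ρ v) (𝒱.cup G H l) := by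
  induction l generalizing G with
  | nil => simp [cup_nil, 𝒱.m_m]
  | cons y l ih =>
    simp only [cup_cons, 𝒱.m_m, map_add, ih fun t => G (y :: t)]
    abel

/-- Both sides sum over cuts of the word into three blocks; the sign comes from `m_m`. -/
theorem cup_cup (F G H : List U → V) (l : List U) :
    𝒱.cup (𝒱.cup F G) H l = -𝒱.cup (fun t => 𝒱.ρ (F t)) (𝒱.cup G H) l := by
  induction l generalizing F G with
  | nil => simp [cup_nil, 𝒱.m_m]
  | cons x l ih =>
    simp only [cup_cons, cup_nil, cup_add_left, ih, map_add, 𝒱.m_m, cup_m_left]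
    abel

theorem bar₁_cup (F G : List U → V) (l : List U) :
    𝒰.bar₁ (𝒱.cup F G) l =
      𝒱.cup (𝒰.bar₁ F) G l + 𝒱.cup (fun t => F (t.map 𝒰.ρ)) (𝒰.bar₁ G) l := by
  induction l generalizing F with
  | nil => simp [cup_nil, bar₁_nil]
  | cons x l ih =>
    simp only [bar₁_cons, cup_cons, bar₁_nil, bar₁_add, cup_add_left, ih, map_zero,
      LinearMap.zero_apply, map_add, List.map_nil, List.map_cons]
    rw [bar₁_map 𝒰 (𝒱.m (F [])) fun t => G (𝒰.ρ x :: t)]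
    abel

theorem bar₂_cup (F G : List U → V) (l : List U) :
    𝒰.bar₂ (𝒱.cup F G) l =
      𝒱.cup (𝒰.bar₂ F) G l + 𝒱.cup (fun t => F (t.map 𝒰.ρ)) (𝒰.bar₂ G) l := by
  induction l generalizing F with
  | nil => simp [cup_nil, bar₂_nil]
  | cons x l ih =>
    cases l with
    | nil => simp [cup_nil, cup_cons, bar₂_nil, bar₂_singleton]
    | cons y l =>
      have e : 𝒱.cup (fun t => 𝒰.bar₂ F (x :: t)) G (y :: l) =
          𝒱.cup (fun t => F (𝒰.m x y :: t)) G l +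
            𝒱.cup (𝒰.bar₂ fun t => F (𝒰.ρ x :: t)) G (y :: l) := by
        simp only [cup_cons, bar₂_cons_cons, bar₂_singleton, bar₂_nil, map_zero,
          LinearMap.zero_apply, cup_add_left]
        abel
      have e' : 𝒰.bar₂ (fun t => 𝒱.cup F G (𝒰.ρ x :: t)) (y :: l) =
          𝒱.m (F []) (𝒰.bar₂ (fun t => G (𝒰.ρ x :: t)) (y :: l)) +
            𝒰.bar₂ (𝒱.cup (fun t => F (𝒰.ρ x :: t)) G) (y :: l) := by
        rw [← bar₂_map, ← bar₂_add]
        exact bar₂_congr fun t _ => 𝒱.cup_cons F G _ t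
      rw [bar₂_cons_cons, e', ih, cup_cons, cup_cons _ (𝒰.bar₂ F), e, bar₂_nil, cup_cons _ _ _ x,
        bar₂_cons_cons]
      simp only [map_zero, LinearMap.zero_apply, map_add, List.map_nil, List.map_cons]
      abel

/-- The bar differential is a coderivation for deconcatenation: the letter it produces lies entirely
on one side of the cut. Acting on the second block, it passes all letters of the first, which
produces the `ρ`'s. -/
theorem bar_cup (F G : List U → V) (l : List U) :
    𝒰.bar (𝒱.cup F G) l =
      𝒱.cup (𝒰.bar F) G l + 𝒱.cup (fun t => F (t.map 𝒰.ρ)) (𝒰.bar G) l := by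
  have e : 𝒰.bar F = fun t => 𝒰.bar₁ F t + 𝒰.bar₂ F t := rfl
  have e' : 𝒰.bar G = fun t => 𝒰.bar₁ G t + 𝒰.bar₂ G t := rfl
  rw [e, e', cup_add_left, cup_add_right, bar, bar₁_cup, bar₂_cup]
  abel

/-- The defect of a function on words from being an `A∞`-morphism. -/
def defect (F : List U → V) (l : List U) : V := 𝒱.D (F l) + 𝒱.cup F F l - 𝒰.bar F l

theorem isMultilin_defect {F : List U → V} (hF : IsMultilin k F) :
    IsMultilin k (defect 𝒰 𝒱 F) :=
  ((hF.comp 𝒱.D).fun_add (𝒱.isMultilin_cup hF hF)).fun_sub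
    ((𝒰.isMultilin_bar₁ hF).fun_add (𝒰.isMultilin_bar₂ hF))

theorem bar_map {W : Type*} [AddCommGroup W] [Module k W] (f : V →ₗ[k] W) (c : List U → V)
    (l : List U) : 𝒰.bar (fun t => f (c t)) l = f (𝒰.bar c l) := by
  rw [bar, bar, bar₁_map, bar₂_map, map_add]

/-- The Bianchi identity. -/
theorem D_defect {F : List U → V} (hF : IsMultilin k F)
    (hρ : ∀ l, 𝒱.ρ (F l) = F (l.map 𝒰.ρ)) (l : List U) :
    𝒱.D (defect 𝒰 𝒱 F l) = -𝒱.cup (defect 𝒰 𝒱 F) F l -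
      𝒱.cup (fun t => 𝒱.ρ (F t)) (defect 𝒰 𝒱 F) l - 𝒰.bar (defect 𝒰 𝒱 F) l := by
  -- Of the three summands of the defect, the last disappears since the bar differential squares to
  -- zero, and the product term splits by the derivation rule; `hρ` moves the sign from the letters
  -- to the value of `F`.
  have e₁ : 𝒰.bar (defect 𝒰 𝒱 F) l = 𝒱.D (𝒰.bar F l) + 𝒱.cup (𝒰.bar F) F l +
      𝒱.cup (fun t => 𝒱.ρ (F t)) (𝒰.bar F) l := by
    have : 𝒰.bar (defect 𝒰 𝒱 F) l =
        𝒰.bar (fun t => 𝒱.D (F t)) l + 𝒰.bar (𝒱.cup F F) l - 𝒰.bar (𝒰.bar F) l := by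
      have e : defect 𝒰 𝒱 F = fun t => 𝒱.D (F t) + 𝒱.cup F F t - 𝒰.bar F t := rfl
      rw [e]
      rw [bar, bar₁_sub, bar₁_add, bar₂_sub, bar₂_add]
      simp only [bar]
      abel
    rw [this, bar_map, bar_cup, bar_bar 𝒰 hF]
    simp only [← hρ]
    abel
  have e : defect 𝒰 𝒱 F = fun t => 𝒱.D (F t) + 𝒱.cup F F t - 𝒰.bar F t := rfl
  rw [e₁, e]
  simp only [map_add, map_sub, 𝒱.D_D, D_cup, cup_sub_left, cup_add_left, cup_sub_right,
    cup_add_right, cup_cup]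
  abel

end BarDGA

end ListCochain

end AInf

namespace AInf

namespace BarDGA

/-! ### Solving the defect equation one word length at a time. -/

section Existence

variable {k : Type*} [CommRing k] {U V : Type*} [AddCommGroup U] [Module k U]
  [AddCommGroup V] [Module k V] {𝒰 : BarDGA k U} {𝒱 : BarDGA k V}

theorem bar₁_mem {T : Submodule k V} {c : List U → V} {l : List U}
    (h : ∀ t, t.length = l.length → c t ∈ T) : 𝒰.bar₁ c l ∈ T := by
  induction l generalizing c with
  | nil => rw [bar₁_nil]; exact T.zero_mem
  | cons x l ih =>
    rw [bar₁_cons]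
    exact T.add_mem (h _ (by simp)) (ih fun t ht => h _ (by simp [ht]))

theorem bar₂_mem {T : Submodule k V} {c : List U → V} {l : List U}
    (h : ∀ t, t.length + 1 = l.length → c t ∈ T) : 𝒰.bar₂ c l ∈ T := by
  induction l generalizing c with
  | nil => rw [bar₂_nil]; exact T.zero_mem
  | cons x l ih =>
    cases l with
    | nil => rw [bar₂_singleton]; exact T.zero_mem
    | cons y l =>
      rw [bar₂_cons_cons]
      exact T.add_mem (h _ (by simp)) (ih fun t ht => h _ (by simp at ht ⊢; omega))

theorem bar₁_eq_zero {c : List U → V} {l : List U}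
    (h : ∀ t, t.length = l.length → c t = 0) : 𝒰.bar₁ c l = 0 := by
  rw [← 𝒰.bar₁_zero l]; exact bar₁_congr h

theorem bar₂_eq_zero {c : List U → V} {l : List U}
    (h : ∀ t, t.length + 1 = l.length → c t = 0) : 𝒰.bar₂ c l = 0 := by
  rw [← 𝒰.bar₂_zero l]; exact bar₂_congr h

theorem cup_eq_zero {F G : List U → V} {l : List U}
    (h : ∀ l₁ l₂, l₁ ++ l₂ = l → 𝒱.m (F l₁) (G l₂) = 0) : 𝒱.cup F G l = 0 := by
  have := 𝒱.cup_mem (T := ⊥) (F := F) (G := G) (l := l) fun l₁ l₂ hl => by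
    rw [Submodule.mem_bot]; exact h l₁ l₂ hl
  simpa using this

theorem defect_congr {F G : List U → V} {l : List U}
    (h : ∀ t, t.length ≤ l.length → F t = G t) : defect 𝒰 𝒱 F l = defect 𝒰 𝒱 G l := by
  have e : 𝒱.cup F F l = 𝒱.cup G G l := cup_congr _ fun l₁ l₂ hl => by
    rw [h l₁ (by simp [← hl]), h l₂ (by simp [← hl])]
  rw [defect, defect, h l le_rfl, e, bar, bar, bar₁_congr fun t ht => h t ht.le,
    bar₂_congr fun t ht => h t (by omega)]

theorem defect_nil {F : List U → V} (h : F [] = 0) : defect 𝒰 𝒱 F [] = 0 := by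
  simp [defect, bar, bar₁_nil, bar₂_nil, cup_nil, h]

theorem defect_singleton {F : List U → V} (h : F [] = 0) (u : U) :
    defect 𝒰 𝒱 F [u] = 𝒱.D (F [u]) - F [𝒰.D u] := by
  simp [defect, bar, bar₁_nil, bar₂_singleton, bar₁_cons, cup_nil, cup_cons, h]

theorem defect_pair {F : List U → V} (h : F [] = 0) (u v : U) :
    defect 𝒰 𝒱 F [u, v] = 𝒱.D (F [u, v]) + 𝒱.m (F [u]) (F [v]) -
      (F [𝒰.D u, v] + F [𝒰.ρ u, 𝒰.D v] + F [𝒰.m u v]) := by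
  simp [defect, bar, bar₁_nil, bar₂_singleton, bar₁_cons, bar₂_cons_cons, cup_nil, cup_cons, h]

/-- Solving the equation `defect F = 0` by induction on the length of words. -/
theorem exists_defect_eq_zero (Good : (List U → V) → Prop)
    (hdiag : ∀ Fs : ℕ → List U → V, (∀ n, Good (Fs n)) → Good fun l => Fs l.length l)
    (step : ∀ (n : ℕ) (F : List U → V), Good F → (∀ l, l.length < n → defect 𝒰 𝒱 F l = 0) →
      ∃ G, Good G ∧ (∀ l, l.length < n → G l = F l) ∧ ∀ l, l.length = n → defect 𝒰 𝒱 G l = 0)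
    (F₀ : List U → V) (hF₀ : Good F₀) :
    ∃ F, Good F ∧ ∀ l, defect 𝒰 𝒱 F l = 0 := by
  choose! G hG using step
  -- `seq n` solves the equation on words shorter than `n`, and stage `n` leaves those words
  -- unchanged. The limit therefore reads its value on `l` off stage `l.length + 1`.
  let seq : ℕ → List U → V := fun n => Nat.rec F₀ G n
  have hseq : ∀ n, Good (seq n) ∧ ∀ l, l.length < n → defect 𝒰 𝒱 (seq n) l = 0 := by
    intro n
    induction n with
    | zero => exact ⟨hF₀, fun l hl => by omega⟩
    | succ n ih =>
      obtain ⟨h₁, h₂, h₃⟩ := hG n (seq n) ih.1 ih.2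
      refine ⟨h₁, fun l hl => ?_⟩
      rcases Nat.lt_succ_iff_lt_or_eq.1 hl with hl | hl
      · rw [← ih.2 l hl]
        exact defect_congr fun t ht => h₂ t (by omega)
      · exact h₃ l hl
  have hstab : ∀ n l, l.length < n → seq n l = seq (l.length + 1) l := by
    intro n l hl
    induction n with
    | zero => omega
    | succ n ih =>
      rcases Nat.lt_succ_iff_lt_or_eq.1 hl with hl | hl
      · rw [← ih hl]
        exact (hG n (seq n) (hseq n).1 (hseq n).2).2.1 l hl
      · rw [hl]
  refine ⟨fun l => seq (l.length + 1) l, hdiag (fun n => seq (n + 1)) fun n => (hseq (n + 1)).1,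
    fun l => ?_⟩
  rw [← (hseq (l.length + 1)).2 l (by omega)]
  exact defect_congr fun t ht => (hstab (l.length + 1) t (by omega)).symm

/-- The effect on the defect of a correction in one length. -/
theorem defect_add {n : ℕ} {F β : List U → V} (hF : F [] = 0) (hβ : β [] = 0)
    {l : List U} (hl : l.length = n) :
    defect 𝒰 𝒱 (fun t => if t.length = n then F t + β t else F t) l =
      defect 𝒰 𝒱 F l + 𝒱.D (β l) - 𝒰.bar₁ β l := by
  -- A cut into two nonempty blocks has both blocks shorter than `n`, where nothing changed; a cut
  -- with an empty block contributes zero before and after, as both functions vanish on the empty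
  -- word.
  have e₁ : 𝒱.cup (fun t => if t.length = n then F t + β t else F t)
      (fun t => if t.length = n then F t + β t else F t) l = 𝒱.cup F F l := by
    refine cup_congr _ fun l₁ l₂ h => ?_
    by_cases h₁ : l₁ = []
    · subst h₁; simp [hF, hβ]
    by_cases h₂ : l₂ = []
    · subst h₂; simp [hF, hβ]
    have h₁ := List.length_pos_iff.2 h₁
    have h₂ := List.length_pos_iff.2 h₂
    have : l₁.length + l₂.length = n := by rw [← hl, ← h, List.length_append]
    rw [if_neg (by omega), if_neg (by omega)]
  have e₂ : 𝒰.bar₁ (fun t => if t.length = n then F t + β t else F t) l =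
      𝒰.bar₁ F l + 𝒰.bar₁ β l := by
    rw [← bar₁_add]
    exact bar₁_congr fun t ht => if_pos (ht.trans hl)
  -- Multiplying letters shortens the word, so the correction is not seen.
  have e₃ : 𝒰.bar₂ (fun t => if t.length = n then F t + β t else F t) l = 𝒰.bar₂ F l :=
    bar₂_congr fun t ht => if_neg (by omega)
  rw [defect, defect, e₁, bar, bar, e₂, e₃, if_pos hl, map_add]
  abel

/-- In the first length where the defect may be nonzero, every term of the Bianchi identity except
`bar₁` involves the defect on a shorter word or the value `F []`. What remains says that the
obstruction is a cocycle. -/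
theorem D_defect_of_vanishing {F : List U → V} (hF : IsMultilin k F)
    (hρ : ∀ l, 𝒱.ρ (F l) = F (l.map 𝒰.ρ)) (h₀ : F [] = 0) {l : List U}
    (h : ∀ t, t.length < l.length → defect 𝒰 𝒱 F t = 0) :
    𝒱.D (defect 𝒰 𝒱 F l) = -𝒰.bar₁ (defect 𝒰 𝒱 F) l := by
  have e₁ : 𝒱.cup (defect 𝒰 𝒱 F) F l = 0 := cup_eq_zero fun l₁ l₂ hl => by
    by_cases h₂ : l₂ = []
    · rw [h₂, h₀, map_zero]
    · have := List.length_pos_iff.2 h₂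
      rw [h l₁ (by rw [← hl, List.length_append]; omega), map_zero, LinearMap.zero_apply]
  have e₂ : 𝒱.cup (fun t => 𝒱.ρ (F t)) (defect 𝒰 𝒱 F) l = 0 := cup_eq_zero fun l₁ l₂ hl => by
    by_cases h₁ : l₁ = []
    · rw [h₁, h₀, map_zero, map_zero, LinearMap.zero_apply]
    · have := List.length_pos_iff.2 h₁
      rw [h l₂ (by rw [← hl, List.length_append]; omega), map_zero]
  have e₃ : 𝒰.bar₂ (defect 𝒰 𝒱 F) l = 0 := bar₂_eq_zero fun t ht => h t (by omega)
  rw [D_defect 𝒰 𝒱 hF hρ, e₁, e₂, bar, e₃]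
  simp

end Existence

/-! ### Homogeneous functions on words, and lifting modulo an acyclic ideal. -/

section Grading

variable {k : Type*} [CommRing k] {U V : Type*} [AddCommGroup U] [Module k U]
  [AddCommGroup V] [Module k V]

/-- A grading of a DG-algebra, shifted in such a way that the differential and the multiplication
both have degree `1`. -/
structure Grading (𝒰 : BarDGA k U) where
  gr : ℤ → Submodule k U
  D_mem : ∀ {i x}, x ∈ gr i → 𝒰.D x ∈ gr (i + 1)
  m_mem : ∀ {i j x y}, x ∈ gr i → y ∈ gr j → 𝒰.m x y ∈ gr (i + j + 1)
  ρ_eq : ∀ {i x}, x ∈ gr i → 𝒰.ρ x = i.negOnePow • x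
  span_eq : Submodule.span k {x | ∃ i, x ∈ gr i} = ⊤

variable {𝒰 : BarDGA k U} {𝒱 : BarDGA k V} (𝒢 : 𝒰.Grading) (ℋ : 𝒱.Grading)

theorem Grading.units_smul_mem {i : ℤ} {x : U} (u : ℤˣ) (hx : x ∈ 𝒢.gr i) : u • x ∈ 𝒢.gr i := by
  rcases Int.units_eq_one_or u with rfl | rfl <;> simpa using hx

theorem Grading.ρ_mem {i : ℤ} {x : U} (hx : x ∈ 𝒢.gr i) : 𝒰.ρ x ∈ 𝒢.gr i := by
  rw [𝒢.ρ_eq hx]; exact 𝒢.units_smul_mem _ hx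

/-- The words with letters of degrees `ds`. -/
abbrev Grading.Word (l : List U) (ds : List ℤ) : Prop := List.Forall₂ (fun x d => x ∈ 𝒢.gr d) l ds

/-- A function on words which is homogeneous of degree `r`. -/
def IsHomog (r : ℤ) (c : List U → V) : Prop :=
  ∀ l ds, 𝒢.Word l ds → c l ∈ ℋ.gr (ds.sum + r)

variable {𝒢 ℋ}

theorem IsHomog.cons {r : ℤ} {c : List U → V} (h : IsHomog 𝒢 ℋ r c) {x : U} {d : ℤ}
    (hx : x ∈ 𝒢.gr d) : IsHomog 𝒢 ℋ (d + r) fun l => c (x :: l) := fun l ds hl => by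
  have := h (x :: l) (d :: ds) (.cons hx hl)
  rwa [List.sum_cons, add_comm d, add_assoc] at this

theorem IsHomog.cast {r s : ℤ} {c : List U → V} (h : IsHomog 𝒢 ℋ r c) (e : r = s) :
    IsHomog 𝒢 ℋ s c := e ▸ h

theorem IsHomog.bar₁ {r : ℤ} {c : List U → V} (h : IsHomog 𝒢 ℋ r c) :
    IsHomog 𝒢 ℋ (r + 1) (𝒰.bar₁ c) := fun l ds hl => by
  induction hl generalizing c r with
  | nil => rw [bar₁_nil]; exact Submodule.zero_mem _
  | @cons x d l ds hx hl ih =>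
    rw [bar₁_cons]
    refine Submodule.add_mem _ ?_ ?_
    · have := h _ _ (.cons (𝒢.D_mem hx) hl)
      convert this using 2
      simp; ring
    · have := ih (h.cons (𝒢.ρ_mem hx))
      convert this using 2
      simp; ring

theorem IsHomog.bar₂ {r : ℤ} {c : List U → V} (h : IsHomog 𝒢 ℋ r c) :
    IsHomog 𝒢 ℋ (r + 1) (𝒰.bar₂ c) := fun l ds hl => by
  induction hl generalizing c r with
  | nil => rw [bar₂_nil]; exact Submodule.zero_mem _
  | @cons x d l ds hx hl ih =>
    cases hl with
    | nil => rw [bar₂_singleton]; exact Submodule.zero_mem _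
    | @cons y d' l ds hy hl =>
      rw [bar₂_cons_cons]
      refine Submodule.add_mem _ ?_ ?_
      · have := h _ _ (.cons (𝒢.m_mem hx hy) hl)
        convert this using 2
        simp; ring
      · have := ih (h.cons (𝒢.ρ_mem hx))
        convert this using 2
        simp; ring

theorem IsHomog.cup {r s : ℤ} {F G : List U → V} (hF : IsHomog 𝒢 ℋ r F) (hG : IsHomog 𝒢 ℋ s G) :
    IsHomog 𝒢 ℋ (r + s + 1) (𝒱.cup F G) := fun l ds hl => by
  induction hl generalizing F r with
  | nil =>
    rw [cup_nil]
    have := ℋ.m_mem (hF [] [] .nil) (hG [] [] .nil)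
    convert this using 2
    simp
  | @cons x d l ds hx hl ih =>
    rw [cup_cons]
    refine Submodule.add_mem _ ?_ ?_
    · have := ℋ.m_mem (hF [] [] .nil) (hG _ _ (.cons hx hl))
      convert this using 2
      simp; ring
    · have := ih (hF.cons hx)
      convert this using 2
      simp; ring

theorem IsHomog.defect {F : List U → V} (hF : IsHomog 𝒢 ℋ 0 F) :
    IsHomog 𝒢 ℋ 1 (defect 𝒰 𝒱 F) := fun l ds hl =>
  Submodule.sub_mem _ (Submodule.add_mem _
    (by simpa using ℋ.D_mem (hF l ds hl)) (by simpa using (hF.cup hF) l ds hl))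
    (Submodule.add_mem _ (by simpa using hF.bar₁ l ds hl) (by simpa using hF.bar₂ l ds hl))

theorem exists_word {l : List U} (h : ∀ x ∈ l, x ∈ {x | ∃ i, x ∈ 𝒢.gr i}) :
    ∃ ds, 𝒢.Word l ds := by
  induction l with
  | nil => exact ⟨[], .nil⟩
  | cons x l ih =>
    obtain ⟨d, hd⟩ := h x (by simp)
    obtain ⟨ds, hds⟩ := ih fun y hy => h y (by simp [hy])
    exact ⟨d :: ds, .cons hd hds⟩

theorem map_ρ_of_word {c : List U → V} (hc : IsMultilin k c) {l : List U} {ds : List ℤ}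
    (h : 𝒢.Word l ds) : c (l.map 𝒰.ρ) = ds.sum.negOnePow • c l := by
  induction h generalizing c with
  | nil => simp
  | @cons x d l ds hx hl ih =>
    rw [List.map_cons, 𝒢.ρ_eq hx, List.sum_cons, Int.negOnePow_add, mul_smul, ← ih (hc.cons x)]
    rcases Int.units_eq_one_or d.negOnePow with h | h <;> simp [h, hc.neg_head]

/-- Supplies the sign hypothesis of the Bianchi identity. Both sides are multilinear, so homogeneous
words suffice, and there each side carries the sign of the total degree. -/
theorem IsHomog.ρ_apply {c : List U → V} (hc : IsMultilin k c) (h : IsHomog 𝒢 ℋ 0 c)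
    (l : List U) : 𝒱.ρ (c l) = c (l.map 𝒰.ρ) := by
  have := ((hc.comp 𝒱.ρ).fun_sub (hc.map 𝒰.ρ)).mem_of_span 𝒢.span_eq ⊥ (fun l hl => ?_) l
  · exact sub_eq_zero.1 (by simpa using this)
  · obtain ⟨ds, hds⟩ := exists_word hl
    rw [map_ρ_of_word hc hds, ℋ.ρ_eq (h l ds hds)]
    simp

theorem IsHomog.ite_length {r : ℤ} {c c' : List U → V} (h : IsHomog 𝒢 ℋ r c)
    (h' : IsHomog 𝒢 ℋ r c') (n : ℕ) :
    IsHomog 𝒢 ℋ r fun l => if l.length = n then c l else c' l := fun l ds hl => by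
  beta_reduce
  split_ifs
  exacts [h l ds hl, h' l ds hl]

theorem IsHomog.fun_add {r : ℤ} {c c' : List U → V} (h : IsHomog 𝒢 ℋ r c)
    (h' : IsHomog 𝒢 ℋ r c') : IsHomog 𝒢 ℋ r fun l => c l + c' l := fun l ds hl =>
  Submodule.add_mem _ (h l ds hl) (h' l ds hl)

theorem IsHomog.map {W : Type*} [AddCommGroup W] [Module k W] {𝒲 : BarDGA k W} {𝒦 : 𝒲.Grading}
    {r : ℤ} {c : List U → V} (h : IsHomog 𝒢 ℋ r c) (f : W →ₗ[k] U)
    (hf : ∀ {i x}, x ∈ 𝒦.gr i → f x ∈ 𝒢.gr i) : IsHomog 𝒦 ℋ r fun l => c (l.map f) :=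
  fun _ _ hl => h _ _ (List.forall₂_map_left_iff.2 (hl.imp fun _ _ hx => hf hx))

/-- Lifting of a map of DG-algebras, given up to an ideal `K`, to an `A∞`-morphism, when `K` has
no cohomology in degrees `≥ 2` and the source is concentrated in degrees `≥ 1`. -/
theorem exists_lift (hpos : ∀ i < 0, 𝒢.gr i = ⊥) (K : Submodule k V)
    (hKD : ∀ x ∈ K, 𝒱.D x ∈ K) (hKl : ∀ x ∈ K, ∀ y, 𝒱.m x y ∈ K)
    (hKr : ∀ x, ∀ y ∈ K, 𝒱.m x y ∈ K) (s : U →ₗ[k] V) (hs : ∀ {i x}, x ∈ 𝒢.gr i → s x ∈ ℋ.gr i)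
    (hsD : ∀ u, 𝒱.D (s u) - s (𝒰.D u) ∈ K)
    (hsm : ∀ u v, 𝒱.m (s u) (s v) - s (𝒰.m u v) ∈ K) (h : V →ₗ[k] V) (hK : ∀ x ∈ K, h x ∈ K)
    (hdeg : ∀ {i x}, x ∈ ℋ.gr i → h x ∈ ℋ.gr (i - 1))
    (hh : ∀ i x, 1 ≤ i → x ∈ ℋ.gr i → x ∈ K → 𝒱.D (h x) + h (𝒱.D x) = x) :
    ∃ F : List U → V, IsMultilin k F ∧ IsHomog 𝒢 ℋ 0 F ∧ F [] = 0 ∧ (∀ u, F [u] - s u ∈ K) ∧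
      ∀ l, defect 𝒰 𝒱 F l = 0 := by
  -- Modulo `K` such an `F` is the strict map `s`. Hence the defect stays in `K`, where the homotopy
  -- `h` acts, and corrections with values in `K` preserve the condition.
  let Good : (List U → V) → Prop := fun F => IsMultilin k F ∧ IsHomog 𝒢 ℋ 0 F ∧ F [] = 0 ∧
    (∀ u, F [u] - s u ∈ K) ∧ ∀ l, 2 ≤ l.length → F l ∈ K
  have hGood : ∀ F, Good F → ∀ l, defect 𝒰 𝒱 F l ∈ K := by
    rintro F ⟨-, -, h₀, h₁, h₂⟩ l
    match l with
    | [] => rw [defect_nil h₀]; exact K.zero_mem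
    | [u] =>
      rw [defect_singleton h₀]
      have := K.sub_mem (K.add_mem (hKD _ (h₁ u)) (hsD u)) (h₁ (𝒰.D u))
      convert this using 1
      rw [map_sub]; abel
    | [u, v] =>
      rw [defect_pair h₀]
      have e := K.sub_mem (K.add_mem (K.add_mem (hKl _ (h₁ u) (F [v])) (hKr (s u) _ (h₁ v)))
        (hsm u v)) (h₁ (𝒰.m u v))
      have := K.sub_mem (K.add_mem (hKD _ (h₂ [u, v] le_rfl)) e)
        (K.add_mem (h₂ [𝒰.D u, v] le_rfl) (h₂ [𝒰.ρ u, 𝒰.D v] le_rfl))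
      convert this using 1
      simp only [map_sub, LinearMap.sub_apply]; abel
    | u :: v :: w :: l =>
      refine K.sub_mem (K.add_mem (hKD _ (h₂ _ (by simp))) (𝒱.cup_mem fun l₁ l₂ hl => ?_))
        (K.add_mem (bar₁_mem fun t ht => h₂ t (by simp at ht; omega))
          (bar₂_mem fun t ht => h₂ t (by simp at ht; omega)))
      have hlen : l₁.length + l₂.length = l.length + 3 := by
        rw [← List.length_append, hl]; simp
      by_cases h₁ : 2 ≤ l₁.length
      · exact hKl _ (h₂ _ h₁) _
      · exact hKr _ _ (h₂ _ (by omega))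
  -- On letters of nonnegative shifted degree the defect has degree at least `1`, the range in which
  -- `h` contracts `K`. A letter of negative degree is zero by `hpos`, and then multilinearity makes
  -- the defect vanish.
  have hbal : ∀ F, Good F → ∀ l, 𝒱.D (h (defect 𝒰 𝒱 F l)) + h (𝒱.D (defect 𝒰 𝒱 F l)) =
      defect 𝒰 𝒱 F l := by
    intro F hF l
    have hml := isMultilin_defect 𝒰 𝒱 hF.1
    have := (((hml.comp h).comp 𝒱.D).fun_add ((hml.comp 𝒱.D).comp h)).fun_sub hml
    have := this.mem_of_span 𝒢.span_eq ⊥ (fun l hl => ?_) l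
    · exact sub_eq_zero.1 (by simpa using this)
    · obtain ⟨ds, hds⟩ := exists_word hl
      rw [Submodule.mem_bot, sub_eq_zero]
      by_cases hneg : ∀ d ∈ ds, 0 ≤ d
      · exact hh _ _ (by have := List.sum_nonneg hneg; omega) (hF.2.1.defect l ds hds)
          (hGood F hF l)
      · push Not at hneg
        obtain ⟨d, hd, hd'⟩ := hneg
        have h0 : (0 : U) ∈ l := by
          clear hl
          induction hds with
          | nil => simp at hd
          | @cons x e l ds hx hl ih =>
            rcases List.mem_cons.1 hd with rfl | hd
            · rw [hpos d hd', Submodule.mem_bot] at hx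
              simp [hx]
            · simp [ih hd]
        obtain ⟨l₁, l₂, rfl⟩ := List.append_of_mem h0
        rw [hml.zero_mid]; simp
  suffices H : ∃ F, Good F ∧ ∀ l, defect 𝒰 𝒱 F l = 0 by
    obtain ⟨F, hF, hF'⟩ := H
    exact ⟨F, hF.1, hF.2.1, hF.2.2.1, hF.2.2.2.1, hF'⟩
  refine exists_defect_eq_zero Good ?_ ?_ (fun l => match l with | [u] => s u | _ => 0) ?_
  · exact fun Fs hFs => ⟨.diagonal fun n => (hFs n).1, fun l ds hl => (hFs _).2.1 l ds hl,
      (hFs _).2.2.1, fun u => (hFs _).2.2.2.1 u, fun l hl => (hFs _).2.2.2.2 l hl⟩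
  · intro n F hF hn
    have h0 : -h (defect 𝒰 𝒱 F []) = 0 := by rw [defect_nil hF.2.2.1]; simp
    -- Kill the obstruction with its primitive: the correction in length `n` is `-h (defect F)`.
    refine ⟨fun t => if t.length = n then F t + -h (defect 𝒰 𝒱 F t) else F t,
      ⟨(hF.1.fun_add ((isMultilin_defect 𝒰 𝒱 hF.1).comp h).fun_neg).ite_length hF.1 n,
        IsHomog.ite_length (hF.2.1.fun_add fun l ds hl => Submodule.neg_mem _ ?_) hF.2.1 n,
        ?_, fun u => ?_, fun l hl => ?_⟩, fun l hl => if_neg hl.ne, fun l hl => ?_⟩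
    · simpa using hdeg (hF.2.1.defect l ds hl)
    · simp only [h0, hF.2.2.1, add_zero, ite_self]
    · beta_reduce
      split_ifs
      · rw [add_sub_right_comm]
        exact K.add_mem (hF.2.2.2.1 u) (K.neg_mem (hK _ (hGood F hF _)))
      · exact hF.2.2.2.1 u
    · beta_reduce
      split_ifs
      · exact K.add_mem (hF.2.2.2.2 l hl) (K.neg_mem (hK _ (hGood F hF _)))
      · exact hF.2.2.2.2 l hl
    · rw [defect_add hF.2.2.1 h0 hl, bar₁_neg, bar₁_map]
      have e := D_defect_of_vanishing hF.1 (hF.2.1.ρ_apply hF.1) hF.2.2.1 (l := l)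
        fun t ht => hn t (hl ▸ ht)
      -- The new defect is `δ - D (h δ) + h (bar₁ δ)` for the old defect `δ`. Since `D δ = -bar₁ δ`,
      -- this is `δ - (D h + h D) δ = 0`.
      have e' := hbal F hF l
      rw [e] at e'
      rw [map_neg] at e' ⊢
      rw [← sub_eq_zero.2 e'.symm]
      abel
  · refine ⟨⟨?_, ?_⟩, ?_, rfl, fun u => by simp, fun l hl => ?_⟩
    · intro l₁ l₂ x y
      match l₁, l₂ with
      | [], [] => simp
      | [], _ :: _ => simp
      | _ :: _, _ => simp
    · intro l₁ l₂ r x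
      match l₁, l₂ with
      | [], [] => simp
      | [], _ :: _ => simp
      | _ :: _, _ => simp
    · intro l ds hl
      match l, ds, hl with
      | [], _, _ => exact Submodule.zero_mem _
      | [u], [d], .cons hu .nil => simpa using hs hu
      | _ :: _ :: _, _, _ => exact Submodule.zero_mem _
    · match l, hl with
      | _ :: _ :: _, _ => exact K.zero_mem

end Grading

end BarDGA

end AInf

namespace AInf

namespace BarDGA

/-! ### Strict morphisms and naturality of the defect. -/

section StrictMaps

variable {k : Type*} [CommRing k] {U W V : Type*} [AddCommGroup U] [Module k U]
  [AddCommGroup W] [Module k W] [AddCommGroup V] [Module k V]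

/-- A map of DG-algebras. -/
structure IsStrict (𝒰 : BarDGA k U) (𝒲 : BarDGA k W) (j : U →ₗ[k] W) : Prop where
  D : ∀ x, j (𝒰.D x) = 𝒲.D (j x)
  ρ : ∀ x, j (𝒰.ρ x) = 𝒲.ρ (j x)
  m : ∀ x y, j (𝒰.m x y) = 𝒲.m (j x) (j y)

variable {𝒰 : BarDGA k U} {𝒲 : BarDGA k W} {𝒱 : BarDGA k V}

theorem IsStrict.bar₁ {j : U →ₗ[k] W} (hj : IsStrict 𝒰 𝒲 j) (c : List W → V) (l : List U) :
    𝒲.bar₁ c (l.map j) = 𝒰.bar₁ (fun t => c (t.map j)) l := by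
  induction l generalizing c with
  | nil => simp [bar₁_nil]
  | cons x l ih => simp only [List.map_cons, bar₁_cons, hj.D, hj.ρ, ih]

theorem IsStrict.bar₂ {j : U →ₗ[k] W} (hj : IsStrict 𝒰 𝒲 j) (c : List W → V) (l : List U) :
    𝒲.bar₂ c (l.map j) = 𝒰.bar₂ (fun t => c (t.map j)) l := by
  induction l generalizing c with
  | nil => simp [bar₂_nil]
  | cons x l ih =>
    cases l with
    | nil => simp [bar₂_singleton]
    | cons y l =>
      have ih := ih fun t => c (𝒲.ρ (j x) :: t)
      simp only [List.map_cons, bar₂_cons_cons, hj.m, hj.ρ] at ih ⊢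
      rw [ih]

theorem cup_map (F G : List W → V) (j : U → W) (l : List U) :
    𝒱.cup F G (l.map j) = 𝒱.cup (fun t => F (t.map j)) (fun t => G (t.map j)) l := by
  induction l generalizing F with
  | nil => simp [cup_nil]
  | cons x l ih => simp only [List.map_cons, cup_cons, List.map_nil, ih]

theorem IsStrict.defect_map {j : U →ₗ[k] W} (hj : IsStrict 𝒰 𝒲 j) (F : List W → V) (l : List U) :
    defect 𝒲 𝒱 F (l.map j) = defect 𝒰 𝒱 (fun t => F (t.map j)) l := by
  rw [defect, defect, bar, bar, cup_map, hj.bar₁, hj.bar₂]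

theorem IsStrict.map_cup {p : W →ₗ[k] V} (hp : IsStrict 𝒲 𝒱 p) (F G : List U → W) (l : List U) :
    p (𝒲.cup F G l) = 𝒱.cup (fun t => p (F t)) (fun t => p (G t)) l := by
  induction l generalizing F with
  | nil => simp [cup_nil, hp.m]
  | cons x l ih => simp only [cup_cons, map_add, hp.m, ih]

theorem IsStrict.map_defect {p : W →ₗ[k] V} (hp : IsStrict 𝒲 𝒱 p) (F : List U → W) (l : List U) :
    defect 𝒰 𝒱 (fun t => p (F t)) l = p (defect 𝒰 𝒲 F l) := by
  rw [defect, defect, bar_map, map_sub, map_add, hp.D, hp.map_cup]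

end StrictMaps

/-! ### Adjoining a unit, and unital extension of morphisms. -/

section Unit

variable {k : Type*} [CommRing k] {U V : Type*} [AddCommGroup U] [Module k U]
  [AddCommGroup V] [Module k V] (𝒰 : BarDGA k U) {𝒱 : BarDGA k V}

/-- The DG-algebra obtained by adjoining a unit. -/
def unitization : BarDGA k (k × U) where
  D := LinearMap.prod 0 (𝒰.D ∘ₗ LinearMap.snd k k U)
  ρ := LinearMap.prodMap (-LinearMap.id) 𝒰.ρ
  m := LinearMap.mk₂ k (fun x y => (x.1 * y.1, x.1 • y.2 - y.1 • 𝒰.ρ x.2 + 𝒰.m x.2 y.2))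
    (fun x x' y => by
      ext
      · simp [add_mul]
      · simp only [Prod.fst_add, Prod.snd_add, map_add, add_smul, smul_add, LinearMap.add_apply]
        abel)
    (fun r x y => by
      ext
      · simp [mul_assoc]
      · simp only [Prod.smul_fst, Prod.smul_snd, map_smul, smul_add, smul_sub, smul_eq_mul,
          mul_smul, LinearMap.smul_apply, smul_comm r y.1])
    (fun x y y' => by
      ext
      · simp [mul_add]
      · simp only [Prod.fst_add, Prod.snd_add, map_add, add_smul, smul_add]
        abel)
    (fun r x y => by
      ext
      · simp [mul_left_comm]
      · simp only [Prod.smul_fst, Prod.smul_snd, map_smul, smul_add, smul_sub, smul_eq_mul,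
          mul_smul, smul_comm r x.1])
  D_D x := by simp [𝒰.D_D]
  ρ_ρ x := by simp [𝒰.ρ_ρ]
  D_ρ x := by simp [𝒰.D_ρ]
  ρ_m x y := by
    ext
    · simp
    · simp [𝒰.ρ_m, 𝒰.ρ_ρ]; abel
  D_m x y := by
    ext
    · simp
    · simp [𝒰.D_m, 𝒰.D_ρ]; abel
  m_m x y z := by
    ext
    · simp [mul_assoc]
    · simp [𝒰.m_m, 𝒰.ρ_ρ, 𝒰.ρ_m, mul_smul, smul_sub, smul_add]
      simp only [smul_comm z.1]
      abel

theorem unitization_D (x : k × U) : 𝒰.unitization.D x = (0, 𝒰.D x.2) := rfl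
theorem unitization_ρ (x : k × U) : 𝒰.unitization.ρ x = (-x.1, 𝒰.ρ x.2) := rfl
theorem unitization_m (x y : k × U) : 𝒰.unitization.m x y =
    (x.1 * y.1, x.1 • y.2 - y.1 • 𝒰.ρ x.2 + 𝒰.m x.2 y.2) := rfl

/-- The part of the unital extension of an `A∞`-morphism which involves the unit. -/
def unitPart (v : V) : List (k × U) → V
  | [x] => x.1 • v
  | _ => 0

/-- The boundary term in the compatibility of a unital extension with the bar differential. -/
def lastTerm : (List U → V) → List (k × U) → V
  | _, [] => 0
  | F, [x] => -(x.1 • F [])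
  | F, x :: y :: l => lastTerm (fun t => F (𝒰.ρ x.2 :: t)) (y :: l)

theorem bar₁_unitPart (v : V) (l : List (k × U)) :
    𝒰.unitization.bar₁ (unitPart (U := U) v) l = 0 := by
  have h0 (x : k × U) (l : List (k × U)) :
      𝒰.unitization.bar₁ (fun t => unitPart v (x :: t)) l = 0 := by
    cases l with
    | nil => rw [bar₁_nil]
    | cons y l =>
      refine bar₁_eq_zero fun t ht => ?_
      cases t with
      | nil => simp at ht
      | cons z t => rfl
  cases l with
  | nil => rw [bar₁_nil]
  | cons x l =>
    rw [bar₁_cons, h0]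
    cases l with
    | nil => simp [unitization_D, unitPart]
    | cons y l => simp [unitPart]

theorem bar₂_unitPart (v : V) (x y : k × U) (l : List (k × U)) :
    𝒰.unitization.bar₂ (unitPart (U := U) v) (x :: y :: l) =
      unitPart v (𝒰.unitization.m x y :: l) := by
  rw [bar₂_cons_cons, add_eq_left]
  cases l with
  | nil => rw [bar₂_singleton]
  | cons z l =>
    refine bar₂_eq_zero fun t ht => ?_
    cases t with
    | nil => simp at ht
    | cons z t => rfl

/-- The unit component of an interior letter multiplies both its left and its right neighbour, with
opposite signs, and these terms cancel. Only the first letter acting to the right and the last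
letter acting to the left survive. -/
theorem bar₂_snd {F : List U → V} (hF : IsMultilin k F) (x : k × U) (l : List (k × U)) :
    𝒰.unitization.bar₂ (fun t => F (t.map Prod.snd)) (x :: l) =
      𝒰.bar₂ F ((x :: l).map Prod.snd) + x.1 • F (l.map Prod.snd) +
        𝒰.lastTerm F (x :: l) := by
  induction l generalizing F x with
  | nil => simp [bar₂_singleton, lastTerm]
  | cons y l ih =>
    have ih := ih (hF.cons (𝒰.ρ x.2)) y
    simp only [List.map_cons, bar₂_cons_cons, unitization_m, unitization_ρ, lastTerm] at ih ⊢
    rw [ih]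
    simp only [hF.add_head, hF.sub_head, hF.smul_head]
    abel

theorem bar₁_snd (F : List U → V) (l : List (k × U)) :
    𝒰.unitization.bar₁ (fun t => F (t.map Prod.snd)) l = 𝒰.bar₁ F (l.map Prod.snd) := by
  induction l generalizing F with
  | nil => simp [bar₁_nil]
  | cons x l ih =>
    simp only [List.map_cons, bar₁_cons, ih fun t => F ((𝒰.unitization.ρ x).2 :: t)]
    rfl

/-- A unit of a DG-algebra. -/
structure IsUnitElem (𝒱 : BarDGA k V) (v : V) : Prop where
  D : 𝒱.D v = 0
  ρ : 𝒱.ρ v = -v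
  m_left : ∀ x, 𝒱.m v x = x
  m_right : ∀ x, 𝒱.m x v = -𝒱.ρ x

variable {𝒰}

/-- The products with `unitPart`, on the left here and on the right in the next lemma, reproduce the
two boundary terms of `bar₂_snd`, so these drop out of the defect of the unital extension. -/
theorem cup_unitPart_left {v : V} (hv : IsUnitElem 𝒱 v) {G : List (k × U) → V} (x : k × U)
    (l : List (k × U)) : 𝒱.cup (unitPart v) G (x :: l) = x.1 • G l := by
  have h0 (x y : k × U) (l : List (k × U)) :
      𝒱.cup (fun t => unitPart v (x :: y :: t)) G l = 0 :=
    cup_eq_zero fun l₁ l₂ _ => by simp [unitPart]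
  rw [cup_cons]
  cases l with
  | nil => simp [cup_nil, unitPart, hv.m_left]
  | cons y l => rw [cup_cons, h0]; simp [unitPart, hv.m_left]

theorem cup_unitPart_right {v : V} (hv : IsUnitElem 𝒱 v) {F F' : List U → V}
    (hF : ∀ l, 𝒱.ρ (F l) = F' (l.map 𝒰.ρ)) (l : List (k × U)) :
    𝒱.cup (fun t => F (t.map Prod.snd)) (unitPart v) l = 𝒰.lastTerm F' l := by
  induction l generalizing F F' with
  | nil => simp [cup_nil, unitPart, lastTerm]
  | cons x l ih =>
    cases l with
    | nil =>
      have := hF []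
      simp only [List.map_nil] at this
      simp [cup_cons, cup_nil, unitPart, hv.m_right, lastTerm, this]
    | cons y l =>
      rw [cup_cons, lastTerm, ← ih (F := fun t => F (x.2 :: t)) fun l => hF (x.2 :: l)]
      simp [unitPart]

/-- The unital extension of an `A∞`-morphism. -/
theorem defect_unital {v : V} (hv : IsUnitElem 𝒱 v) {F : List U → V} (hF : IsMultilin k F)
    (hρ : ∀ l, 𝒱.ρ (F l) = F (l.map 𝒰.ρ)) (h₀ : F [] = 0) (hF' : ∀ l, defect 𝒰 𝒱 F l = 0)
    (l : List (k × U)) :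
    defect 𝒰.unitization 𝒱 (fun t => F (t.map Prod.snd) + unitPart v t) l = 0 := by
  cases l with
  | nil => exact defect_nil (by simp [h₀, unitPart])
  | cons x l =>
    have e := hF' ((x :: l).map Prod.snd)
    rw [defect, cup_map, bar] at e
    rw [defect, bar, bar₁_add, bar₂_add, bar₁_unitPart, bar₁_snd, bar₂_snd 𝒰 hF, cup_add_left,
      cup_add_right, cup_unitPart_left hv, cup_unitPart_right hv hρ, map_add]
    have e' : 𝒱.D (unitPart v (x :: l)) = 0 := by
      cases l with
      | nil => simp [unitPart, hv.D]
      | cons y l => simp [unitPart]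
    -- The product of `unitPart` with itself matches the bar term coming from unit times unit; both
    -- are nonzero at most on words of length two.
    have e'' : x.1 • unitPart v l = 𝒰.unitization.bar₂ (unitPart (U := U) v) (x :: l) := by
      match l with
      | [] => simp [unitPart, bar₂_singleton]
      | [y] => simp [bar₂_unitPart, unitPart, unitization_m, mul_smul]
      | y :: z :: l => simp [bar₂_unitPart, unitPart]
    rw [e', smul_add, e'', sub_eq_zero.1 e |> eq_sub_of_add_eq]
    abel

theorem isMultilin_unitPart (v : V) : IsMultilin k (unitPart (k := k) (U := U) v) := by
  constructor
  · intro l₁ l₂ x y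
    match l₁, l₂ with
    | [], [] => simp [unitPart, add_smul]
    | [], _ :: _ => simp [unitPart]
    | [_], _ => simp [unitPart]
    | _ :: _ :: _, _ => simp [unitPart]
  · intro l₁ l₂ r x
    match l₁, l₂ with
    | [], [] => simp [unitPart, mul_smul]
    | [], _ :: _ => simp [unitPart]
    | [_], _ => simp [unitPart]
    | _ :: _ :: _, _ => simp [unitPart]

end Unit

/-! ### Extension of morphisms along a deformation retract. -/

section Extension

variable {k : Type*} [CommRing k] {U W V : Type*} [AddCommGroup U] [Module k U]
  [AddCommGroup W] [Module k W] [AddCommGroup V] [Module k V]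
  {𝒰 : BarDGA k U} {𝒲 : BarDGA k W} {𝒱 : BarDGA k V}

/-- Precomposition of a function on words with the homotopy between the identity and `e ⊗ ⋯ ⊗ e`
which is induced by a homotopy `h` between the identity and `e`. -/
def tensorHtpy (𝒲 : BarDGA k W) (h e : W →ₗ[k] W) : (List W → V) → List W → V
  | _, [] => 0
  | c, x :: l => c (h x :: l) + tensorHtpy 𝒲 h e (fun t => c (𝒲.ρ (e x) :: t)) l

variable {h e : W →ₗ[k] W}

theorem tensorHtpy_nil (c : List W → V) : tensorHtpy 𝒲 h e c [] = 0 := by rw [tensorHtpy]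
theorem tensorHtpy_cons (c : List W → V) (x : W) (l : List W) : tensorHtpy 𝒲 h e c (x :: l) =
    c (h x :: l) + tensorHtpy 𝒲 h e (fun t => c (𝒲.ρ (e x) :: t)) l := by rw [tensorHtpy]

theorem tensorHtpy_add (c c' : List W → V) (l : List W) :
    tensorHtpy 𝒲 h e (fun t => c t + c' t) l =
      tensorHtpy 𝒲 h e c l + tensorHtpy 𝒲 h e c' l := by
  induction l generalizing c c' with
  | nil => simp [tensorHtpy_nil]
  | cons x l ih =>
    rw [tensorHtpy_cons, tensorHtpy_cons, tensorHtpy_cons,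
      ih (fun t => c (𝒲.ρ (e x) :: t)) fun t => c' (𝒲.ρ (e x) :: t)]
    abel

theorem tensorHtpy_map {V' : Type*} [AddCommGroup V'] [Module k V'] (f : V →ₗ[k] V')
    (c : List W → V) (l : List W) :
    tensorHtpy 𝒲 h e (fun t => f (c t)) l = f (tensorHtpy 𝒲 h e c l) := by
  induction l generalizing c with
  | nil => simp [tensorHtpy_nil]
  | cons x l ih =>
    rw [tensorHtpy_cons, tensorHtpy_cons, map_add, ih fun t => c (𝒲.ρ (e x) :: t)]

theorem tensorHtpy_neg (c : List W → V) (l : List W) :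
    tensorHtpy 𝒲 h e (fun t => -c t) l = -tensorHtpy 𝒲 h e c l :=
  tensorHtpy_map (k := k) (-LinearMap.id : V →ₗ[k] V) c l

theorem tensorHtpy_smul (r : k) (c : List W → V) (l : List W) :
    tensorHtpy 𝒲 h e (fun t => r • c t) l = r • tensorHtpy 𝒲 h e c l :=
  tensorHtpy_map (r • LinearMap.id : V →ₗ[k] V) c l

theorem tensorHtpy_congr {c c' : List W → V} {l : List W}
    (hc : ∀ t, t.length = l.length → c t = c' t) :
    tensorHtpy 𝒲 h e c l = tensorHtpy 𝒲 h e c' l := by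
  induction l generalizing c c' with
  | nil => rw [tensorHtpy_nil, tensorHtpy_nil]
  | cons x l ih =>
    rw [tensorHtpy_cons, tensorHtpy_cons, hc _ (by simp), ih fun t ht => hc _ (by simp [ht])]

theorem isMultilin_tensorHtpy {c : List W → V} (hc : IsMultilin k c) :
    IsMultilin k (tensorHtpy 𝒲 h e c) := by
  constructor
  · intro l₁ l₂ x y
    induction l₁ generalizing c with
    | nil =>
      simp only [List.nil_append, tensorHtpy_cons, map_add, hc.add_head, tensorHtpy_add]
      abel
    | cons z l₁ ih =>
      simp only [List.cons_append, tensorHtpy_cons, ih (hc.cons (𝒲.ρ (e z)))]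
      have := hc.add (h z :: l₁) l₂ x y
      simp only [List.cons_append] at this
      rw [this]; abel
  · intro l₁ l₂ r x
    induction l₁ generalizing c with
    | nil =>
      simp only [List.nil_append, tensorHtpy_cons, map_smul, hc.smul_head, tensorHtpy_smul,
        smul_add]
    | cons z l₁ ih =>
      simp only [List.cons_append, tensorHtpy_cons, ih (hc.cons (𝒲.ρ (e z))), smul_add]
      have := hc.smul (h z :: l₁) l₂ r x
      simp only [List.cons_append] at this
      rw [this]

theorem IsHomog.tensorHtpy {𝒢 : 𝒲.Grading} {ℋ : 𝒱.Grading}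
    (hh : ∀ {i x}, x ∈ 𝒢.gr i → h x ∈ 𝒢.gr (i - 1)) (he : ∀ {i x}, x ∈ 𝒢.gr i → e x ∈ 𝒢.gr i)
    {r : ℤ} {c : List W → V} (hc : IsHomog 𝒢 ℋ r c) :
    IsHomog 𝒢 ℋ (r - 1) (tensorHtpy 𝒲 h e c) := fun l ds hl => by
  induction hl generalizing c r with
  | nil => rw [tensorHtpy_nil]; exact Submodule.zero_mem _
  | @cons x d l ds hx hl ih =>
    rw [tensorHtpy_cons]
    refine Submodule.add_mem _ ?_ ?_
    · have := hc _ _ (.cons (hh hx) hl)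
      convert this using 2
      simp; ring
    · have := ih (hc.cons (𝒢.ρ_mem (he hx)))
      convert this using 2
      simp; ring

/-- The tensor trick: summing over the position of `h`, with `e` on all letters to its left and the
identity to its right, makes the differentials telescope from the identity to `e ⊗ ⋯ ⊗ e`. -/
theorem bar₁_tensorHtpy (hh : ∀ x, 𝒲.D (h x) + h (𝒲.D x) = x - e x)
    (hρ : ∀ x, h (𝒲.ρ x) = -𝒲.ρ (h x)) (eρ : ∀ x, e (𝒲.ρ x) = 𝒲.ρ (e x))
    (eD : ∀ x, e (𝒲.D x) = 𝒲.D (e x)) {c : List W → V} (hc : IsMultilin k c) (l : List W) :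
    𝒲.bar₁ (tensorHtpy 𝒲 h e c) l + tensorHtpy 𝒲 h e (𝒲.bar₁ c) l = c l - c (l.map e) := by
  induction l generalizing c with
  | nil => simp [bar₁_nil, tensorHtpy_nil]
  | cons x l ih =>
    have ih := eq_sub_of_add_eq (ih (hc.cons (e x)))
    have hx : c (𝒲.D (h x) :: l) + c (h (𝒲.D x) :: l) = c (x :: l) - c (e x :: l) := by
      rw [← hc.add_head, hh, hc.sub_head]
    simp only [bar₁_cons, tensorHtpy_cons, bar₁_add, tensorHtpy_add, eρ, eD, 𝒲.ρ_ρ, hρ, ih,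
      hc.neg_head, bar₁_neg, 𝒲.D_ρ, tensorHtpy_neg, List.map_cons]
    rw [eq_sub_of_add_eq hx]
    abel

/-- An `A∞`-morphism defined on a deformation retract of a DG-algebra extends to the
DG-algebra. -/
theorem exists_extension {𝒢 : 𝒲.Grading} {𝒢' : 𝒰.Grading} {ℋ : 𝒱.Grading} {j : U →ₗ[k] W}
    {p : W →ₗ[k] U}
    (hj : IsStrict 𝒰 𝒲 j) (hpj : ∀ x, p (j x) = x) (hjp : ∀ x, j (p x) = e x)
    (hjm : ∀ {i x}, x ∈ 𝒢'.gr i → j x ∈ 𝒢.gr i) (hpm : ∀ {i x}, x ∈ 𝒢.gr i → p x ∈ 𝒢'.gr i)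
    (hm : ∀ {i x}, x ∈ 𝒢.gr i → h x ∈ 𝒢.gr (i - 1)) (hhj : ∀ x, h (j x) = 0)
    (hh : ∀ x, 𝒲.D (h x) + h (𝒲.D x) = x - e x)
    (hρ : ∀ x, h (𝒲.ρ x) = -𝒲.ρ (h x)) (eρ : ∀ x, e (𝒲.ρ x) = 𝒲.ρ (e x))
    {F₀ : List U → V} (hF₀ : IsMultilin k F₀) (hF₀' : IsHomog 𝒢' ℋ 0 F₀) (h0 : F₀ [] = 0)
    (hdef : ∀ l, defect 𝒰 𝒱 F₀ l = 0) :
    ∃ F : List W → V, IsMultilin k F ∧ IsHomog 𝒢 ℋ 0 F ∧ (∀ l, F (l.map j) = F₀ l) ∧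
      ∀ l, defect 𝒲 𝒱 F l = 0 := by
  have eD : ∀ x, e (𝒲.D x) = 𝒲.D (e x) := fun x => by
    have h₁ := congr_arg 𝒲.D (hh x)
    have h₂ := hh (𝒲.D x)
    simp only [map_add, map_sub, 𝒲.D_D, zero_add, add_zero, map_zero] at h₁ h₂
    rw [h₁] at h₂
    exact (sub_right_inj.1 h₂).symm
  let Good : (List W → V) → Prop := fun F => IsMultilin k F ∧ IsHomog 𝒢 ℋ 0 F ∧
    ∀ l, F (l.map j) = F₀ l
  have hnil : ∀ F, Good F → F [] = 0 := fun F hF => by rw [← h0, ← hF.2.2 []]; rfl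
  -- The side condition `h ∘ j = 0` makes corrections vanish on words from the retract, so every
  -- stage still extends `F₀`.
  have htj : ∀ (c : List W → V), IsMultilin k c → ∀ l : List U,
      tensorHtpy 𝒲 h e c (l.map j) = 0 := by
    intro c hc l
    induction l generalizing c with
    | nil => rw [List.map_nil, tensorHtpy_nil]
    | cons x l ih => rw [List.map_cons, tensorHtpy_cons, hhj, hc.zero_head, ih _ (hc.cons _), add_zero]
  suffices H : ∃ F, Good F ∧ ∀ l, defect 𝒲 𝒱 F l = 0 by
    obtain ⟨F, hF, hF'⟩ := H
    exact ⟨F, hF.1, hF.2.1, hF.2.2, hF'⟩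
  -- The projection `p` need not be multiplicative, so `F₀ ∘ p` is only a starting value with the
  -- right restriction.
  refine exists_defect_eq_zero Good ?_ ?_ (fun l => F₀ (l.map p)) ?_
  · refine fun Fs hFs => ⟨.diagonal fun n => (hFs n).1, fun l ds hl => (hFs _).2.1 l ds hl,
      fun l => (hFs _).2.2 l⟩
  · intro n F hF hn
    have hml := isMultilin_defect 𝒲 𝒱 hF.1
    refine ⟨fun t => if t.length = n then F t + tensorHtpy 𝒲 h e (defect 𝒲 𝒱 F) t else F t,
      ⟨(hF.1.fun_add (isMultilin_tensorHtpy hml)).ite_length hF.1 n,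
        IsHomog.ite_length (hF.2.1.fun_add (((hF.2.1.defect).tensorHtpy hm fun hx =>
          hjp _ ▸ hjm (hpm hx)).cast (by norm_num))) hF.2.1 n, fun l => ?_⟩,
      fun l hl => if_neg hl.ne, fun l hl => ?_⟩
    · simp only [htj _ hml, add_zero, ite_self, hF.2.2 l]
    · rw [defect_add (hnil F hF) (tensorHtpy_nil _) hl, ← tensorHtpy_map]
      have hlow : ∀ t, t.length = l.length →
          𝒱.D (defect 𝒲 𝒱 F t) = -𝒲.bar₁ (defect 𝒲 𝒱 F) t := fun t ht =>
        D_defect_of_vanishing hF.1 (hF.2.1.ρ_apply hF.1) (hnil F hF)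
          fun t' ht' => hn t' (hl ▸ ht ▸ ht')
      have e₁ := bar₁_tensorHtpy hh hρ eρ eD hml l
      -- The corrected defect is the old one evaluated on `l.map e`. That word comes from the
      -- retract, where the defect is that of `F₀`, namely zero.
      have e₂ : defect 𝒲 𝒱 F (l.map e) = 0 := by
        have : l.map e = (l.map p).map j := by simp [Function.comp_def, hjp]
        rw [this, hj.defect_map, ← hdef (l.map p)]
        exact defect_congr fun t _ => hF.2.2 t
      rw [e₂, sub_zero] at e₁
      rw [tensorHtpy_congr hlow, tensorHtpy_neg, ← sub_eq_zero.2 e₁.symm]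
      abel
  · exact ⟨hF₀.map p, hF₀'.map p hpm, fun l => by simp [Function.comp_def, hpj]⟩

end Extension

end BarDGA

end AInf

namespace AInf

universe w w'

/-! ### DG-algebras in the bar normalization. -/

section OfDG

open DirectSum

variable {k : Type*} [CommRing k] {A : ℤ → Type w} [∀ i, AddCommGroup (A i)]
  [∀ i, Module k (A i)] [DirectSum.GRing A] [DirectSum.GAlgebra k A]

/-- A DG-algebra in the normalization of the bar construction. -/
def DGStructure.bar (𝒟 : DGStructure k A) : BarDGA k (⨁ i, A i) where
  D := 𝒟.D
  ρ := -signMap k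
  m := (LinearMap.mul k (⨁ i, A i)).comp (signMap k)
  D_D x := by
    have : 𝒟.D ∘ₗ 𝒟.D = 0 := DirectSum.linearMap_ext _ fun i => LinearMap.ext fun x => by
      simp [DGStructure.D_D_lof]
    exact LinearMap.congr_fun this x
  ρ_ρ x := by
    have : (-signMap k) ∘ₗ (-signMap k) = (LinearMap.id : (⨁ i, A i) →ₗ[k] _) :=
      DirectSum.linearMap_ext _ fun i => LinearMap.ext fun x => by
        rcases Int.units_eq_one_or i.negOnePow with h | h <;> simp [signMap_lof, h]
    exact LinearMap.congr_fun this x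
  D_ρ x := by
    have : 𝒟.D ∘ₗ (-signMap k) = -((-signMap k) ∘ₗ 𝒟.D) :=
      DirectSum.linearMap_ext _ fun i => LinearMap.ext fun x => by
        rcases Int.units_eq_one_or i.negOnePow with h | h <;>
          simp [signMap_lof, h, DGStructure.D_lof, Int.negOnePow_succ]
    exact LinearMap.congr_fun this x
  ρ_m x y := by
    have : ((LinearMap.mul k (⨁ i, A i)).comp (signMap k)).compr₂ (-signMap k) =
        -((LinearMap.mul k (⨁ i, A i)).comp (signMap k)).compl₁₂ (-signMap k) (-signMap k) := by
      refine DirectSum.linearMap_ext _ fun i => LinearMap.ext fun x =>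
        DirectSum.linearMap_ext _ fun j => LinearMap.ext fun y => ?_
      have := signMap_mul_lof (k := k) i j x y
      rcases Int.units_eq_one_or i.negOnePow with h | h <;>
      rcases Int.units_eq_one_or j.negOnePow with h' | h' <;>
        simp [signMap_lof, h, h', this]
    exact LinearMap.congr_fun (LinearMap.congr_fun this x) y
  D_m x y := by
    have : ((LinearMap.mul k (⨁ i, A i)).comp (signMap k)).compr₂ 𝒟.D =
        -((LinearMap.mul k (⨁ i, A i)).comp (signMap k)).compl₁₂ 𝒟.D LinearMap.id -
        ((LinearMap.mul k (⨁ i, A i)).comp (signMap k)).compl₁₂ (-signMap k) 𝒟.D := by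
      refine DirectSum.linearMap_ext _ fun i => LinearMap.ext fun x =>
        DirectSum.linearMap_ext _ fun j => LinearMap.ext fun y => ?_
      have e₁ := 𝒟.D_mul_lof i j x y
      have e₂ : signMap k (𝒟.D (lof k ℤ A i x)) = -i.negOnePow • 𝒟.D (lof k ℤ A i x) := by
        rw [DGStructure.D_lof, signMap_lof, Int.negOnePow_succ]
      rcases Int.units_eq_one_or i.negOnePow with h | h <;>
        (simp [signMap_lof, h, e₁, e₂]; try abel)
    exact LinearMap.congr_fun (LinearMap.congr_fun this x) y
  m_m x y z := by
    have : signMap k (signMap k x * y) = x * signMap k y := by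
      have : ((LinearMap.mul k (⨁ i, A i)).comp (signMap k)).compr₂ (signMap k) =
          (LinearMap.mul k (⨁ i, A i)).compl₁₂ LinearMap.id (signMap k) := by
        refine DirectSum.linearMap_ext _ fun i => LinearMap.ext fun x =>
          DirectSum.linearMap_ext _ fun j => LinearMap.ext fun y => ?_
        have := signMap_mul_lof (k := k) i j x y
        rcases Int.units_eq_one_or i.negOnePow with h | h <;>
        rcases Int.units_eq_one_or j.negOnePow with h' | h' <;>
          simp [signMap_lof, h, h', this]
      exact LinearMap.congr_fun (LinearMap.congr_fun this x) y
    have e : signMap k (signMap k x) = x := by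
      have : signMap k ∘ₗ signMap k = (LinearMap.id : (⨁ i, A i) →ₗ[k] _) :=
        DirectSum.linearMap_ext _ fun i => LinearMap.ext fun x => by
          rcases Int.units_eq_one_or i.negOnePow with h | h <;> simp [signMap_lof, h]
      exact LinearMap.congr_fun this x
    simp [this, e, mul_assoc]

variable (𝒟 : DGStructure k A)

theorem DGStructure.bar_D (x : ⨁ i, A i) : 𝒟.bar.D x = 𝒟.D x := rfl
theorem DGStructure.bar_ρ (x : ⨁ i, A i) : 𝒟.bar.ρ x = -signMap k x := rfl
theorem DGStructure.bar_m (x y : ⨁ i, A i) : 𝒟.bar.m x y = signMap k x * y := rfl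

theorem DGStructure.bar_ρ_lof (i : ℤ) (x : A i) :
    𝒟.bar.ρ (lof k ℤ A i x) = (i - 1).negOnePow • lof k ℤ A i x := by
  rw [bar_ρ, signMap_lof, Int.negOnePow_sub, Int.negOnePow_one]
  simp

/-- The grading of a DG-algebra. -/
def DGStructure.barGrading : 𝒟.bar.Grading where
  -- Suspended degree: `A` in degree `i + 1` sits in degree `i`. Then `D` and the product both have
  -- degree `1`, and components of `A∞`-morphisms have degree `0`.
  gr i := LinearMap.range (lof k ℤ A (i + 1))
  D_mem := by
    rintro i _ ⟨x, rfl⟩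
    exact ⟨𝒟.d _ x, (𝒟.D_lof _ x).symm⟩
  m_mem := by
    rintro i j _ _ ⟨x, rfl⟩ ⟨y, rfl⟩
    rw [bar_m, signMap_lof, smul_mul_assoc, lof_mul_lof, ← lof_units_smul]
    obtain ⟨z, hz⟩ := lof_cast (k := k) (A := A) (show i + 1 + (j + 1) = i + j + 1 + 1 by ring)
      ((i + 1).negOnePow • GradedMonoid.GMul.mul x y)
    exact ⟨z, hz.symm⟩
  ρ_eq := by
    rintro i _ ⟨x, rfl⟩
    rw [bar_ρ_lof, add_sub_cancel_right]
  span_eq := by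
    refine eq_top_iff.2 fun x _ => ?_
    induction x using DirectSum.induction_on with
    | zero => exact Submodule.zero_mem _
    | of i x =>
      obtain ⟨y, hy⟩ := lof_cast (k := k) (A := A) (show i = i - 1 + 1 by ring) x
      exact Submodule.subset_span ⟨i - 1, y, hy.symm⟩
    | add x y hx hy => exact Submodule.add_mem _ (hx trivial) (hy trivial)

theorem DGStructure.lof_mem_barGrading {i j : ℤ} (h : i = j + 1) (x : A i) :
    lof k ℤ A i x ∈ 𝒟.barGrading.gr j := by
  subst h; exact ⟨x, rfl⟩

end OfDG

/-! ### From functions on words to `A∞`-morphisms. -/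

section Words

variable {V : Type*}

/-- The word formed by the first `n` entries of a sequence. -/
def word (a : ℕ → V) (n : ℕ) : List V := List.ofFn fun i : Fin n => a i

theorem word_succ (a : ℕ → V) (n : ℕ) : word a (n + 1) = a 0 :: word (fun i => a (i + 1)) n := by
  simp [word, List.ofFn_succ]

theorem word_splice_zero (a : ℕ → V) (s : ℕ) (v : V) (n : ℕ) :
    word (splice a 0 s v) (n + 1) = v :: word (fun i => a (i + s)) n := by
  rw [word_succ]
  congr 1
  refine congr_arg List.ofFn (funext fun i => ?_)
  simp only [splice]
  rw [if_neg (by omega), if_neg (by omega)]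
  congr 1; omega

theorem word_splice_succ (a : ℕ → V) (r s : ℕ) (v : V) (n : ℕ) :
    word (splice a (r + 1) s v) (n + 1) = a 0 :: word (splice (fun i => a (i + 1)) r s v) n := by
  rw [word_succ]
  congr 1
  refine congr_arg List.ofFn (funext fun i => ?_)
  simp only [splice]
  by_cases h : (i : ℕ) < r
  · rw [if_pos (by omega), if_pos h]
  by_cases h' : (i : ℕ) = r
  · rw [if_neg (by omega), if_pos (by omega), if_neg h, if_pos h']
  · rw [if_neg (by omega), if_neg (by omega), if_neg h, if_neg h']
    congr 1; omega

end Words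

section ToAInfinity

open DirectSum

variable {k : Type*} [CommRing k] {A : ℤ → Type w} [∀ i, AddCommGroup (A i)]
  [∀ i, Module k (A i)] [DirectSum.GRing A] [DirectSum.GAlgebra k A]
  {B : ℤ → Type w'} [∀ i, AddCommGroup (B i)]
  [∀ i, Module k (B i)] [DirectSum.GRing B] [DirectSum.GAlgebra k B]

theorem ofFn_update {V : Type*} {n : ℕ} (v : Fin n → V) (i : Fin n) (x : V) :
    List.ofFn (Function.update v i x) =
      (List.ofFn v).take i ++ x :: (List.ofFn v).drop (i + 1) := by
  have : List.ofFn (Function.update v i x) = (List.ofFn v).set i x := by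
    refine List.ext_getElem (by simp) fun j h₁ h₂ => ?_
    simp only [List.getElem_set, List.getElem_ofFn, Function.update_apply, Fin.ext_iff, eq_comm]
  rw [this, List.set_eq_take_append_cons_drop, if_pos (by simp)]

/-- The multilinear map given by a multilinear function on words. -/
def IsMultilin.toMultilinearMap {U V : Type*} [AddCommGroup U] [Module k U] [AddCommGroup V]
    [Module k V] {c : List U → V} (hc : IsMultilin k c) (n : ℕ) :
    MultilinearMap k (fun _ : Fin n => U) V :=
  MultilinearMap.mk' (fun v => c (List.ofFn v))
    (fun v i x y => by simp only [ofFn_update, hc.add])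
    (fun v i r x => by simp only [ofFn_update, hc.smul])

theorem IsMultilin.toMultilinearMap_apply {U V : Type*} [AddCommGroup U] [Module k U]
    [AddCommGroup V] [Module k V] {c : List U → V} (hc : IsMultilin k c) (n : ℕ) (v : Fin n → U) :
    hc.toMultilinearMap n v = c (List.ofFn v) := rfl

/-- Converts the recursion into the explicit sum of the `A∞`-relations: the `ρ`'s on the letters
passed over combine to the sign of the position `r`. -/
theorem DGStructure.bar₁_word (𝒟 : DGStructure k A) {V : Type*} [AddCommGroup V] [Module k V]
    {c : List (⨁ i, A i) → V} (hc : IsMultilin k c) (n : ℕ) (d : ℕ → ℤ) (x : ∀ i, A (d i))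
    (a : ℕ → ⨁ i, A i) (ha : ∀ i, a i = lof k ℤ A (d i) (x i)) :
    𝒟.bar.bar₁ c (word a n) = ∑ r ∈ Finset.range n,
      (∑ i ∈ Finset.range r, (d i - 1)).negOnePow • c (word (splice a r 1 (𝒟.D (a r))) n) := by
  induction n generalizing a c d with
  | zero => simp [word, BarDGA.bar₁_nil]
  | succ n ih =>
    rw [word_succ, BarDGA.bar₁_cons, Finset.sum_range_succ', ih (hc.cons _) (fun i => d (i + 1))
      (fun i => x (i + 1)) _ fun i => ha (i + 1), add_comm]
    congr 1
    · refine Finset.sum_congr rfl fun r _ => ?_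
      rw [word_splice_succ, Finset.sum_range_succ', add_comm, Int.negOnePow_add, mul_smul]
      nth_rw 1 [ha 0]
      rw [DGStructure.bar_ρ_lof, ← ha 0]
      rcases Int.units_eq_one_or (d 0 - 1).negOnePow with h | h <;> simp [h, hc.neg_head]
    · simp [word_splice_zero, DGStructure.bar_D]

theorem DGStructure.bar₂_word (𝒟 : DGStructure k A) {V : Type*} [AddCommGroup V] [Module k V]
    {c : List (⨁ i, A i) → V} (hc : IsMultilin k c) (n : ℕ) (d : ℕ → ℤ) (x : ∀ i, A (d i))
    (a : ℕ → ⨁ i, A i) (ha : ∀ i, a i = lof k ℤ A (d i) (x i)) :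
    𝒟.bar.bar₂ c (word a (n + 1)) = ∑ r ∈ Finset.range n,
      (∑ i ∈ Finset.range r, (d i - 1)).negOnePow •
        c (word (splice a r 2 (signMap k (a r) * a (r + 1))) n) := by
  induction n generalizing a c d with
  | zero => simp [word, BarDGA.bar₂_singleton]
  | succ n ih =>
    have ih := ih (hc.cons (𝒟.bar.ρ (a 0))) (fun i => d (i + 1))
      (fun i => x (i + 1)) (fun i => a (i + 1)) fun i => ha (i + 1)
    rw [word_succ] at ih
    rw [word_succ, word_succ, BarDGA.bar₂_cons_cons, Finset.sum_range_succ', ih, add_comm]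
    congr 1
    · refine Finset.sum_congr rfl fun r _ => ?_
      rw [word_splice_succ, Finset.sum_range_succ', add_comm, Int.negOnePow_add, mul_smul]
      nth_rw 1 [ha 0]
      rw [DGStructure.bar_ρ_lof, ← ha 0]
      rcases Int.units_eq_one_or (d 0 - 1).negOnePow with h | h <;> simp [h, hc.neg_head]
    · simp [word_splice_zero, DGStructure.bar_m]

/-- All cuts occur, including those with an empty block; compositions have no such block, and for a
function vanishing on the empty word these terms are zero. -/
theorem BarDGA.cup_word {U V : Type*} [AddCommGroup U] [Module k U] [AddCommGroup V] [Module k V]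
    (𝒱 : BarDGA k V) (F G : List U → V) (a : ℕ → U) (n : ℕ) :
    𝒱.cup F G (word a n) = ∑ i ∈ Finset.range (n + 1),
      𝒱.m (F (word a i)) (G (word (fun j => a (i + j)) (n - i))) := by
  induction n generalizing a F with
  | zero => simp [word, BarDGA.cup_nil]
  | succ n ih =>
    rw [word_succ, BarDGA.cup_cons, ih, Finset.sum_range_succ' _ (n + 1), add_comm]
    congr 1
    · refine Finset.sum_congr rfl fun i _ => ?_
      rw [word_succ, Nat.add_sub_add_right]
      simp only [add_assoc, add_comm, add_left_comm]
    · simp [word_succ]; simp [word]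

/-- The composition of `n` with two parts `i` and `n - i`. -/
def pairComposition {n i : ℕ} (h₀ : 0 < i) (h : i < n) : Composition n where
  blocks := [i, n - i]
  blocks_pos := by
    intro j hj
    simp only [List.mem_cons, List.not_mem_nil, or_false] at hj
    omega
  blocks_sum := by simp; omega

/-- For a DG-algebra as target the operations of arity at least `3` are zero, so only compositions
with one or two parts matter, and two parts amount to an interior cut point. -/
theorem sum_composition {M : Type*} [AddCommMonoid M] (n : ℕ) (hn : 0 < n)
    (g : Composition n → M) (hg : ∀ c, 3 ≤ c.length → g c = 0) :
    ∑ c, g c = g (Composition.single n hn) + ∑ i ∈ (Finset.Ioo 0 n).attach,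
      g (pairComposition (Finset.mem_Ioo.1 i.2).1 (Finset.mem_Ioo.1 i.2).2) := by
  classical
  let P : {i // i ∈ Finset.Ioo 0 n} → Composition n := fun i =>
    pairComposition (Finset.mem_Ioo.1 i.2).1 (Finset.mem_Ioo.1 i.2).2
  have hP : Function.Injective P := fun i j hij => by
    have := congr_arg Composition.blocks hij
    simp only [P, pairComposition, List.cons.injEq] at this
    exact Subtype.ext this.1
  have hlen (i) : (P i).length = 2 := rfl
  have hs : Composition.single n hn ∉ Finset.univ.image P := by
    intro h
    obtain ⟨i, -, hi⟩ := Finset.mem_image.1 h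
    have := congr_arg Composition.length hi
    rw [hlen, Composition.single_length] at this
    omega
  rw [← Finset.sum_subset (Finset.subset_univ (insert (Composition.single n hn)
    (Finset.univ.image P))), Finset.sum_insert hs, Finset.sum_image fun i _ j _ h => hP h]
  · rfl
  · intro c _ hc
    apply hg
    by_contra hlt
    apply hc
    have h0 : 0 < c.length := c.length_pos_of_pos hn
    rw [Finset.mem_insert, Finset.mem_image]
    rcases (by omega : c.length = 1 ∨ c.length = 2) with h | h
    · exact Or.inl ((Composition.eq_single_iff_length hn).2 h)
    · right
      obtain ⟨i, j, hij⟩ := List.length_eq_two.1 (show c.blocks.length = 2 from h)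
      have hi : 0 < i := c.blocks_pos (by simp [hij])
      have hj : 0 < j := c.blocks_pos (by simp [hij])
      have hsum := c.blocks_sum
      rw [hij] at hsum
      simp at hsum
      refine ⟨⟨i, Finset.mem_Ioo.2 ⟨hi, by omega⟩⟩, Finset.mem_univ _, Composition.ext ?_⟩
      simp only [P, pairComposition, hij, List.cons.injEq, true_and, and_true]
      omega

/-- The `A∞`-morphism given by a multilinear function on words without defect. -/
def toAInfinityHom (𝒟 : DGStructure k A) (𝒟' : DGStructure k B)
    {F : List (⨁ i, A i) → ⨁ i, B i} (hF : IsMultilin k F)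
    (hF' : BarDGA.IsHomog 𝒟.barGrading 𝒟'.barGrading 0 F) (h0 : F [] = 0)
    (hdef : ∀ l, BarDGA.defect 𝒟.bar 𝒟'.bar F l = 0) :
    AInfinityHom 𝒟.toAInfinity 𝒟'.toAInfinity where
  f := hF.toMultilinearMap
  f_zero := by
    ext v
    simp [IsMultilin.toMultilinearMap_apply, h0]
  degree n d x := by
    have : 𝒟.barGrading.Word (List.ofFn fun i => lof k ℤ A (d i) (x i))
        (List.ofFn fun i => d i - 1) := by
      rw [BarDGA.Grading.Word, List.forall₂_iff_get]
      refine ⟨by simp, fun i h₁ h₂ => ?_⟩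
      simp only [List.get_eq_getElem, List.getElem_ofFn]
      exact 𝒟.lof_mem_barGrading (by ring) _
    obtain ⟨y, hy⟩ := hF' _ _ this
    obtain ⟨z, hz⟩ := lof_cast (k := k) (A := B) (j := (∑ i, d i) + 1 - n) (by
      simp [List.sum_ofFn]; ring) y
    exact ⟨z, by rw [IsMultilin.toMultilinearMap_apply, ← hy, hz]⟩
  compat n d x a ha := by
    rcases Nat.eq_zero_or_pos n with rfl | hn
    · simp only [Finset.Icc_eq_empty_of_lt Nat.zero_lt_one, Finset.sum_empty]
      refine (Finset.sum_eq_zero fun c _ => ?_).symm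
      have hc : c.length = 0 := Nat.le_zero.1 c.length_le
      generalize (fun i => hF.toMultilinearMap (c.blocksFun i) fun j => a (c.embedding i j)) = v
      revert v
      rw [hc]
      intro v
      rfl
    have hl : ∑ s ∈ Finset.Icc 1 n, ∑ r ∈ Finset.range (n - s + 1),
        (∑ i ∈ Finset.range r, (d i - 1)).negOnePow •
        hF.toMultilinearMap (n - s + 1)
          (fun i => splice a r s (𝒟.toAInfinity.m s (fun j => a (r + j))) i) =
        𝒟.bar.bar F (word a n) := by
      -- Only `s = 1` and `s = 2` contribute, and they are `bar₁` and `bar₂`.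
      have h3 : ∀ s, 3 ≤ s → ∑ r ∈ Finset.range (n - s + 1),
          (∑ i ∈ Finset.range r, (d i - 1)).negOnePow •
          hF.toMultilinearMap (n - s + 1)
            (fun i => splice a r s (𝒟.toAInfinity.m s (fun j => a (r + j))) i) = 0 := by
        refine fun s hs => Finset.sum_eq_zero fun r hr => ?_
        have : 𝒟.toAInfinity.m s = 0 := 𝒟.ops_of_three_le s hs
        rw [this, MultilinearMap.map_coord_zero (i := ⟨r, Finset.mem_range.1 hr⟩), smul_zero]
        simp [splice]
      have h1 : ∑ r ∈ Finset.range (n - 1 + 1),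
          (∑ i ∈ Finset.range r, (d i - 1)).negOnePow •
          hF.toMultilinearMap (n - 1 + 1)
            (fun i => splice a r 1 (𝒟.toAInfinity.m 1 (fun j => a (r + j))) i) =
          𝒟.bar.bar₁ F (word a n) := by
        rw [𝒟.bar₁_word hF n d x a ha, Nat.sub_add_cancel hn]
        refine Finset.sum_congr rfl fun r _ => ?_
        rfl
      obtain ⟨n, rfl⟩ : ∃ m, n = m + 1 := ⟨n - 1, by omega⟩
      rw [BarDGA.bar, 𝒟.bar₂_word hF n d x a ha, ← h1]
      rcases Nat.eq_zero_or_pos n with rfl | hn'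
      · simp
      · have hsub : ({1, 2} : Finset ℕ) ⊆ Finset.Icc 1 (n + 1) := by
          intro s hs
          simp only [Finset.mem_insert, Finset.mem_singleton] at hs
          rw [Finset.mem_Icc]; omega
        rw [← Finset.sum_subset hsub, Finset.sum_pair (by norm_num)]
        · congr 1
          rw [show n + 1 - 2 + 1 = n by omega]
          refine Finset.sum_congr rfl fun r _ => ?_
          have : 𝒟.toAInfinity.m 2 (fun j => a (r + j)) = signMap k (a r) * a (r + 1) :=
            𝒟.ops_two _
          rw [this]
          rfl
        · intro s hs hs'
          apply h3
          simp only [Finset.mem_insert, Finset.mem_singleton] at hs'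
          rw [Finset.mem_Icc] at hs; omega
    have hr : ∑ c : Composition n, 𝒟'.toAInfinity.m c.length
        (fun i => hF.toMultilinearMap (c.blocksFun i) (fun j => a (c.embedding i j))) =
        𝒟'.bar.D (F (word a n)) + 𝒟'.bar.cup F F (word a n) := by
      rw [sum_composition n hn _ fun c hc => ?_]
      · congr 1
        · refine (𝒟'.ops_one _).trans (congr_arg (fun l => 𝒟'.D (F l)) ?_)
          refine congr_arg List.ofFn (funext fun j => congr_arg a ?_)
          exact (Composition.coe_embedding _ _ _).trans (Nat.zero_add _)
        · have e₀ : 𝒟'.bar.m (F (word a 0)) (F (word (fun j => a (0 + j)) (n - 0))) = 0 := by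
            rw [show word a 0 = [] by simp [word], h0, map_zero, LinearMap.zero_apply]
          have e₁ : 𝒟'.bar.m (F (word a n)) (F (word (fun j => a (n + j)) (n - n))) = 0 := by
            rw [Nat.sub_self, show word (fun j => a (n + j)) 0 = [] by simp [word], h0, map_zero]
          rw [BarDGA.cup_word, Finset.sum_range_succ, e₁, add_zero, Finset.range_eq_Ico,
            Finset.sum_eq_sum_Ico_succ_bot hn, e₀, zero_add]
          change _ = ∑ i ∈ Finset.Ioo 0 n, _
          rw [← Finset.sum_attach (Finset.Ioo 0 n)]
          refine Finset.sum_congr rfl fun i _ => (𝒟'.ops_two _).trans ?_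
          rw [DGStructure.bar_m]
          congr 1
          · refine congr_arg (fun l => signMap k (F l)) ?_
            refine congr_arg List.ofFn (funext fun j => congr_arg a ?_)
            exact (Composition.coe_embedding _ _ _).trans (Nat.zero_add _)
      · have : 𝒟'.toAInfinity.m c.length = 0 := 𝒟'.ops_of_three_le _ hc
        rw [this]; rfl
    rw [hl, hr]
    exact (sub_eq_zero.1 (hdef (word a n))).symm

end ToAInfinity

end AInf

namespace AInf

universe w w' w''

/-! ### Generalized inverses and contracting homotopies over a field. -/

section GeneralizedInverse

variable {k : Type*} [Field k] {V W : Type*} [AddCommGroup V] [Module k V] [AddCommGroup W]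
  [Module k W]

/-- Compose the retraction onto the range with a linear section of `f` over its range; whatever the
retraction kills is killed by the result. -/
theorem exists_generalizedInverse_of_retraction (f : V →ₗ[k] W) (r : W →ₗ[k] LinearMap.range f)
    (hr : ∀ v, r (f v) = f.rangeRestrict v) :
    ∃ g : W →ₗ[k] V, (∀ v, f (g (f v)) = f v) ∧ (∀ w, g (f (g w)) = g w) ∧
      ∀ w, r w = 0 → g w = 0 := by
  obtain ⟨σ, hσ⟩ := f.rangeRestrict.exists_rightInverse_of_surjective f.range_rangeRestrict
  have hσ' (y : LinearMap.range f) : f (σ y) = y :=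
    congr_arg Subtype.val (LinearMap.congr_fun hσ y)
  refine ⟨σ ∘ₗ r, fun v => ?_, fun w => ?_, fun w hw => by simp [hw]⟩
  · simp [hr, hσ']
  · simp only [LinearMap.comp_apply, hr]
    congr 1
    exact Subtype.ext (hσ' _)

theorem exists_retraction_range (f : V →ₗ[k] W) :
    ∃ r : W →ₗ[k] LinearMap.range f, ∀ v, r (f v) = f.rangeRestrict v := by
  obtain ⟨r, hr⟩ := (LinearMap.range f).subtype.exists_leftInverse_of_injective
    (Submodule.ker_subtype _)
  exact ⟨r, fun v => LinearMap.congr_fun hr (f.rangeRestrict v)⟩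

theorem exists_generalizedInverse (f : V →ₗ[k] W) :
    ∃ g : W →ₗ[k] V, (∀ v, f (g (f v)) = f v) ∧ ∀ w, g (f (g w)) = g w := by
  obtain ⟨r, hr⟩ := exists_retraction_range f
  obtain ⟨g, h₁, h₂, -⟩ := exists_generalizedInverse_of_retraction f r hr
  exact ⟨g, h₁, h₂⟩

/-- Applied to the unit, which is not a coboundary, this yields a homotopy that annihilates the
unit. -/
theorem exists_generalizedInverse_apply_eq_zero (f : V →ₗ[k] W) (w : W)
    (hw : w ∉ LinearMap.range f) :
    ∃ g : W →ₗ[k] V, (∀ v, f (g (f v)) = f v) ∧ (∀ w, g (f (g w)) = g w) ∧ g w = 0 := by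
  obtain ⟨r, hr⟩ := exists_retraction_range f
  obtain ⟨φ, hφ, hφ'⟩ := Submodule.exists_le_ker_of_notMem hw
  -- With `φ` zero on the range and nonzero at `w`, subtracting `φ(·) φ(w)⁻¹ r(w)` leaves the
  -- retraction unchanged on the range and makes it kill `w`.
  obtain ⟨g, h₁, h₂, h₃⟩ := exists_generalizedInverse_of_retraction f
    (r - (φ.smulRight ((φ w)⁻¹ • r w))) fun v => by
      have : φ (f v) = 0 := hφ' (LinearMap.mem_range_self f v)
      simp [hr, this]
  exact ⟨g, h₁, h₂, h₃ w (by simp [smul_smul, hφ])⟩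

end GeneralizedInverse

section DirectSumMaps

open DirectSum

variable {k : Type*} [CommRing k] {A : ℤ → Type w} [∀ i, AddCommGroup (A i)]
  [∀ i, Module k (A i)]

/-- The endomorphism of degree `-1` of a direct sum given by a family of maps. -/
def lowerMap (g : ∀ i, A (i + 1) →ₗ[k] A i) : (⨁ i, A i) →ₗ[k] ⨁ i, A i :=
  toModule k ℤ _ fun j => lof k ℤ A (j - 1) ∘ₗ g (j - 1) ∘ₗ
    (LinearEquiv.cast (R := k) (M := A) (sub_add_cancel j 1).symm : A j →ₗ[k] A (j - 1 + 1))

theorem lowerMap_lof (g : ∀ i, A (i + 1) →ₗ[k] A i) (i : ℤ) (x : A (i + 1)) :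
    lowerMap g (lof k ℤ A (i + 1) x) = lof k ℤ A i (g i x) := by
  have key : ∀ m (e : i + 1 = m + 1),
      lof k ℤ A m (g m (LinearEquiv.cast (R := k) (M := A) e x)) = lof k ℤ A i (g i x) := by
    intro m e
    obtain rfl : i = m := by omega
    rfl
  rw [lowerMap, toModule_lof]
  exact key _ _

theorem eq_lof_succ (i : ℤ) (x : A i) : ∃ y : A (i - 1 + 1), lof k ℤ A i x = lof k ℤ A (i - 1 + 1) y :=
  lof_cast (by ring) x

theorem lowerMap_mem (g : ∀ i, A (i + 1) →ₗ[k] A i) (i : ℤ) (x : A i) :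
    ∃ y, lowerMap g (lof k ℤ A i x) = lof k ℤ A (i - 1) y := by
  obtain ⟨y, hy⟩ := eq_lof_succ (k := k) i x
  exact ⟨_, by rw [hy, lowerMap_lof]⟩

theorem mem_of_lof_mem {T : Submodule k (⨁ i, A i)} {x : ⨁ i, A i}
    (h : ∀ i, lof k ℤ A i (x i) ∈ T) : x ∈ T := by
  classical
  rw [← DirectSum.sum_support_of x]
  exact Submodule.sum_mem _ fun i _ => h i

theorem lof_apply_of_ne {i j : ℤ} (h : i ≠ j) (x : A i) : (lof k ℤ A i x) j = 0 :=
  DirectSum.of_eq_of_ne _ _ _ h.symm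

theorem lof_apply_same (i : ℤ) (x : A i) : (lof k ℤ A i x) i = x :=
  DirectSum.of_eq_same _ _

variable (k A) in
/-- The elements with components in degrees `≥ n` only. -/
def geDegree (n : ℤ) : Submodule k (⨁ i, A i) where
  carrier := {x | ∀ i < n, x i = 0}
  add_mem' hx hy i hi := by rw [DirectSum.add_apply, hx i hi, hy i hi, add_zero]
  zero_mem' i _ := rfl
  smul_mem' r x hx i hi := by rw [DirectSum.smul_apply, hx i hi, smul_zero]

theorem lof_mem_geDegree {n i : ℤ} (h : n ≤ i) (x : A i) : lof k ℤ A i x ∈ geDegree k A n :=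
  fun _ hj => lof_apply_of_ne (by omega) x

theorem mem_of_mem_geDegree {n : ℤ} {x : ⨁ i, A i} (hx : x ∈ geDegree k A n)
    {T : Submodule k (⨁ i, A i)} (h : ∀ i, n ≤ i → ∀ y, lof k ℤ A i y ∈ T) : x ∈ T :=
  mem_of_lof_mem fun i => by
    by_cases hi : n ≤ i
    · exact h i hi _
    · rw [hx i (by omega), map_zero]; exact T.zero_mem

end DirectSumMaps

section Contractions

open DirectSum

variable {k : Type*} [Field k] {A : ℤ → Type w} [∀ i, AddCommGroup (A i)]
  [∀ i, Module k (A i)] [DirectSum.GRing A]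

theorem DGStructure.D_D (𝒟 : DGStructure k A) (x : ⨁ i, A i) : 𝒟.D (𝒟.D x) = 0 := by
  have : 𝒟.D ∘ₗ 𝒟.D = 0 := DirectSum.linearMap_ext _ fun i => LinearMap.ext fun x => by
    simp [DGStructure.D_D_lof]
  exact LinearMap.congr_fun this x

theorem DGStructure.D_one (𝒟 : DGStructure k A) : 𝒟.D 1 = 0 := by
  have := 𝒟.D_mul_lof 0 0 (GradedMonoid.GOne.one : A 0) GradedMonoid.GOne.one
  have e : lof k ℤ A 0 (GradedMonoid.GOne.one : A 0) = 1 := rfl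
  simpa [e] using this

/-- A DG-algebra with cohomology `k` in degree `0` and no cohomology in negative degrees
contracts onto its part of degrees `≥ 1`, suitably truncated, and the unit. -/
theorem DGStructure.exists_connected_contraction (𝒟 : DGStructure k A)
    (hneg : ∀ i < 0, ∀ x : A i, 𝒟.d i x = 0 →
      ∃ y : A (i - 1), 𝒟.D (lof k ℤ A (i - 1) y) = lof k ℤ A i x)
    (hzero : ∀ x : A 0, 𝒟.d 0 x = 0 →
      ∃ (c : k) (y : A (-1)), lof k ℤ A 0 x = c • 1 + 𝒟.D (lof k ℤ A (-1) y))
    (hone : ∀ y, 𝒟.D y ≠ 1) :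
    ∃ h : (⨁ i, A i) →ₗ[k] ⨁ i, A i,
      (∀ i x, ∃ y, h (lof k ℤ A i x) = lof k ℤ A (i - 1) y) ∧
      (∀ i, 2 ≤ i → ∀ x, h (lof k ℤ A i x) = 0) ∧ h 1 = 0 ∧
      (∀ i < 0, ∀ x, 𝒟.D (h (lof k ℤ A i x)) + h (𝒟.D (lof k ℤ A i x)) = lof k ℤ A i x) ∧
      (∀ x, ∃ c : k, 𝒟.D (h (lof k ℤ A 0 x)) + h (𝒟.D (lof k ℤ A 0 x)) = lof k ℤ A 0 x - c • 1) ∧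
      ∀ x, h (lof k ℤ A 1 x - 𝒟.D (h (lof k ℤ A 1 x))) = 0 := by
  -- `g` is a generalized inverse of the differential for `i ≤ 0` and zero for `i ≥ 1`. It always
  -- kills the unit, which may appear here under the index `i + 1` for `i = -1`.
  have hg : ∀ i, ∃ g : A (i + 1) →ₗ[k] A i, (1 ≤ i → g = 0) ∧
      (i ≤ 0 → ∀ v, 𝒟.d i (g (𝒟.d i v)) = 𝒟.d i v) ∧ (∀ w, g (𝒟.d i (g w)) = g w) ∧
      ∀ w, lof k ℤ A (i + 1) w = 1 → g w = 0 := by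
    intro i
    by_cases hi : 1 ≤ i
    · exact ⟨0, fun _ => rfl, fun h => by omega, fun w => by simp, fun w _ => rfl⟩
    by_cases hw : ∃ w, lof k ℤ A (i + 1) w = 1
    · obtain ⟨w, hw⟩ := hw
      obtain ⟨g, h₁, h₂, h₃⟩ := exists_generalizedInverse_apply_eq_zero (𝒟.d i) w (by
        rintro ⟨y, rfl⟩
        exact hone (lof k ℤ A i y) (by rw [D_lof, hw]))
      refine ⟨g, fun h => by omega, fun _ => h₁, h₂, fun w' hw' => ?_⟩
      rw [← h₃]
      congr 1
      have := congr_arg (fun z => z (i + 1)) (hw'.trans hw.symm)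
      simpa only [lof_apply_same] using this
    · obtain ⟨g, h₁, h₂⟩ := exists_generalizedInverse (𝒟.d i)
      exact ⟨g, fun h => by omega, fun _ => h₁, h₂, fun w hw' => absurd ⟨w, hw'⟩ hw⟩
  choose g g₁ g₂ g₃ g₄ using hg
  have hG₀ : ∀ i, 2 ≤ i → ∀ x, lowerMap g (lof k ℤ A i x) = 0 := by
    intro i hi x
    obtain ⟨y, hy⟩ := eq_lof_succ (k := k) i x
    rw [hy, lowerMap_lof, g₁ (i - 1) (by omega)]
    simp
  have hG₁ : ∀ i ≤ 0, ∀ x, 𝒟.D (lowerMap g (𝒟.D (lof k ℤ A i x))) = 𝒟.D (lof k ℤ A i x) := by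
    intro i hi x
    rw [D_lof, lowerMap_lof, D_lof, g₂ i hi]
  have hG₂ : ∀ i x, lowerMap g (𝒟.D (lowerMap g (lof k ℤ A i x))) =
      lowerMap g (lof k ℤ A i x) := by
    intro i x
    obtain ⟨y, hy⟩ := eq_lof_succ (k := k) i x
    rw [hy, lowerMap_lof, D_lof, lowerMap_lof, g₃]
  have hG₃ : lowerMap g 1 = 0 := by
    obtain ⟨y, hy⟩ := eq_lof_succ (k := k) 0 (GradedMonoid.GOne.one : A 0)
    have e : lof k ℤ A 0 (GradedMonoid.GOne.one : A 0) = 1 := rfl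
    rw [e] at hy
    rw [hy, lowerMap_lof, g₄ _ _ hy.symm, map_zero]
  have hdeg : ∀ i x, ∃ y, lof k ℤ A i x - lowerMap g (𝒟.D (lof k ℤ A i x)) = lof k ℤ A i y :=
    fun i x => ⟨x - g i (𝒟.d i x), by rw [D_lof, lowerMap_lof, map_sub]⟩
  -- With `h = g - g g D` and `D D = 0`, one finds `D h x + h D x = D g y + g D x` for the cocycle
  -- `y = x - g D x`. If `y` is a coboundary then `D g y = y`, so the sum is `x`; in degree `0`, `y`
  -- is a coboundary plus a multiple of the unit, and `g 1 = 0`.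
  refine ⟨lowerMap g - lowerMap g ∘ₗ lowerMap g ∘ₗ 𝒟.D, fun i x => ?_, fun i hi x => ?_, ?_,
    fun i hi x => ?_, fun x => ?_, fun x => ?_⟩
  · obtain ⟨y, hy⟩ := lowerMap_mem g i x
    obtain ⟨z, hz⟩ := lowerMap_mem g i (g i (𝒟.d i x))
    exact ⟨y - z, by simp [hy, D_lof, lowerMap_lof, hz]⟩
  · simp [hG₀ i hi, D_lof, hG₀ (i + 1) (by omega)]
  · simp [hG₃, D_one]
  · obtain ⟨y, hy⟩ := hdeg i x
    have hy₀ : 𝒟.d i y = 0 := by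
      have : 𝒟.D (lof k ℤ A i y) = 0 := by rw [← hy, map_sub, hG₁ i hi.le, sub_self]
      rw [D_lof] at this
      simpa only [lof_apply_same, DirectSum.zero_apply] using congr_arg (fun z => z (i + 1)) this
    obtain ⟨z, hz⟩ := hneg i hi y hy₀
    have e : 𝒟.D (lowerMap g (lof k ℤ A i y)) = lof k ℤ A i y := by
      rw [← hz, hG₁ _ (by omega)]
    rw [← hy] at e
    simp only [LinearMap.sub_apply, LinearMap.comp_apply, D_D, map_zero, sub_zero]
    rw [← map_sub, e, sub_add_cancel]
  · obtain ⟨y, hy⟩ := hdeg 0 x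
    have hy₀ : 𝒟.d 0 y = 0 := by
      have : 𝒟.D (lof k ℤ A 0 y) = 0 := by rw [← hy, map_sub, hG₁ 0 le_rfl, sub_self]
      rw [D_lof] at this
      simpa only [lof_apply_same, DirectSum.zero_apply] using congr_arg (fun z => z (0 + 1)) this
    obtain ⟨c, z, hz⟩ := hzero y hy₀
    have e : 𝒟.D (lowerMap g (lof k ℤ A 0 y)) = lof k ℤ A 0 y - c • 1 := by
      rw [hz, map_add, map_smul, hG₃, smul_zero, zero_add, hG₁ _ (by omega), add_sub_cancel_left]
    rw [← hy] at e
    refine ⟨c, ?_⟩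
    simp only [LinearMap.sub_apply, LinearMap.comp_apply, D_D, map_zero, sub_zero]
    rw [← map_sub, e]
    abel
  · have e : lowerMap g (𝒟.D (lof k ℤ A 1 x)) = 0 := by rw [D_lof, hG₀ _ (by omega)]
    simp only [LinearMap.sub_apply, LinearMap.comp_apply, D_D, map_zero, sub_zero, map_sub, e, hG₂,
      sub_self]

variable {C : ℤ → Type w'} [∀ i, AddCommGroup (C i)] [∀ i, Module k (C i)] [DirectSum.GRing C]

/-- A contraction of the kernel of a surjective map of complexes in the degrees in which it has
no cohomology. -/
theorem DGStructure.exists_kernel_contraction (𝒞 : DGStructure k C)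
    (p : ∀ i, C i →ₗ[k] A i) (s : ∀ i, A i →ₗ[k] C i) (hps : ∀ i x, p i (s i x) = x)
    (hK : ∀ i, 2 ≤ i → ∀ z : C i, p i z = 0 → 𝒞.d i z = 0 →
      ∃ w : C (i - 1), p (i - 1) w = 0 ∧ 𝒞.D (lof k ℤ C (i - 1) w) = lof k ℤ C i z) :
    ∃ h : (⨁ i, C i) →ₗ[k] ⨁ i, C i,
      (∀ i x, ∃ y, h (lof k ℤ C i x) = lof k ℤ C (i - 1) y) ∧
      (∀ x, lmap p (h x) = 0) ∧
      ∀ i, 2 ≤ i → ∀ x, p i x = 0 → 𝒞.D (h (lof k ℤ C i x)) + h (𝒞.D (lof k ℤ C i x)) =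
        lof k ℤ C i x := by
  -- Here `1 - s p` projects onto the kernel of `p`. Inverting `d (1 - s p)` and projecting
  -- afterwards gives a homotopy with values in the kernel.
  choose g g₁ g₂ using fun i => exists_generalizedInverse (𝒞.d i ∘ₗ (LinearMap.id - s i ∘ₗ p i))
  let g' : ∀ i, C (i + 1) →ₗ[k] C i := fun i => (LinearMap.id - s i ∘ₗ p i) ∘ₗ g i
  have hpg : ∀ i x, p i (g' i x) = 0 := fun i x => by simp [g', hps]
  have hG₁ : ∀ i x, p i x = 0 →
      𝒞.D (lowerMap g' (𝒞.D (lof k ℤ C i x))) = 𝒞.D (lof k ℤ C i x) := by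
    intro i x hx
    rw [D_lof, lowerMap_lof, D_lof]
    have := g₁ i x
    simp only [LinearMap.comp_apply, LinearMap.sub_apply, LinearMap.id_apply, hx, map_zero,
      sub_zero] at this
    congr 1
  have hpG : ∀ i x, lmap p (lowerMap g' (lof k ℤ C i x)) = 0 := fun i x => by
    obtain ⟨y, hy⟩ := eq_lof_succ (k := k) i x
    rw [hy, lowerMap_lof, lmap_lof, hpg, map_zero]
  have hpG' : ∀ x, lmap p (lowerMap g' x) = 0 := fun x => by
    have : lmap p ∘ₗ lowerMap g' = 0 := DirectSum.linearMap_ext _ fun i =>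
      LinearMap.ext fun x => hpG i x
    exact LinearMap.congr_fun this x
  -- The same combination `g' - g' g' D` as in the connected case. The primitive from `hK` lies in
  -- the kernel, where `D g' D = D` holds.
  refine ⟨lowerMap g' - lowerMap g' ∘ₗ lowerMap g' ∘ₗ 𝒞.D, fun i x => ?_, fun x => ?_,
    fun i hi x hx => ?_⟩
  · obtain ⟨y, hy⟩ := lowerMap_mem g' i x
    obtain ⟨z, hz⟩ := lowerMap_mem g' i (g' i (𝒞.d i x))
    exact ⟨y - z, by simp [hy, D_lof, lowerMap_lof, hz]⟩
  · simp [hpG']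
  · have hy : lof k ℤ C i x - lowerMap g' (𝒞.D (lof k ℤ C i x)) =
        lof k ℤ C i (x - g' i (𝒞.d i x)) := by rw [D_lof, lowerMap_lof, map_sub]
    have hy₀ : 𝒞.d i (x - g' i (𝒞.d i x)) = 0 := by
      have : 𝒞.D (lof k ℤ C i (x - g' i (𝒞.d i x))) = 0 := by
        rw [← hy, map_sub, hG₁ i x hx, sub_self]
      rw [D_lof] at this
      simpa only [lof_apply_same, DirectSum.zero_apply] using congr_arg (fun z => z (i + 1)) this
    obtain ⟨w, hw, hw'⟩ := hK i hi _ (by rw [map_sub, hx, hpg, sub_zero]) hy₀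
    have e : 𝒞.D (lowerMap g' (lof k ℤ C i (x - g' i (𝒞.d i x)))) =
        lof k ℤ C i (x - g' i (𝒞.d i x)) := by
      rw [← hw', hG₁ _ _ hw]
    rw [← hy] at e
    simp only [LinearMap.sub_apply, LinearMap.comp_apply, D_D, map_zero, sub_zero]
    rw [← map_sub, e, sub_add_cancel]

end Contractions

end AInf

namespace AInf

universe w w' w''

namespace BarDGA

/-! ### Gradings on subalgebras and on unitizations. -/

section Sub

variable {k : Type*} [CommRing k] {W : Type*} [AddCommGroup W] [Module k W] (𝒲 : BarDGA k W)

/-- A nonunital DG-subalgebra. -/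
def sub (U : Submodule k W) (hD : ∀ x ∈ U, 𝒲.D x ∈ U) (hρ : ∀ x ∈ U, 𝒲.ρ x ∈ U)
    (hm : ∀ x ∈ U, ∀ y ∈ U, 𝒲.m x y ∈ U) : BarDGA k U where
  D := 𝒲.D.restrict hD
  ρ := 𝒲.ρ.restrict hρ
  m := LinearMap.mk₂ k (fun x y => ⟨𝒲.m x y, hm x x.2 y y.2⟩)
    (fun x x' y => Subtype.ext (by simp)) (fun r x y => Subtype.ext (by simp))
    (fun x y y' => Subtype.ext (by simp)) (fun r x y => Subtype.ext (by simp))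
  D_D x := Subtype.ext (𝒲.D_D x)
  ρ_ρ x := Subtype.ext (𝒲.ρ_ρ x)
  D_ρ x := Subtype.ext (𝒲.D_ρ x)
  ρ_m x y := Subtype.ext (𝒲.ρ_m x y)
  D_m x y := Subtype.ext (𝒲.D_m x y)
  m_m x y z := Subtype.ext (𝒲.m_m x y z)

variable {𝒲} {U : Submodule k W} {hD : ∀ x ∈ U, 𝒲.D x ∈ U} {hρ : ∀ x ∈ U, 𝒲.ρ x ∈ U}
  {hm : ∀ x ∈ U, ∀ y ∈ U, 𝒲.m x y ∈ U}

theorem isStrict_subtype : IsStrict (𝒲.sub U hD hρ hm) 𝒲 U.subtype :=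
  ⟨fun _ => rfl, fun _ => rfl, fun _ _ => rfl⟩

/-- The grading of a subalgebra spanned by homogeneous elements. -/
def Grading.sub (𝒢 : 𝒲.Grading)
    (h : U ≤ Submodule.span k {x | x ∈ U ∧ ∃ i, x ∈ 𝒢.gr i}) : (𝒲.sub U hD hρ hm).Grading where
  gr i := (𝒢.gr i).comap U.subtype
  D_mem h := 𝒢.D_mem h
  m_mem h h' := 𝒢.m_mem h h'
  ρ_eq h := Subtype.ext ((𝒢.ρ_eq h).trans (by simp [Units.smul_def]))
  span_eq := by
    refine Submodule.map_injective_of_injective U.injective_subtype ?_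
    rw [Submodule.map_span, Submodule.map_top, Submodule.range_subtype]
    refine le_antisymm (Submodule.span_le.2 ?_) (h.trans (Submodule.span_mono ?_))
    · rintro _ ⟨x, -, rfl⟩; exact x.2
    · rintro x ⟨hx, i, hi⟩
      exact ⟨⟨x, hx⟩, ⟨i, hi⟩, rfl⟩

/-- The grading of a unitization. -/
def Grading.unitization (𝒢 : 𝒲.Grading) : 𝒲.unitization.Grading where
  -- The unit has degree `0`, hence suspended degree `-1`.
  gr i :=
    { carrier := {x | (i ≠ -1 → x.1 = 0) ∧ x.2 ∈ 𝒢.gr i}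
      add_mem' := fun hx hy => ⟨fun h => by simp [hx.1 h, hy.1 h], Submodule.add_mem _ hx.2 hy.2⟩
      zero_mem' := ⟨fun _ => rfl, Submodule.zero_mem _⟩
      smul_mem' := fun r x hx => ⟨fun h => by simp [hx.1 h], Submodule.smul_mem _ r hx.2⟩ }
  D_mem h := ⟨fun _ => rfl, 𝒢.D_mem h.2⟩
  m_mem := by
    rintro i j x y ⟨hx, hx'⟩ ⟨hy, hy'⟩
    refine ⟨fun h => ?_, ?_⟩
    · rw [unitization_m]
      by_cases hi : i = -1
      · have : y.1 = 0 := hy (by omega)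
        simp [this]
      · simp [hx hi]
    · rw [unitization_m]
      refine Submodule.add_mem _ (Submodule.sub_mem _ ?_ ?_) (𝒢.m_mem hx' hy')
      · by_cases hi : i = -1
        · subst hi; rw [neg_add_eq_sub, sub_add_cancel]; exact Submodule.smul_mem _ _ hy'
        · rw [hx hi, zero_smul]; exact Submodule.zero_mem _
      · by_cases hj : j = -1
        · subst hj; rw [neg_add_cancel_right]; exact Submodule.smul_mem _ _ (𝒢.ρ_mem hx')
        · rw [hy hj, zero_smul]; exact Submodule.zero_mem _
  ρ_eq := by
    rintro i x ⟨hx, hx'⟩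
    rw [unitization_ρ, 𝒢.ρ_eq hx']
    by_cases hi : i = -1
    · subst hi; ext <;> simp [Units.smul_def]
    · ext <;> simp [hx hi, Units.smul_def]
  span_eq := by
    rw [eq_top_iff]
    rintro ⟨a, u⟩ -
    have h₁ : ((a, 0) : k × W) ∈ Submodule.span k {x : k × W | ∃ i, (i ≠ -1 → x.1 = 0) ∧ x.2 ∈ 𝒢.gr i} :=
      Submodule.subset_span ⟨-1, by simp, Submodule.zero_mem _⟩
    have h₂ : ∀ u, ((0, u) : k × W) ∈
        Submodule.span k {x : k × W | ∃ i, (i ≠ -1 → x.1 = 0) ∧ x.2 ∈ 𝒢.gr i} := by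
      intro u
      have : u ∈ Submodule.span k {x | ∃ i, x ∈ 𝒢.gr i} := 𝒢.span_eq ▸ Submodule.mem_top
      induction this using Submodule.span_induction with
      | mem x hx => obtain ⟨i, hi⟩ := hx; exact Submodule.subset_span ⟨i, fun _ => rfl, hi⟩
      | zero => exact Submodule.zero_mem _
      | add x y _ _ hx hy => simpa using Submodule.add_mem _ hx hy
      | smul r x _ hx => simpa using Submodule.smul_mem _ r hx
    have := Submodule.add_mem _ h₁ (h₂ u)
    simpa using this

theorem Grading.mem_unitization {𝒢 : 𝒲.Grading} {i : ℤ} {x : k × W} :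
    x ∈ 𝒢.unitization.gr i ↔ (i ≠ -1 → x.1 = 0) ∧ x.2 ∈ 𝒢.gr i := Iff.rfl

variable {V : Type*} [AddCommGroup V] [Module k V] {𝒱 : BarDGA k V}

/-- The unital extension of an `A∞`-morphism. -/
theorem exists_unital_extension {𝒢 : 𝒲.Grading} {ℋ : 𝒱.Grading} {v : V} (hv : IsUnitElem 𝒱 v)
    (hv' : v ∈ ℋ.gr (-1)) {F : List W → V} (hF : IsMultilin k F) (hF' : IsHomog 𝒢 ℋ 0 F)
    (h₀ : F [] = 0) (hdef : ∀ l, defect 𝒲 𝒱 F l = 0) :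
    ∃ F' : List (k × W) → V, IsMultilin k F' ∧ IsHomog 𝒢.unitization ℋ 0 F' ∧ F' [] = 0 ∧
      (∀ l, defect 𝒲.unitization 𝒱 F' l = 0) ∧ F' [(1, 0)] = v ∧ ∀ w, F' [(0, w)] = F [w] := by
  refine ⟨fun t => F (t.map Prod.snd) + unitPart v t,
    (hF.map (LinearMap.snd k k W)).fun_add (isMultilin_unitPart v), ?_, by simp [h₀, unitPart],
    defect_unital hv hF (hF'.ρ_apply hF) h₀ hdef, by simp [unitPart, hF.zero_head],
    fun w => by simp [unitPart]⟩
  intro l ds hl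
  refine Submodule.add_mem _ (hF' _ ds ?_) ?_
  · rw [Grading.Word, List.forall₂_map_left_iff]
    exact hl.imp fun x d h => h.2
  · cases hl with
    | nil => exact Submodule.zero_mem _
    | @cons x d l ds hx hl =>
      cases hl with
      | cons _ _ => exact Submodule.zero_mem _
      | nil =>
        by_cases hd : d = -1
        · subst hd; simpa [unitPart] using Submodule.smul_mem _ _ hv'
        · simp [unitPart, hx.1 hd]

end Sub

end BarDGA

end AInf

namespace AInf

universe w w' w''

/-! ### Connected DG-algebras and correspondences between them. -/

open DirectSum BarDGA

section

variable {k : Type*} [Field k] {A : ℤ → Type w} [∀ i, AddCommGroup (A i)]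
  [∀ i, Module k (A i)] [DirectSum.GRing A] [DirectSum.GAlgebra k A]

theorem DGStructure.isUnitElem_one (𝒟 : DGStructure k A) : IsUnitElem 𝒟.bar 1 := by
  have e : lof k ℤ A 0 (GradedMonoid.GOne.one : A 0) = 1 := rfl
  have e' : signMap k (1 : ⨁ i, A i) = 1 := by
    rw [← e, signMap_lof, Int.negOnePow_zero, one_smul]
  refine ⟨𝒟.D_one, ?_, fun x => ?_, fun x => ?_⟩
  · rw [bar_ρ, e']
  · rw [bar_m, e', one_mul]
  · rw [bar_m, bar_ρ, neg_neg, mul_one]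

theorem DGStructure.lof_mem_range_barGrading {𝒟 : DGStructure k A} {i : ℤ} {x : ⨁ i, A i}
    (hx : x ∈ 𝒟.barGrading.gr (i - 1)) : ∃ y, x = lof k ℤ A i y := by
  obtain ⟨y, rfl⟩ := hx
  exact lof_cast (by ring) y

/-- The cohomology of a DG-algebra vanishes in negative degrees, and is generated by the nonzero
class of the unit in degree `0`. -/
structure DGStructure.IsConnected (𝒟 : DGStructure k A) : Prop where
  neg : ∀ i < 0, ∀ x : A i, 𝒟.d i x = 0 →
      ∃ y : A (i - 1), 𝒟.D (lof k ℤ A (i - 1) y) = lof k ℤ A i x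
  zero : ∀ x : A 0, 𝒟.d 0 x = 0 →
      ∃ (c : k) (y : A (-1)), lof k ℤ A 0 x = c • 1 + 𝒟.D (lof k ℤ A (-1) y)
  one : ∀ y, 𝒟.D y ≠ 1

variable {B : ℤ → Type w'} [∀ i, AddCommGroup (B i)] [∀ i, Module k (B i)] [DirectSum.GRing B]
  [DirectSum.GAlgebra k B]

/-- Along a homotopy, the positive part of a connected DG-algebra carries all `A∞`-morphisms. -/
theorem DGStructure.IsConnected.exists_subalgebra {𝒟 : DGStructure k A} (h𝒟 : 𝒟.IsConnected) :
    ∃ (U : Submodule k (⨁ i, A i)) (𝒰 : BarDGA k U) (𝒢 : 𝒰.Grading),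
      IsStrict 𝒰 𝒟.bar U.subtype ∧ (∀ i (x : U), x ∈ 𝒢.gr i ↔ (x : ⨁ i, A i) ∈ 𝒟.barGrading.gr i) ∧
      (∀ i < 0, 𝒢.gr i = ⊥) ∧
      (∀ i, 1 ≤ i → ∀ x : A i, 𝒟.d i x = 0 → ∃ (y : A i) (w : ⨁ i, A i),
        lof k ℤ A i y ∈ U ∧ lof k ℤ A i x = lof k ℤ A i y + 𝒟.D w) ∧
      ∀ (𝒟' : DGStructure k B) (F : List U → ⨁ i, B i), IsMultilin k F →
        IsHomog 𝒢 𝒟'.barGrading 0 F → F [] = 0 → (∀ l, defect 𝒰 𝒟'.bar F l = 0) →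
        ∃ F' : List (⨁ i, A i) → ⨁ i, B i, IsMultilin k F' ∧
          IsHomog 𝒟.barGrading 𝒟'.barGrading 0 F' ∧ F' [] = 0 ∧
          (∀ l, defect 𝒟.bar 𝒟'.bar F' l = 0) ∧ F' [1] = 1 ∧ ∀ u : U, F' [(u : ⨁ i, A i)] = F [u] := by
  obtain ⟨h, hdeg, h2, h1, hneg, hzero, hone⟩ :=
    𝒟.exists_connected_contraction h𝒟.neg h𝒟.zero h𝒟.one
  have h2' : ∀ x ∈ geDegree k A 2, h x = 0 := fun x hx =>
    mem_of_mem_geDegree hx (T := LinearMap.ker h) h2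
  -- As `h` vanishes in degrees at least `2`, `U` is everything there, and in degree `1` it is the
  -- kernel of `h`. Products and differentials of elements of degree at least `1` land in degree at
  -- least `2`, so closure under both is automatic.
  let U : Submodule k (⨁ i, A i) := geDegree k A 1 ⊓ LinearMap.ker h
  have hU2 : geDegree k A 2 ≤ U := fun x hx => ⟨fun i hi => hx i (by omega), h2' x hx⟩
  have hDge : ∀ x ∈ geDegree k A 1, 𝒟.D x ∈ geDegree k A 2 := fun x hx =>
    mem_of_mem_geDegree hx (T := (geDegree k A 2).comap 𝒟.D) fun i hi y => by
      rw [Submodule.mem_comap, D_lof]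
      exact lof_mem_geDegree (by omega) _
  have hmge : ∀ x ∈ geDegree k A 1, ∀ y ∈ geDegree k A 1, 𝒟.bar.m x y ∈ geDegree k A 2 := by
    intro x hx y hy
    refine mem_of_mem_geDegree hx (T := (geDegree k A 2).comap (𝒟.bar.m.flip y)) fun i hi x => ?_
    refine mem_of_mem_geDegree hy (T := (geDegree k A 2).comap (𝒟.bar.m (lof k ℤ A i x)))
      fun j hj y => ?_
    rw [Submodule.mem_comap, bar_m, signMap_lof, smul_mul_assoc, lof_mul_lof, ← lof_units_smul]
    exact lof_mem_geDegree (by omega) _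
  have hρge : ∀ x ∈ geDegree k A 1, 𝒟.bar.ρ x ∈ geDegree k A 1 := fun x hx =>
    mem_of_mem_geDegree hx (T := (geDegree k A 1).comap 𝒟.bar.ρ) fun i hi y => by
      rw [Submodule.mem_comap, bar_ρ_lof, ← lof_units_smul]
      exact lof_mem_geDegree hi _
  have hhρ : ∀ x, h (𝒟.bar.ρ x) = -𝒟.bar.ρ (h x) := by
    intro x
    have : h ∘ₗ 𝒟.bar.ρ = -(𝒟.bar.ρ ∘ₗ h) := DirectSum.linearMap_ext _ fun i =>
      LinearMap.ext fun x => by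
        obtain ⟨y, hy⟩ := hdeg i x
        simp only [LinearMap.comp_apply, LinearMap.neg_apply, bar_ρ_lof, hy, Units.smul_def,
          map_zsmul, ← neg_smul]
        congr 1
        rw [Int.negOnePow_sub (i - 1)]; simp
    exact LinearMap.congr_fun this x
  have hUhom : U ≤ Submodule.span k {x | x ∈ U ∧ ∃ i, x ∈ 𝒟.barGrading.gr i} := by
    rintro x ⟨hx, hx'⟩
    refine mem_of_lof_mem fun i => Submodule.subset_span ⟨?_, i - 1, 𝒟.lof_mem_barGrading (by ring) _⟩
    rcases lt_trichotomy i 1 with hi | rfl | hi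
    · rw [hx i hi, map_zero]; exact U.zero_mem
    -- The other components of `x` have degree at least `2`, hence lie in `U`; therefore so does the
    -- component of degree `1`.
    · have : x - lof k ℤ A 1 (x 1) ∈ geDegree k A 2 := fun j hj => by
        rw [DirectSum.sub_apply]
        by_cases hj' : j = 1
        · subst hj'; rw [lof_apply_same, sub_self]
        · rw [lof_apply_of_ne (Ne.symm hj'), hx j (by omega), sub_zero]
      have h₁ := U.sub_mem (show x ∈ U from ⟨hx, hx'⟩) (hU2 this)
      rwa [sub_sub_cancel] at h₁
    · exact hU2 (lof_mem_geDegree (by omega) _)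
  let 𝒰 : BarDGA k U := 𝒟.bar.sub U (fun x hx => hU2 (hDge x hx.1))
    (fun x hx => ⟨hρge x hx.1, by
      rw [SetLike.mem_coe, LinearMap.mem_ker, hhρ, LinearMap.mem_ker.1 hx.2, map_zero, neg_zero]⟩)
    (fun x hx y hy => hU2 (hmge x hx.1 y hy.1))
  let 𝒢 : 𝒰.Grading := 𝒟.barGrading.sub hUhom
  refine ⟨U, 𝒰, 𝒢, isStrict_subtype, fun i x => Iff.rfl, fun i hi => ?_, fun i hi x hx => ?_,
    fun 𝒟' F hF hF' h₀ hdef => ?_⟩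
  · rw [eq_bot_iff]
    rintro ⟨x, hx⟩ ⟨y, hy⟩
    have hy : lof k ℤ A (i + 1) y = x := hy
    have := hx.1 (i + 1) (by omega)
    rw [← hy, lof_apply_same] at this
    refine Subtype.ext ?_
    change x = 0
    rw [← hy, this, map_zero]
  · obtain ⟨z, hz⟩ := hdeg i x
    obtain ⟨w, hw⟩ : ∃ w, 𝒟.D (lof k ℤ A (i - 1) z) = lof k ℤ A i w := by
      rw [D_lof]; exact lof_cast (by ring) _
    -- Replace `x` by `x - D (h x)`, which `h` kills in degree `1` by the last property of the
    -- contraction.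
    refine ⟨x - w, lof k ℤ A (i - 1) z, ?_, by rw [map_sub, hw, sub_add_cancel]⟩
    rcases hi.eq_or_lt with rfl | hi
    · refine ⟨lof_mem_geDegree le_rfl _, ?_⟩
      rw [SetLike.mem_coe, LinearMap.mem_ker, map_sub, ← hw, ← hz, hone]
    · exact hU2 (lof_mem_geDegree (by omega) _)
  -- `e` is homotopic to the identity and projects onto `k · 1 ⊕ U`: it is zero in negative degrees,
  -- takes scalar values in degree `0`, maps positive degrees into `U`, and fixes `1` and `U`.
  · let e : (⨁ i, A i) →ₗ[k] ⨁ i, A i := LinearMap.id - 𝒟.D ∘ₗ h - h ∘ₗ 𝒟.D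
    have he : ∀ x, e x = x - 𝒟.D (h x) - h (𝒟.D x) := fun x => rfl
    have e1 : e 1 = 1 := by simp [he, h1, 𝒟.D_one]
    have eU : ∀ x ∈ U, e x = x := fun x hx => by
      rw [he, LinearMap.mem_ker.1 hx.2, h2' _ (hDge x hx.1)]; simp
    have eneg : ∀ i < 0, ∀ x, e (lof k ℤ A i x) = 0 := fun i hi x => by
      rw [he, sub_sub, hneg i hi, sub_self]
    have ezero : ∀ x, ∃ c : k, e (lof k ℤ A 0 x) = c • 1 := fun x => by
      obtain ⟨c, hc⟩ := hzero x
      exact ⟨c, by rw [he, sub_sub, hc, sub_sub_cancel]⟩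
    have hdegD : ∀ i x, ∃ y, e (lof k ℤ A i x) = lof k ℤ A i y := fun i x => by
      obtain ⟨y, hy⟩ := hdeg i x
      obtain ⟨z, hz⟩ := hdeg (i + 1) (𝒟.d i x)
      obtain ⟨y', hy'⟩ := lof_cast (k := k) (show i - 1 + 1 = i by ring) (𝒟.d _ y)
      obtain ⟨z', hz'⟩ := lof_cast (k := k) (show i + 1 - 1 = i by ring) z
      exact ⟨x - y' - z', by rw [he, hy, D_lof, D_lof, hz, map_sub, map_sub, hy', hz']⟩
    have epos : ∀ i, 1 ≤ i → ∀ x, e (lof k ℤ A i x) ∈ U := fun i hi x => by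
      obtain ⟨y, hy⟩ := hdegD i x
      rcases hi.eq_or_lt with rfl | hi
      · refine ⟨hy ▸ lof_mem_geDegree le_rfl _, ?_⟩
        rw [SetLike.mem_coe, LinearMap.mem_ker, he, D_lof, h2 (1 + 1) (by norm_num), sub_zero, hone]
      · exact hy ▸ hU2 (lof_mem_geDegree (by omega) _)
    have h10 : (GradedMonoid.GOne.one : A 0) ≠ 0 := fun h0 => h𝒟.one 0 (by
      rw [map_zero]
      exact ((congr_arg (lof k ℤ A 0) h0).trans (map_zero _)).symm)
    obtain ⟨ψ₀, hψ₀, -⟩ := Submodule.exists_le_ker_of_notMem (p := (⊥ : Submodule k (A 0)))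
      (mt (Submodule.mem_bot k).1 h10)
    -- A functional supported in degree `0`, normalized to `1` at the unit; it reads off the
    -- coefficient of the unit in `e x`.
    let φ : (⨁ i, A i) →ₗ[k] k := (ψ₀ GradedMonoid.GOne.one)⁻¹ • ψ₀ ∘ₗ DirectSum.component k ℤ A 0
    have hφ : ∀ x : ⨁ i, A i, φ x = (ψ₀ GradedMonoid.GOne.one)⁻¹ * ψ₀ (x 0) := fun x => rfl
    have hone' : lof k ℤ A 0 (GradedMonoid.GOne.one : A 0) = 1 := rfl
    have φ1 : φ 1 = 1 := by rw [hφ, ← hone', lof_apply_same, inv_mul_cancel₀ hψ₀]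
    have φ0 : ∀ i, i ≠ 0 → ∀ x, φ (lof k ℤ A i x) = 0 := fun i hi x => by
      rw [hφ, lof_apply_of_ne hi, map_zero, mul_zero]
    have φU : ∀ x ∈ U, φ x = 0 := fun x hx => by rw [hφ, hx.1 0 (by norm_num), map_zero, mul_zero]
    let p₁ : (⨁ i, A i) →ₗ[k] ⨁ i, A i := e - (φ ∘ₗ e).smulRight 1
    have hp₁ : ∀ x, p₁ x = e x - φ (e x) • 1 := fun x => rfl
    have hp₁U : ∀ x, p₁ x ∈ U := by
      intro x
      refine mem_of_lof_mem (T := U.comap p₁) fun i => ?_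
      rw [Submodule.mem_comap]
      generalize x i = x
      rcases lt_trichotomy i 0 with hi | rfl | hi
      · rw [hp₁, eneg i hi, map_zero, zero_smul, sub_zero]; exact U.zero_mem
      · obtain ⟨c, hc⟩ := ezero x
        rw [hp₁, hc, map_smul, φ1, smul_eq_mul, mul_one, sub_self]; exact U.zero_mem
      · have := epos i hi x
        rwa [hp₁, φU _ this, zero_smul, sub_zero]
    let p : (⨁ i, A i) →ₗ[k] k × U := (φ ∘ₗ e).prod (p₁.codRestrict U hp₁U)
    have hp : ∀ x, p x = (φ (e x), ⟨p₁ x, hp₁U x⟩) := fun x => rfl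
    let j : (k × U) →ₗ[k] ⨁ i, A i := (LinearMap.toSpanSingleton k _ 1).coprod U.subtype
    have hj : ∀ x, j x = x.1 • 1 + (x.2 : ⨁ i, A i) := fun x => rfl
    have h1gr : (1 : ⨁ i, A i) ∈ 𝒟.barGrading.gr (-1) := 𝒟.lof_mem_barGrading (by norm_num) _
    have hB1 : (1 : ⨁ i, B i) ∈ 𝒟'.barGrading.gr (-1) :=
      𝒟'.lof_mem_barGrading (by norm_num) (GradedMonoid.GOne.one : B 0)
    have ej : ∀ x, e (j x) = j x := fun x => by
      rw [hj, map_add, map_smul, e1, eU _ x.2.2]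
    have φj : ∀ x, φ (j x) = x.1 := fun x => by
      rw [hj, map_add, map_smul, φ1, φU _ x.2.2, smul_eq_mul, mul_one, add_zero]
    have hu := 𝒟.isUnitElem_one
    have jstrict : IsStrict 𝒰.unitization 𝒟.bar j := by
      refine ⟨fun x => ?_, fun x => ?_, fun x y => ?_⟩
      · rw [hj, hj, unitization_D, map_add, map_smul, hu.D, smul_zero, zero_smul]; rfl
      · rw [hj, hj, unitization_ρ, map_add, map_smul, hu.ρ, neg_smul, smul_neg]; rfl
      · rw [hj, hj, hj, unitization_m]
        simp only [map_add, map_smul, LinearMap.add_apply, LinearMap.smul_apply, hu.m_left,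
          hu.m_right, Submodule.coe_add, Submodule.coe_sub, Submodule.coe_smul, smul_smul,
          smul_add, smul_neg]
        have e₁ : ((𝒰.ρ x.2 : U) : ⨁ i, A i) = 𝒟.bar.ρ x.2 := rfl
        have e₂ : ((𝒰.m x.2 y.2 : U) : ⨁ i, A i) = 𝒟.bar.m x.2 y.2 := rfl
        rw [e₁, e₂, mul_comm y.1]
        abel
    obtain ⟨F₁, hF₁, hF₁', hF₁0, hF₁d, hF₁u, hF₁F⟩ :=
      exists_unital_extension 𝒟'.isUnitElem_one hB1 hF hF' h₀ hdef
    obtain ⟨F', hF'ml, hF'h, hF'j, hF'd⟩ := exists_extension (𝒢 := 𝒟.barGrading)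
      (𝒢' := 𝒢.unitization) (h := h) (e := e) jstrict (p := p)
      (fun x => by
        rw [hp]
        refine Prod.ext ?_ (Subtype.ext ?_)
        · change φ (e (j x)) = x.1
          rw [ej, φj]
        · change p₁ (j x) = x.2
          rw [hp₁, ej, φj, hj, add_sub_cancel_left])
      (fun x => by
        rw [hj, hp]
        change φ (e x) • 1 + p₁ x = e x
        rw [hp₁, add_sub_cancel])
      (fun {i x} hx => by
        rw [hj]
        refine Submodule.add_mem _ ?_ hx.2
        by_cases hi : i = -1
        · subst hi; exact Submodule.smul_mem _ _ h1gr
        · rw [hx.1 hi, zero_smul]; exact Submodule.zero_mem _)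
      (fun {i x} hx => by
        obtain ⟨x, rfl⟩ := hx
        obtain ⟨y, hy⟩ := hdegD _ x
        rw [hp, Grading.mem_unitization]
        have h0 : i ≠ -1 → φ (e (lof k ℤ A (i + 1) x)) = 0 := fun hi => by
          rw [hy, φ0 _ (by omega)]
        refine ⟨h0, ?_⟩
        change p₁ _ ∈ 𝒟.barGrading.gr i
        rw [hp₁]
        refine Submodule.sub_mem _ ⟨y, hy.symm⟩ ?_
        by_cases hi : i = -1
        · subst hi; exact Submodule.smul_mem _ _ h1gr
        · rw [h0 hi, zero_smul]; exact Submodule.zero_mem _)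
      (fun {i x} hx => by
        obtain ⟨x, rfl⟩ := hx
        obtain ⟨y, hy⟩ := hdeg _ x
        rw [hy]
        exact 𝒟.lof_mem_barGrading (by ring) _)
      (fun x => by rw [hj, map_add, map_smul, h1, LinearMap.mem_ker.1 x.2.2.2, smul_zero, add_zero])
      (fun x => by rw [he, bar_D, bar_D]; abel) hhρ
      (fun x => by
        rw [he, he, hhρ, map_sub, map_sub]
        have e₁ := 𝒟.bar.D_ρ x
        have e₂ := 𝒟.bar.D_ρ (h x)
        rw [bar_D, bar_D] at e₁ e₂
        rw [e₁, map_neg, map_neg, e₂, hhρ, neg_neg, neg_neg])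
      hF₁ hF₁' hF₁0 hF₁d
    refine ⟨F', hF'ml, hF'h, (hF'j []).trans hF₁0, hF'd, ?_, fun u => ?_⟩
    · rw [← hF₁u, ← hF'j, List.map_singleton, hj]; simp
    · rw [← hF₁F, ← hF'j, List.map_singleton, hj]; simp

variable {C : ℤ → Type w''} [∀ i, AddCommGroup (C i)] [∀ i, Module k (C i)] [DirectSum.GRing C]
  [DirectSum.GAlgebra k C]

/-- A correspondence `A ← C → B` of DG-algebras with `A` connected, such that `C → A` is surjective
with kernel acyclic in degrees `≥ 2`, induces an `A∞`-morphism. -/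
theorem DGStructure.IsConnected.exists_of_correspondence {𝒟 : DGStructure k A} (h𝒟 : 𝒟.IsConnected)
    {𝒞 : DGStructure k C} {𝒟' : DGStructure k B} (p : ∀ i, C i →ₗ[k] A i) (q : ∀ i, C i →ₗ[k] B i)
    (hp : IsStrict 𝒞.bar 𝒟.bar (lmap p)) (hq : IsStrict 𝒞.bar 𝒟'.bar (lmap q))
    (s : ∀ i, A i →ₗ[k] C i) (hps : ∀ i x, p i (s i x) = x)
    (hK : ∀ i, 2 ≤ i → ∀ z : C i, p i z = 0 → 𝒞.d i z = 0 →
      ∃ w : C (i - 1), p (i - 1) w = 0 ∧ 𝒞.D (lof k ℤ C (i - 1) w) = lof k ℤ C i z) :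
    ∃ F : List (⨁ i, A i) → ⨁ i, B i, IsMultilin k F ∧
      IsHomog 𝒟.barGrading 𝒟'.barGrading 0 F ∧ F [] = 0 ∧
      (∀ l, defect 𝒟.bar 𝒟'.bar F l = 0) ∧ F [1] = 1 ∧
      ∀ i, 1 ≤ i → ∀ x : A i, 𝒟.d i x = 0 → ∃ z : C i, 𝒞.d i z = 0 ∧
        (∃ w, lof k ℤ A i x = lof k ℤ A i (p i z) + 𝒟.D w) ∧
        ∃ w, F [lof k ℤ A i x] = lof k ℤ B i (q i z) + 𝒟'.D w := by
  obtain ⟨h, hdeg, hhK, hh⟩ := 𝒞.exists_kernel_contraction p s hps hK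
  obtain ⟨U, 𝒰, 𝒢, hU, hUgr, hUneg, hUcocycle, hUext⟩ := h𝒟.exists_subalgebra (B := B)
  have hps' : ∀ x, lmap p (lmap s x) = x := fun x => by
    have : lmap p ∘ₗ lmap s = LinearMap.id := DirectSum.linearMap_ext _ fun i =>
      LinearMap.ext fun x => by simp [lmap_lof, hps]
    exact LinearMap.congr_fun this x
  -- Lift the inclusion of `U` to an `A∞`-morphism into `C`. The linear section `s` is strict modulo
  -- `ker p` because `p` is strict and `p s = 1`.
  obtain ⟨G, hG, hG', hG0, hGs, hGd⟩ := exists_lift (𝒱 := 𝒞.bar) (ℋ := 𝒞.barGrading) (𝒢 := 𝒢) hUneg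
    (LinearMap.ker (lmap p))
    (fun x hx => by rw [LinearMap.mem_ker] at hx ⊢; rw [hp.D, hx, map_zero])
    (fun x hx y => by
      rw [LinearMap.mem_ker] at hx ⊢; rw [hp.m, hx, map_zero, LinearMap.zero_apply])
    (fun x y hy => by rw [LinearMap.mem_ker] at hy ⊢; rw [hp.m, hy, map_zero])
    (lmap s ∘ₗ U.subtype)
    (fun {i x} hx => by
      obtain ⟨y, hy⟩ := (hUgr _ _).1 hx
      exact ⟨s _ y, by
        rw [LinearMap.comp_apply, Submodule.subtype_apply, ← hy, lmap_lof]⟩)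
    (fun u => by
      rw [LinearMap.mem_ker, map_sub, hp.D, LinearMap.comp_apply, LinearMap.comp_apply, hps', hps',
        hU.D, sub_self])
    (fun u v => by
      rw [LinearMap.mem_ker, map_sub, hp.m, LinearMap.comp_apply, LinearMap.comp_apply,
        LinearMap.comp_apply, hps', hps', hps', hU.m, sub_self])
    h (fun x _ => hhK x)
    (fun {i x} hx => by
      obtain ⟨x, rfl⟩ := hx
      obtain ⟨y, hy⟩ := hdeg _ x
      rw [hy]
      exact 𝒞.lof_mem_barGrading (by ring) _)
    (fun i x hi hx hx' => by
      obtain ⟨x, rfl⟩ := hx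
      refine hh _ (by omega) _ ?_
      rw [LinearMap.mem_ker, lmap_lof] at hx'
      simpa only [lof_apply_same, DirectSum.zero_apply] using congr_arg (fun z => z (i + 1)) hx')
  -- Push the lift forward along the strict map `q`, then extend it from `U` to all of `A`.
  obtain ⟨F, hF, hF', hF0, hFd, hF1, hFG⟩ := hUext 𝒟' (fun l => lmap q (G l)) (hG.comp _)
    (fun l ds hl => by
      obtain ⟨y, hy⟩ := hG' l ds hl
      exact ⟨q _ y, (lmap_lof _ _ _).symm.trans (congr_arg _ hy)⟩)
    (by rw [hG0, map_zero]) (fun l => by rw [hq.map_defect, hGd, map_zero])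
  have hFD : ∀ x, F [𝒟.D x] = 𝒟'.D (F [x]) := fun x => by
    have := hFd [x]
    rw [defect_singleton hF0, sub_eq_zero] at this
    exact this.symm
  refine ⟨F, hF, hF', hF0, hFd, hF1, fun i hi x hx => ?_⟩
  obtain ⟨y, w, hy, hw⟩ := hUcocycle i hi x hx
  obtain ⟨z, hz⟩ := lof_mem_range_barGrading (i := i) (x := G [⟨lof k ℤ A i y, hy⟩]) (by
    simpa using hG' [⟨lof k ℤ A i y, hy⟩] [i - 1]
      (.cons ((hUgr _ _).2 (𝒟.lof_mem_barGrading (by ring) _)) .nil))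
  have hDy : 𝒰.D ⟨lof k ℤ A i y, hy⟩ = 0 := Subtype.ext (by
    refine (hU.D _).trans ?_
    have := congr_arg 𝒟.D hw
    rw [map_add, D_D, D_lof, hx, map_zero, add_zero] at this
    exact this.symm)
  -- The linear part of the lift differs from `s` by elements of `ker p`, so it projects back to `y`
  -- exactly.
  have hpz : p i z = y := by
    have := hGs ⟨lof k ℤ A i y, hy⟩
    rw [hz, LinearMap.mem_ker, map_sub, lmap_lof, LinearMap.comp_apply, hps', sub_eq_zero] at this
    simpa only [Submodule.subtype_apply, lof_apply_same] using congr_arg (fun z => z i) this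
  refine ⟨z, ?_, ⟨w, by rw [hw, hpz]⟩, F [w], ?_⟩
  · have := hGd [⟨lof k ℤ A i y, hy⟩]
    rw [defect_singleton hG0, hDy, hz, bar_D, D_lof, hG.zero_head, sub_zero] at this
    simpa only [lof_apply_same, DirectSum.zero_apply] using congr_arg (fun z => z (i + 1)) this
  · rw [hw, hF.add_head, hFD]
    congr 1
    exact (hFG ⟨_, hy⟩).trans (by rw [hz, lmap_lof])

/-- The projection of a direct sum to one of its summands. -/
def homogProj (k : Type*) [CommRing k] (A : ℤ → Type w) [∀ i, AddCommGroup (A i)]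
    [∀ i, Module k (A i)] (i : ℤ) : (⨁ i, A i) →ₗ[k] ⨁ i, A i :=
  lof k ℤ A i ∘ₗ DirectSum.component k ℤ A i

theorem homogProj_apply (i : ℤ) (x : ⨁ i, A i) : homogProj k A i x = lof k ℤ A i (x i) := rfl

theorem homogProj_map (f : (⨁ i, A i) →ₗ[k] ⨁ i, B i) (r : ℤ)
    (hf : ∀ i x, ∃ y, f (lof k ℤ A i x) = lof k ℤ B (i + r) y) (i : ℤ) (x : ⨁ i, A i) :
    homogProj k B (i + r) (f x) = f (homogProj k A i x) := by
  have : homogProj k B (i + r) ∘ₗ f = f ∘ₗ homogProj k A i := DirectSum.linearMap_ext _ fun j =>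
    LinearMap.ext fun x => by
      obtain ⟨y, hy⟩ := hf j x
      simp only [LinearMap.comp_apply, hy, homogProj_apply]
      by_cases hj : j = i
      · subst hj; rw [lof_apply_same, lof_apply_same, hy]
      · rw [lof_apply_of_ne hj, lof_apply_of_ne (by omega), map_zero, map_zero, map_zero]
  exact LinearMap.congr_fun this x

theorem DGStructure.homogProj_D (𝒟 : DGStructure k A) (i : ℤ) (x : ⨁ i, A i) :
    homogProj k A (i + 1) (𝒟.D x) = 𝒟.D (homogProj k A i x) :=
  homogProj_map 𝒟.D 1 (fun i x => ⟨𝒟.d i x, 𝒟.D_lof i x⟩) i x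

theorem DGStructure.d_apply_eq_zero {𝒟 : DGStructure k A} {x : ⨁ i, A i} (hx : 𝒟.D x = 0) (i : ℤ) :
    𝒟.d i (x i) = 0 := by
  have := 𝒟.homogProj_D i x
  rw [hx, map_zero, homogProj_apply, D_lof] at this
  simpa only [lof_apply_same, DirectSum.zero_apply] using
    (congr_arg (fun z => z (i + 1)) this).symm

theorem DGStructure.homogProj_mem_range (𝒟 : DGStructure k A) (i : ℤ) (y : ⨁ i, A i) :
    homogProj k A i (𝒟.D y) ∈ LinearMap.range 𝒟.D := by
  obtain ⟨i, rfl⟩ : ∃ j, i = j + 1 := ⟨i - 1, by ring⟩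
  exact ⟨_, (𝒟.homogProj_D i y).symm⟩

/-- A correspondence `A ← C → B` of connected DG-algebras under which the positive cohomology of
`A` and `B` corresponds bijectively induces an `A∞`-quasi-isomorphism. -/
theorem DGStructure.IsConnected.exists_isQuasiIso {𝒟 : DGStructure k A} (h𝒟 : 𝒟.IsConnected)
    {𝒞 : DGStructure k C} {𝒟' : DGStructure k B} (h𝒟' : 𝒟'.IsConnected)
    (p : ∀ i, C i →ₗ[k] A i) (q : ∀ i, C i →ₗ[k] B i)
    (hp : IsStrict 𝒞.bar 𝒟.bar (lmap p)) (hq : IsStrict 𝒞.bar 𝒟'.bar (lmap q))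
    (s : ∀ i, A i →ₗ[k] C i) (hps : ∀ i x, p i (s i x) = x)
    (hK : ∀ i, 2 ≤ i → ∀ z : C i, p i z = 0 → 𝒞.d i z = 0 →
      ∃ w : C (i - 1), p (i - 1) w = 0 ∧ 𝒞.D (lof k ℤ C (i - 1) w) = lof k ℤ C i z)
    (hqp : ∀ i, 1 ≤ i → ∀ z : C i, 𝒞.d i z = 0 → lof k ℤ B i (q i z) ∈ LinearMap.range 𝒟'.D →
      lof k ℤ A i (p i z) ∈ LinearMap.range 𝒟.D)
    (hpq : ∀ i, 1 ≤ i → ∀ z : C i, 𝒞.d i z = 0 → lof k ℤ A i (p i z) ∈ LinearMap.range 𝒟.D →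
      lof k ℤ B i (q i z) ∈ LinearMap.range 𝒟'.D)
    (hqs : ∀ i, 1 ≤ i → ∀ y : B i, 𝒟'.d i y = 0 → ∃ z : C i, 𝒞.d i z = 0 ∧
      lof k ℤ B i y - lof k ℤ B i (q i z) ∈ LinearMap.range 𝒟'.D) :
    ∃ F : AInfinityHom 𝒟.toAInfinity 𝒟'.toAInfinity, F.IsQuasiIso := by
  obtain ⟨F, hF, hF', hF0, hFd, hF1, hFpq⟩ := h𝒟.exists_of_correspondence p q hp hq s hps hK
  let f : (⨁ i, A i) →ₗ[k] ⨁ i, B i :=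
    { toFun := fun x => F [x]
      map_add' := fun x y => hF.add_head x y []
      map_smul' := fun r x => hF.smul_head r x [] }
  have hf : ∀ x, f x = F [x] := fun _ => rfl
  have hfD : ∀ x, f (𝒟.D x) = 𝒟'.D (f x) := fun x => by
    have := hFd [x]
    rw [defect_singleton hF0, sub_eq_zero] at this
    exact this.symm
  have hfP : ∀ i x, homogProj k B i (f x) = f (homogProj k A i x) := fun i x => by
    have := homogProj_map f 0 (fun i x => by
      have := hF' [lof k ℤ A i x] [i - 1] (.cons (𝒟.lof_mem_barGrading (by ring) _) .nil)
      obtain ⟨y, hy⟩ := this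
      obtain ⟨z, hz⟩ := lof_cast (k := k) (j := i + 0) (by simp) y
      exact ⟨z, by rw [hf, ← hy, hz]⟩) i x
    rwa [add_zero] at this
  have hf1 : f 1 = 1 := hF1
  refine ⟨toAInfinityHom 𝒟 𝒟' hF hF' hF0 hFd, fun x hx => ?_, fun y hy => ?_⟩
  · rintro ⟨y, hy⟩
    have hx : 𝒟.D x = 0 := hx
    have hy : f x = 𝒟'.D y := hy
    suffices x ∈ LinearMap.range 𝒟.D by
      obtain ⟨z, hz⟩ := this
      exact ⟨z, hz.symm⟩
    refine mem_of_lof_mem fun i => ?_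
    have hxi := d_apply_eq_zero hx i
    have hyi : f (lof k ℤ A i (x i)) ∈ LinearMap.range 𝒟'.D := by
      rw [← homogProj_apply, ← hfP, hy]
      exact 𝒟'.homogProj_mem_range i y
    generalize x i = x at hxi hyi
    rcases lt_trichotomy i 0 with hi | rfl | hi
    · obtain ⟨y, hy⟩ := h𝒟.neg i hi x hxi
      exact ⟨_, hy⟩
    · obtain ⟨c, y, hy⟩ := h𝒟.zero x hxi
      obtain ⟨z, hz⟩ := hyi
      by_cases hc : c = 0
      · exact ⟨lof k ℤ A (-1) y, by rw [hy, hc, zero_smul, zero_add]⟩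
      -- If `c ≠ 0`, solving for the unit exhibits `1 = f 1` as a coboundary in `B`.
      · refine absurd ?_ (h𝒟'.one (c⁻¹ • (z - f (lof k ℤ A (-1) y))))
        rw [map_smul, map_sub, hz, hy, map_add, map_smul, hf1, hfD, add_sub_cancel_right,
          smul_smul, inv_mul_cancel₀ hc, one_smul]
    · obtain ⟨z, hz, ⟨w, hw⟩, w', hw'⟩ := hFpq i hi x hxi
      rw [hw]
      refine Submodule.add_mem _ (hqp i hi z hz ?_) ⟨w, rfl⟩
      have := Submodule.sub_mem _ hyi (show 𝒟'.D w' ∈ LinearMap.range 𝒟'.D from ⟨w', rfl⟩)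
      rwa [hf, hw', add_sub_cancel_right] at this
  · have hy : 𝒟'.D y = 0 := hy
    suffices y ∈ (LinearMap.ker 𝒟.D).map f ⊔ LinearMap.range 𝒟'.D by
      obtain ⟨_, ⟨x, hx, rfl⟩, _, ⟨z, rfl⟩, h⟩ := Submodule.mem_sup.1 this
      refine ⟨x, hx, -z, ?_⟩
      change f x = y + 𝒟'.D (-z)
      rw [← h, map_neg, add_neg_cancel_right]
    refine mem_of_lof_mem fun i => ?_
    have hyi := d_apply_eq_zero hy i
    generalize y i = y at hyi
    rcases lt_trichotomy i 0 with hi | rfl | hi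
    · obtain ⟨z, hz⟩ := h𝒟'.neg i hi y hyi
      exact Submodule.mem_sup_right ⟨_, hz⟩
    · obtain ⟨c, z, hz⟩ := h𝒟'.zero y hyi
      rw [hz]
      refine Submodule.add_mem _ (Submodule.smul_mem _ _ (Submodule.mem_sup_left ⟨1, ?_, hf1⟩))
        (Submodule.mem_sup_right ⟨_, rfl⟩)
      exact 𝒟.D_one
    · obtain ⟨z, hz, hyz⟩ := hqs i hi y hyi
      have hpz : 𝒟.d i (p i z) = 0 := by
        have := hp.D (lof k ℤ C i z)
        rw [bar_D, bar_D, 𝒞.D_lof, hz, map_zero, map_zero, lmap_lof, D_lof] at this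
        simpa only [lof_apply_same, DirectSum.zero_apply] using
          (congr_arg (fun z => z (i + 1)) this).symm
      obtain ⟨z', hz', ⟨w, hw⟩, w', hw'⟩ := hFpq i hi (p i z) hpz
      -- The cocycle `z'` behind `f (p z)` need not be `z`, but `p z` and `p z'` are cohomologous,
      -- hence so are `q z` and `q z'`.
      have h₁ := hpq i hi (z - z') (by rw [map_sub, hz, hz', sub_zero])
        ⟨w, by rw [map_sub, map_sub, hw, add_sub_cancel_left]⟩
      have h₂ : f (lof k ℤ A i (p i z)) ∈ (LinearMap.ker 𝒟.D).map f ⊔ LinearMap.range 𝒟'.D :=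
        Submodule.mem_sup_left ⟨_, by
          change 𝒟.D _ = 0
          rw [D_lof, hpz, map_zero], rfl⟩
      have h₃ := Submodule.add_mem _ (Submodule.add_mem _ h₂
        (Submodule.mem_sup_right (Submodule.add_mem _ h₁ hyz)))
        (Submodule.mem_sup_right (show 𝒟'.D (-w') ∈ LinearMap.range 𝒟'.D from ⟨_, rfl⟩))
      convert h₃ using 1
      rw [hf, hw', map_sub, map_sub, map_neg]
      abel

end

end AInf

namespace AInf

open DirectSum BarDGA CategoryTheory CochainComplex CochainComplex.HomComplex

section

universe w w'

variable {k : Type*} [CommRing k] {A : ℤ → Type w} [∀ i, AddCommGroup (A i)]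
  [∀ i, Module k (A i)] [DirectSum.GRing A] [DirectSum.GAlgebra k A]
  {B : ℤ → Type w'} [∀ i, AddCommGroup (B i)] [∀ i, Module k (B i)] [DirectSum.GRing B]
  [DirectSum.GAlgebra k B]

theorem isStrict_lmap {𝒟 : DGStructure k A} {𝒟' : DGStructure k B} (p : ∀ i, A i →ₗ[k] B i)
    (hd : ∀ i x, p (i + 1) (𝒟.d i x) = 𝒟'.d i (p i x))
    (hm : ∀ i j (x : A i) (y : A j), p (i + j) (GradedMonoid.GMul.mul x y) =
      GradedMonoid.GMul.mul (p i x) (p j y)) :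
    IsStrict 𝒟.bar 𝒟'.bar (lmap p) := by
  have hρ : ∀ x, lmap p (signMap k x) = signMap k (lmap p x) := fun x => by
    have : lmap p ∘ₗ signMap k = signMap k ∘ₗ lmap p := DirectSum.linearMap_ext _ fun i =>
      LinearMap.ext fun x => by
        simp only [LinearMap.comp_apply, signMap_lof, lmap_lof, Units.smul_def, map_zsmul]
    exact LinearMap.congr_fun this x
  refine ⟨fun x => ?_, fun x => ?_, fun x y => ?_⟩
  · have : lmap p ∘ₗ 𝒟.D = 𝒟'.D ∘ₗ lmap p := DirectSum.linearMap_ext _ fun i =>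
      LinearMap.ext fun x => by
        simp only [LinearMap.comp_apply, DGStructure.D_lof, lmap_lof, hd]
    exact LinearMap.congr_fun this x
  · rw [DGStructure.bar_ρ, DGStructure.bar_ρ, map_neg, hρ]
  · rw [DGStructure.bar_m, DGStructure.bar_m, ← hρ]
    generalize signMap k x = x
    have : (LinearMap.mul k (⨁ i, A i)).compr₂ (lmap p) =
        (LinearMap.mul k (⨁ i, B i)).compl₁₂ (lmap p) (lmap p) :=
      DirectSum.linearMap_ext _ fun i => LinearMap.ext fun x => DirectSum.linearMap_ext _ fun j =>
        LinearMap.ext fun y => by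
          simp only [LinearMap.comp_apply, LinearMap.compr₂_apply, LinearMap.compl₁₂_apply,
            LinearMap.mul_apply', lmap_lof, lof_mul_lof, hm]
    exact LinearMap.congr_fun (LinearMap.congr_fun this x) y

end

/-! ### Triangular gluing of two complexes along a bimodule. -/

section Collage

universe v v' v'' u u' u''

variable {C : Type u} [Category.{v} C] {C' : Type u'} [Category.{v'} C']
  {E : Type u''} [Category.{v''} E]

/-- The objects of the category obtained by gluing `C'` and `C` along the bimodule
`(X, Y) ↦ (Φ X ⟶ Φ' Y)`; here an object is a formal sum of an object of `C'` and an object of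
`C`. -/
structure Collage (Φ : C ⥤ E) (Φ' : C' ⥤ E) where
  fst : C'
  snd : C

variable (Φ : C ⥤ E) (Φ' : C' ⥤ E) [Preadditive C] [Preadditive C'] [Preadditive E]
  [Φ.Additive] [Φ'.Additive]

/-- Morphisms are triangular matrices and composition is matrix multiplication, the off-diagonal
entries being acted on through `Φ` and `Φ'`. -/
instance : Category (Collage Φ Φ') where
  Hom X Y := (X.fst ⟶ Y.fst) × (X.snd ⟶ Y.snd) × (Φ.obj X.snd ⟶ Φ'.obj Y.fst)
  id X := (𝟙 _, 𝟙 _, 0)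
  comp f g := (f.1 ≫ g.1, f.2.1 ≫ g.2.1, Φ.map f.2.1 ≫ g.2.2 + f.2.2 ≫ Φ'.map g.1)
  id_comp f := by simp
  comp_id f := by simp
  assoc f g h := by simp [add_assoc]

instance (X Y : Collage Φ Φ') : AddCommGroup (X ⟶ Y) :=
  inferInstanceAs (AddCommGroup ((X.fst ⟶ Y.fst) × (X.snd ⟶ Y.snd) × (Φ.obj X.snd ⟶ Φ'.obj Y.fst)))

instance : Preadditive (Collage Φ Φ') where
  add_comp X Y Z f f' g := by
    refine Prod.ext (Preadditive.add_comp _ _ _ f.1 f'.1 g.1)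
      (Prod.ext (Preadditive.add_comp _ _ _ f.2.1 f'.2.1 g.2.1) ?_)
    change Φ.map (f.2.1 + f'.2.1) ≫ g.2.2 + (f.2.2 + f'.2.2) ≫ Φ'.map g.1 =
      (Φ.map f.2.1 ≫ g.2.2 + f.2.2 ≫ Φ'.map g.1) + (Φ.map f'.2.1 ≫ g.2.2 + f'.2.2 ≫ Φ'.map g.1)
    rw [Functor.map_add, Preadditive.add_comp, Preadditive.add_comp]
    abel
  comp_add X Y Z f g g' := by
    refine Prod.ext (Preadditive.comp_add _ _ _ f.1 g.1 g'.1)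
      (Prod.ext (Preadditive.comp_add _ _ _ f.2.1 g.2.1 g'.2.1) ?_)
    change Φ.map f.2.1 ≫ (g.2.2 + g'.2.2) + f.2.2 ≫ Φ'.map (g.1 + g'.1) =
      (Φ.map f.2.1 ≫ g.2.2 + f.2.2 ≫ Φ'.map g.1) + (Φ.map f.2.1 ≫ g'.2.2 + f.2.2 ≫ Φ'.map g'.1)
    rw [Functor.map_add, Preadditive.comp_add, Preadditive.comp_add]
    abel

variable (k : Type*) [CommRing k] [Linear k C] [Linear k C'] [Linear k E]
  [Φ.Linear k] [Φ'.Linear k]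

instance (X Y : Collage Φ Φ') : Module k (X ⟶ Y) :=
  inferInstanceAs (Module k ((X.fst ⟶ Y.fst) × (X.snd ⟶ Y.snd) × (Φ.obj X.snd ⟶ Φ'.obj Y.fst)))

instance : Linear k (Collage Φ Φ') where
  homModule X Y := inferInstance
  smul_comp X Y Z r f g := by
    refine Prod.ext (Linear.smul_comp _ _ _ r f.1 g.1)
      (Prod.ext (Linear.smul_comp _ _ _ r f.2.1 g.2.1) ?_)
    change Φ.map (r • f.2.1) ≫ g.2.2 + (r • f.2.2) ≫ Φ'.map g.1 =
      r • (Φ.map f.2.1 ≫ g.2.2 + f.2.2 ≫ Φ'.map g.1)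
    rw [Functor.map_smul, Linear.smul_comp, Linear.smul_comp, smul_add]
  comp_smul X Y Z f r g := by
    refine Prod.ext (Linear.comp_smul _ _ _ f.1 r g.1)
      (Prod.ext (Linear.comp_smul _ _ _ f.2.1 r g.2.1) ?_)
    change Φ.map f.2.1 ≫ (r • g.2.2) + f.2.2 ≫ Φ'.map (r • g.1) =
      r • (Φ.map f.2.1 ≫ g.2.2 + f.2.2 ≫ Φ'.map g.1)
    rw [Functor.map_smul, Linear.comp_smul, Linear.comp_smul, smul_add]

variable {Φ Φ'} {Q : CochainComplex C ℤ} {Q' : CochainComplex C' ℤ}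

/-- The complex obtained by gluing `Q` and `Q'` along a cocycle of degree `1`. -/
def collageComplex (ψ : Cochain ((Φ.mapHomologicalComplex _).obj Q)
    ((Φ'.mapHomologicalComplex _).obj Q') 1) (hψ : δ 1 2 ψ = 0) :
    CochainComplex (Collage Φ Φ') ℤ where
  X p := ⟨Q'.X p, Q.X p⟩
  d p q := (Q'.d p q, Q.d p q, if h : p + 1 = q then ψ.v p q h else 0)
  shape p q hpq := by
    have h : ¬ p + 1 = q := hpq
    refine Prod.ext (Q'.shape p q hpq) (Prod.ext (Q.shape p q hpq) (dif_neg h))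
  d_comp_d' p q r hpq hqr := by
    have h₁ : p + 1 = q := hpq
    have h₂ : q + 1 = r := hqr
    refine Prod.ext (Q'.d_comp_d p q r) (Prod.ext (Q.d_comp_d p q r) ?_)
    -- The off-diagonal entry of the square of the differential is `δ ψ`; in degree `2` the sign in
    -- `δ` is positive, so the two expressions agree literally.
    have := Cochain.congr_v hψ p r (by omega)
    rw [δ_v 1 2 rfl ψ p r (by omega) q q (by omega) (by omega)] at this
    let ψ₁ : Φ.obj (Q.X q) ⟶ Φ'.obj (Q'.X r) := if h : q + 1 = r then ψ.v q r h else 0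
    let ψ₂ : Φ.obj (Q.X p) ⟶ Φ'.obj (Q'.X q) := if h : p + 1 = q then ψ.v p q h else 0
    have e₁ : ψ₁ = ψ.v q r h₂ := dif_pos h₂
    have e₂ : ψ₂ = ψ.v p q h₁ := dif_pos h₁
    change Φ.map (Q.d p q) ≫ ψ₁ + ψ₂ ≫ Φ'.map (Q'.d q r) = 0
    rw [e₁, e₂, add_comm]
    simp only [Int.negOnePow_even 2 even_two, one_smul] at this
    exact this

variable {ψ : Cochain ((Φ.mapHomologicalComplex _).obj Q) ((Φ'.mapHomologicalComplex _).obj Q') 1}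
  {hψ : δ 1 2 ψ = 0}

theorem collageComplex_d (p q : ℤ) (h : p + 1 = q) :
    (collageComplex ψ hψ).d p q = (Q'.d p q, Q.d p q, ψ.v p q h) := by
  refine Prod.ext rfl (Prod.ext rfl (dif_pos h))

/-- The component in `Q'` of an endomorphism of a glued complex. -/
def collageFst (ψ : Cochain ((Φ.mapHomologicalComplex _).obj Q)
    ((Φ'.mapHomologicalComplex _).obj Q') 1) (hψ : δ 1 2 ψ = 0) (i : ℤ) :
    Cochain (collageComplex ψ hψ) (collageComplex ψ hψ) i →ₗ[k] Cochain Q' Q' i where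
  toFun z := Cochain.mk fun p q h => (z.v p q h).1
  map_add' _ _ := by ext; rfl
  map_smul' _ _ := by ext; rfl

/-- The component in `Q` of an endomorphism of a glued complex. -/
def collageSnd (ψ : Cochain ((Φ.mapHomologicalComplex _).obj Q)
    ((Φ'.mapHomologicalComplex _).obj Q') 1) (hψ : δ 1 2 ψ = 0) (i : ℤ) :
    Cochain (collageComplex ψ hψ) (collageComplex ψ hψ) i →ₗ[k] Cochain Q Q i where
  toFun z := Cochain.mk fun p q h => (z.v p q h).2.1
  map_add' _ _ := by ext; rfl
  map_smul' _ _ := by ext; rfl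

/-- The off-diagonal component of an endomorphism of a glued complex. -/
def collageHom {i : ℤ} (z : Cochain (collageComplex ψ hψ) (collageComplex ψ hψ) i) :
    Cochain ((Φ.mapHomologicalComplex _).obj Q) ((Φ'.mapHomologicalComplex _).obj Q') i :=
  Cochain.mk fun p q h => (z.v p q h).2.2

/-- The endomorphism of a glued complex with given components. -/
def collageMk (hψ : δ 1 2 ψ = 0) {i : ℤ} (b : Cochain Q' Q' i) (a : Cochain Q Q i)
    (h : Cochain ((Φ.mapHomologicalComplex _).obj Q) ((Φ'.mapHomologicalComplex _).obj Q') i) :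
    Cochain (collageComplex ψ hψ) (collageComplex ψ hψ) i :=
  Cochain.mk fun p q hpq => (b.v p q hpq, a.v p q hpq, h.v p q hpq)

variable {i : ℤ} (z : Cochain (collageComplex ψ hψ) (collageComplex ψ hψ) i)

theorem collageFst_mk (b : Cochain Q' Q' i) (a : Cochain Q Q i)
    (h : Cochain ((Φ.mapHomologicalComplex _).obj Q) ((Φ'.mapHomologicalComplex _).obj Q') i) :
    collageFst k ψ hψ i (collageMk hψ b a h) = b := by
  ext; rfl

theorem collageSnd_mk (b : Cochain Q' Q' i) (a : Cochain Q Q i)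
    (h : Cochain ((Φ.mapHomologicalComplex _).obj Q) ((Φ'.mapHomologicalComplex _).obj Q') i) :
    collageSnd k ψ hψ i (collageMk hψ b a h) = a := by
  ext; rfl

theorem collageHom_mk (b : Cochain Q' Q' i) (a : Cochain Q Q i)
    (h : Cochain ((Φ.mapHomologicalComplex _).obj Q) ((Φ'.mapHomologicalComplex _).obj Q') i) :
    collageHom (collageMk hψ b a h) = h := by
  ext; rfl

theorem collage_ext {z z' : Cochain (collageComplex ψ hψ) (collageComplex ψ hψ) i}
    (h₁ : collageFst k ψ hψ i z = collageFst k ψ hψ i z')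
    (h₂ : collageSnd k ψ hψ i z = collageSnd k ψ hψ i z') (h₃ : collageHom z = collageHom z') :
    z = z' := by
  ext p q h
  exact Prod.ext (Cochain.congr_v h₁ p q h) (Prod.ext (Cochain.congr_v h₂ p q h)
    (Cochain.congr_v h₃ p q h))

theorem collageFst_comp {j m : ℤ} (w : Cochain (collageComplex ψ hψ) (collageComplex ψ hψ) j)
    (h : i + j = m) : collageFst k ψ hψ m (z.comp w h) =
      (collageFst k ψ hψ i z).comp (collageFst k ψ hψ j w) h := by
  ext p q hpq
  rw [Cochain.comp_v _ _ h p (p + i) q rfl (by omega)]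
  change ((z.comp w h).v p q hpq).1 = _
  rw [Cochain.comp_v _ _ h p (p + i) q rfl (by omega)]
  rfl

theorem collageSnd_comp {j m : ℤ} (w : Cochain (collageComplex ψ hψ) (collageComplex ψ hψ) j)
    (h : i + j = m) : collageSnd k ψ hψ m (z.comp w h) =
      (collageSnd k ψ hψ i z).comp (collageSnd k ψ hψ j w) h := by
  ext p q hpq
  rw [Cochain.comp_v _ _ h p (p + i) q rfl (by omega)]
  change ((z.comp w h).v p q hpq).2.1 = _
  rw [Cochain.comp_v _ _ h p (p + i) q rfl (by omega)]
  rfl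

theorem units_smul_fst {X Y : Collage Φ Φ'} (r : ℤˣ) (f : X ⟶ Y) : (r • f).1 = r • f.1 := by
  rcases Int.units_eq_one_or r with rfl | rfl
  · simp
  · simp; rfl

theorem units_smul_snd {X Y : Collage Φ Φ'} (r : ℤˣ) (f : X ⟶ Y) : (r • f).2 = r • f.2 := by
  rcases Int.units_eq_one_or r with rfl | rfl
  · simp
  · simp; rfl

theorem collageFst_δ {j : ℤ} (h : i + 1 = j) :
    collageFst k ψ hψ j (δ i j z) = δ i j (collageFst k ψ hψ i z) := by
  ext p q hpq
  rw [δ_v i j h _ p q hpq (q - 1) (p + 1) rfl rfl]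
  change ((δ i j z).v p q hpq).1 = _
  rw [δ_v i j h _ p q hpq (q - 1) (p + 1) rfl rfl]
  refine (congr_arg₂ (· + ·) rfl (units_smul_fst _ _)).trans ?_
  rfl

theorem collageSnd_δ {j : ℤ} (h : i + 1 = j) :
    collageSnd k ψ hψ j (δ i j z) = δ i j (collageSnd k ψ hψ i z) := by
  ext p q hpq
  rw [δ_v i j h _ p q hpq (q - 1) (p + 1) rfl rfl]
  change ((δ i j z).v p q hpq).2.1 = _
  rw [δ_v i j h _ p q hpq (q - 1) (p + 1) rfl rfl]
  refine (congr_arg₂ (· + ·) rfl (congr_arg Prod.fst (units_smul_snd _ _))).trans ?_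
  rfl

/-- The twist by `ψ` is visible only in this entry. It makes the kernel of the projection to `End Q`
the cone, up to shift and signs, of composition with `ψ` on `End Q'`. -/
theorem collageHom_δ {j : ℤ} (h : i + 1 = j) :
    collageHom (δ i j z) = δ i j (collageHom z) +
      ((collageSnd k ψ hψ i z).map Φ).comp ψ h +
      j.negOnePow • ψ.comp ((collageFst k ψ hψ i z).map Φ') ((add_comm 1 i).trans h) := by
  ext p q hpq
  rw [Cochain.add_v, Cochain.add_v, Cochain.units_smul_v,
    Cochain.comp_v _ _ h p (q - 1) q (by omega) (by omega),
    Cochain.comp_v _ _ ((add_comm 1 i).trans h) p (p + 1) q (by omega) (by omega),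
    δ_v i j h _ p q hpq (q - 1) (p + 1) rfl rfl]
  change ((δ i j z).v p q hpq).2.2 = _
  rw [δ_v i j h _ p q hpq (q - 1) (p + 1) rfl rfl, collageComplex_d _ _ (by omega),
    collageComplex_d _ _ rfl]
  refine (congr_arg₂ (· + ·) rfl (congr_arg Prod.snd (units_smul_snd _ _))).trans ?_
  let ψ₁ : Φ.obj (Q.X (q - 1)) ⟶ Φ'.obj (Q'.X q) := ψ.v (q - 1) q (by omega)
  let ψ₂ : Φ.obj (Q.X p) ⟶ Φ'.obj (Q'.X (p + 1)) := ψ.v p (p + 1) rfl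
  let z₁ : Φ.obj (Q.X p) ⟶ Φ'.obj (Q'.X (q - 1)) := (z.v p (q - 1) (by omega)).2.2
  let z₂ : Φ.obj (Q.X (p + 1)) ⟶ Φ'.obj (Q'.X q) := (z.v (p + 1) q (by omega)).2.2
  let a : Q.X p ⟶ Q.X (q - 1) := (z.v p (q - 1) (by omega)).2.1
  let b : Q'.X (p + 1) ⟶ Q'.X q := (z.v (p + 1) q (by omega)).1
  change (Φ.map a ≫ ψ₁ +
    z₁ ≫ Φ'.map (Q'.d (q - 1) q)) +
    j.negOnePow • (Φ.map (Q.d p (p + 1)) ≫ z₂ +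
      ψ₂ ≫ Φ'.map b) =
    (z₁ ≫ Φ'.map (Q'.d (q - 1) q) +
      j.negOnePow • (Φ.map (Q.d p (p + 1)) ≫ z₂)) +
    Φ.map a ≫ ψ₁ +
    j.negOnePow • (ψ₂ ≫ Φ'.map b)
  rw [smul_add]
  abel

end Collage

end AInf

namespace AInf

open DirectSum BarDGA CategoryTheory CochainComplex CochainComplex.HomComplex

/-! ### Endomorphism algebras related by a bimodule cocycle. -/

section

universe v u

variable {C : Type u} [Category.{v} C] [Preadditive C] {k : Type*} [CommRing k] [Linear k C]
  {Q : CochainComplex C ℤ}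

theorem endDG_D_lof {i j : ℤ} (h : i + 1 = j) (x : Cochain Q Q i) :
    (endDG k Q).D (lof k ℤ (EndGr Q) i x) = lof k ℤ (EndGr Q) j (δ i j x) := by
  subst h; exact (endDG k Q).D_lof i x

end

theorem DGStructure.lof_mem_range_D {k : Type*} [Field k] {A : ℤ → Type*} [∀ i, AddCommGroup (A i)]
    [∀ i, Module k (A i)] [DirectSum.GRing A] [DirectSum.GAlgebra k A] (𝒟 : DGStructure k A) {i : ℤ}
    {x : A i} (h : lof k ℤ A i x ∈ LinearMap.range 𝒟.D) :
    ∃ y : A (i - 1), 𝒟.D (lof k ℤ A (i - 1) y) = lof k ℤ A i x := by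
  obtain ⟨i, rfl⟩ : ∃ j, i = j + 1 := ⟨i - 1, by ring⟩
  obtain ⟨y, hy⟩ := h
  have := 𝒟.homogProj_D i y
  rw [hy, homogProj_apply, lof_apply_same, homogProj_apply] at this
  obtain ⟨z, hz⟩ := lof_cast (k := k) (show i = i + 1 - 1 by ring) (y i)
  exact ⟨z, by rw [this, hz]⟩

theorem lof_mem_range_endDG {C : Type*} [Category C] [Preadditive C] {k : Type*} [Field k]
    [Linear k C] {Q : CochainComplex C ℤ} {i j : ℤ} (h : i + 1 = j) (x : Cochain Q Q j) :
    lof k ℤ (EndGr Q) j x ∈ LinearMap.range (endDG k Q).D ↔ ∃ y, δ i j y = x := by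
  constructor
  · intro hx
    obtain ⟨y, hy⟩ := (endDG k Q).lof_mem_range_D hx
    obtain rfl : i = j - 1 := by omega
    rw [endDG_D_lof h] at hy
    exact ⟨y, by simpa only [lof_apply_same] using congr_arg (fun z => z j) hy⟩
  · rintro ⟨y, rfl⟩
    exact ⟨_, endDG_D_lof h y⟩

section

universe v v' v'' u u' u''

variable {C : Type u} [Category.{v} C] {C' : Type u'} [Category.{v'} C']
  {E : Type u''} [Category.{v''} E]
  (Φ : C ⥤ E) (Φ' : C' ⥤ E) [Preadditive C] [Preadditive C'] [Preadditive E]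
  [Φ.Additive] [Φ'.Additive]

theorem map_units_smul {K L : CochainComplex C ℤ} {n : ℤ} (r : ℤˣ) (z : Cochain K L n) :
    (r • z).map Φ = r • z.map Φ := by
  rcases Int.units_eq_one_or r with rfl | rfl <;> simp

theorem δ_comp_of_δ_eq_zero {K L M : CochainComplex C ℤ} {n₁ n₂ n₁₂ m₂ m₁₂ : ℤ} {x : Cochain K L n₁}
    (hx : δ n₁ (n₁ + 1) x = 0) (y : Cochain L M n₂) (h : n₁ + n₂ = n₁₂) (h₂ : n₂ + 1 = m₂)
    (h₁₂ : n₁₂ + 1 = m₁₂) : δ n₁₂ m₁₂ (x.comp y h) = x.comp (δ n₂ m₂ y) (by omega) := by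
  rw [δ_comp x y h (n₁ + 1) m₂ m₁₂ h₁₂ rfl h₂, hx, Cochain.zero_comp, smul_zero, add_zero]

theorem δ_comp_of_δ_eq_zero_right {K L M : CochainComplex C ℤ} {n₁ n₂ n₁₂ m₁ m₁₂ : ℤ}
    (x : Cochain K L n₁) {y : Cochain L M n₂} (hy : δ n₂ (n₂ + 1) y = 0) (h : n₁ + n₂ = n₁₂)
    (h₁ : n₁ + 1 = m₁) (h₁₂ : n₁₂ + 1 = m₁₂) :
    δ n₁₂ m₁₂ (x.comp y h) = n₂.negOnePow • (δ n₁ m₁ x).comp y (by omega) := by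
  rw [δ_comp x y h m₁ (n₂ + 1) m₁₂ h₁₂ h₁ rfl, hy, Cochain.comp_zero, zero_add]

theorem negOnePow_smul_δ {K L : CochainComplex C ℤ} {i j : ℤ} (n : ℤˣ) (x : Cochain K L i) :
    n • δ i j x = δ i j (n • x) := (δ_units_smul (R := ℤ) i j n x).symm

variable {k : Type*} [Field k] [Linear k C] [Linear k C'] [Linear k E]
  [Φ.Linear k] [Φ'.Linear k] {Φ Φ'}

/-- Two complexes whose endomorphism algebras have the same positive cohomology as a common
bimodule, via a cocycle of that bimodule, have `A∞`-quasi-isomorphic endomorphism algebras. -/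
theorem exists_isQuasiIso_of_cocycle {A : ℤ → Type*} [∀ i, AddCommGroup (A i)]
    [∀ i, Module k (A i)] [DirectSum.GRing A] [DirectSum.GAlgebra k A] {𝒟 : DGStructure k A}
    {Q : CochainComplex C ℤ} {Q' : CochainComplex C' ℤ}
    (σ : ∀ i, EndGr Q i ≃ₗ[k] A i)
    (hσ : ∀ i x, σ (i + 1) (δ i (i + 1) x) = 𝒟.d i (σ i x))
    (hσ' : ∀ i j (x : EndGr Q i) (y : EndGr Q j), σ (i + j) (GradedMonoid.GMul.mul x y) =
      GradedMonoid.GMul.mul (σ i x) (σ j y))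
    (h𝒟 : 𝒟.IsConnected) (hQ' : (endDG k Q').IsConnected)
    {ψ : Cochain ((Φ.mapHomologicalComplex _).obj Q) ((Φ'.mapHomologicalComplex _).obj Q') 1}
    (hψ : δ 1 2 ψ = 0)
    (inj : ∀ h i j (hij : i + 1 = j), h + 1 = i → 1 ≤ i → ∀ a : Cochain Q Q i, δ i j a = 0 →
      (∃ x, δ i j x = (a.map Φ).comp ψ hij) → ∃ y, δ h i y = a)
    (inj' : ∀ h i j (hij : 1 + i = j), h + 1 = i → 1 ≤ i → ∀ b : Cochain Q' Q' i, δ i j b = 0 →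
      (∃ x, δ i j x = ψ.comp (b.map Φ') hij) → ∃ y, δ h i y = b)
    (surj : ∀ i j m (hij : i + 1 = j), j + 1 = m → 1 ≤ i → ∀ x, δ j m x = 0 →
      ∃ a : Cochain Q Q i, δ i j a = 0 ∧ ∃ y, x = (a.map Φ).comp ψ hij + δ i j y)
    (surj' : ∀ i j m (hij : 1 + i = j), j + 1 = m → 1 ≤ i → ∀ x, δ j m x = 0 →
      ∃ b : Cochain Q' Q' i, δ i j b = 0 ∧ ∃ y, x = ψ.comp (b.map Φ') hij + δ i j y) :
    ∃ F : AInfinityHom 𝒟.toAInfinity (endDG k Q').toAInfinity, F.IsQuasiIso := by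
  have hψ' : δ 1 (1 + 1) ψ = 0 := hψ
  have hσr : ∀ i j (h : i + 1 = j) (x : Cochain Q Q j),
      lof k ℤ A j (σ j x) ∈ LinearMap.range 𝒟.D ↔ ∃ y, δ i j y = x := by
    intro i j h x
    subst h
    constructor
    · intro hx
      obtain ⟨y, hy⟩ := 𝒟.lof_mem_range_D hx
      obtain ⟨y', hy'⟩ := lof_cast (k := k) (show i + 1 - 1 = i by ring) y
      rw [hy', 𝒟.D_lof] at hy
      refine ⟨(σ i).symm y', (σ (i + 1)).injective ?_⟩
      rw [hσ, LinearEquiv.apply_symm_apply]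
      simpa only [lof_apply_same] using congr_arg (fun z => z (i + 1)) hy
    · rintro ⟨y, rfl⟩
      exact ⟨lof k ℤ A i (σ i y), by rw [𝒟.D_lof, hσ]⟩
  -- The three matrix entries of the cocycle equation. The last one says that `a ψ` and `ψ b` agree
  -- up to sign and coboundary.
  have hδ : ∀ i (z : Cochain (collageComplex ψ hψ) (collageComplex ψ hψ) i), δ i (i + 1) z = 0 →
      δ i (i + 1) (collageFst k ψ hψ i z) = 0 ∧ δ i (i + 1) (collageSnd k ψ hψ i z) = 0 ∧
      δ i (i + 1) (collageHom z) + ((collageSnd k ψ hψ i z).map Φ).comp ψ rfl +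
        (i + 1).negOnePow • ψ.comp ((collageFst k ψ hψ i z).map Φ') (add_comm 1 i) = 0 := by
    intro i z hz
    refine ⟨?_, ?_, ?_⟩
    · rw [← collageFst_δ k z rfl, hz, map_zero]
    · rw [← collageSnd_δ k z rfl, hz, map_zero]
    · rw [← collageHom_δ k z rfl, hz]; ext; rfl
  refine h𝒟.exists_isQuasiIso (𝒞 := endDG k (collageComplex ψ hψ)) hQ'
    (fun i => (σ i).toLinearMap ∘ₗ collageSnd k ψ hψ i) (fun i => collageFst k ψ hψ i)
    (isStrict_lmap _ (fun i x => ?_) fun i j x y => ?_)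
    (isStrict_lmap _ (fun i x => collageFst_δ k x rfl) fun i j x y => collageFst_comp k y x _)
    -- Placing `a` on the diagonal is a linear section only: the term `a ψ` prevents it from being a
    -- chain map.
    (fun i => { toFun := fun x => collageMk hψ 0 ((σ i).symm x) 0, map_add' := ?_, map_smul' := ?_ })
    (fun i x => ?_) (fun i hi z hz hz' => ?_) (fun i hi z hz hb => ?_) (fun i hi z hz ha => ?_)
    (fun i hi b hb => ?_)
  · exact (congr_arg (σ _) (collageSnd_δ k x rfl)).trans (hσ _ _)
  · exact (congr_arg (σ _) (collageSnd_comp k y x _)).trans (hσ' _ _ _ _)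
  · intro x y
    ext p q h
    exact Prod.ext (add_zero _).symm (Prod.ext
      (congr_arg (fun c => Cochain.v c p q h) (map_add (σ i).symm x y)) (add_zero _).symm)
  · intro r x
    ext p q h
    exact Prod.ext (smul_zero (A := (Q'.X p ⟶ Q'.X q)) r).symm (Prod.ext
      (congr_arg (fun c => Cochain.v c p q h) (map_smul (σ i).symm r x))
      (smul_zero (A := (Φ.obj (Q.X p) ⟶ Φ'.obj (Q'.X q))) r).symm)
  · exact (congr_arg (σ i) (collageSnd_mk k _ _ _)).trans ((σ i).apply_symm_apply x)
  all_goals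
    obtain ⟨j, rfl⟩ : ∃ j, i = j + 1 := ⟨i - 1, by ring⟩
  · have hz : collageSnd k ψ hψ (j + 1) z = 0 := (σ (j + 1)).map_eq_zero_iff.1 hz
    obtain ⟨hb, -, hh⟩ := hδ (j + 1) z hz'
    rw [hz, Cochain.map_zero, Cochain.zero_comp, add_zero] at hh
    -- Acyclicity of the kernel, as for a cone. The off-diagonal entry makes `ψ b` a coboundary, so
    -- `b = δ b'` by injectivity in degree `j + 1`.
    obtain ⟨b', hb'⟩ := inj' j (j + 1) (j + 1 + 1) (by ring) rfl (by omega) _ hb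
      ⟨-((j + 1 + 1).negOnePow • collageHom z), by
        rw [δ_neg, ← negOnePow_smul_δ, eq_neg_of_add_eq_zero_left hh, smul_neg, neg_neg, smul_smul,
          Int.units_mul_self, one_smul]⟩
    have hb'' : δ (j + 1) (j + 1 + 1) (ψ.comp (b'.map Φ') (add_comm 1 j)) =
        ψ.comp ((collageFst k ψ hψ (j + 1) z).map Φ') (add_comm 1 (j + 1)) := by
      rw [δ_comp_of_δ_eq_zero hψ' _ _ rfl rfl, δ_map, hb']
    -- The off-diagonal entry, corrected by `ψ b'`, is a cocycle, and surjectivity in degree `j`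
    -- writes it as `ψ b'' + δ x`. This needs `j ≥ 1`, hence total degree at least `2`.
    obtain ⟨b'', hb₂, x, hx⟩ := surj' j (j + 1) (j + 1 + 1) (by ring) rfl (by omega)
      (collageHom z + (j + 1 + 1).negOnePow • ψ.comp (b'.map Φ') (add_comm 1 j)) (by
        rw [δ_add, ← negOnePow_smul_δ, hb'', hh])
    obtain ⟨w, hw, hwz⟩ : ∃ w : Cochain (collageComplex ψ hψ) (collageComplex ψ hψ) j,
        collageSnd k ψ hψ j w = 0 ∧ δ j (j + 1) w = z := by
      refine ⟨collageMk hψ (b' + (j + 1).negOnePow • b'') 0 x, collageSnd_mk k _ _ _,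
        collage_ext k ?_ ?_ ?_⟩
      · rw [collageFst_δ _ _ rfl, collageFst_mk, δ_add, ← negOnePow_smul_δ, hb₂, smul_zero, add_zero,
          hb']
      · rw [collageSnd_δ _ _ rfl, collageSnd_mk, δ_zero, hz]
      · rw [collageHom_δ k _ rfl, collageHom_mk, collageSnd_mk, collageFst_mk, Cochain.map_zero,
          Cochain.zero_comp, add_zero, Cochain.map_add, map_units_smul, Cochain.comp_add,
          Cochain.comp_units_smul, smul_add, smul_smul, Int.units_mul_self, one_smul,
          eq_sub_of_add_eq hx, Int.negOnePow_succ (j + 1)]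
        simp only [Units.neg_smul]
        abel
    have key : ∀ l, l = j → ∃ w : Cochain (collageComplex ψ hψ) (collageComplex ψ hψ) l,
        collageSnd k ψ hψ l w = 0 ∧ (endDG k (collageComplex ψ hψ)).D (lof k ℤ (EndGr _) l w) =
          lof k ℤ (EndGr _) (j + 1) z := by
      rintro _ rfl
      exact ⟨w, hw, by rw [endDG_D_lof rfl, hwz]⟩
    obtain ⟨w, hw, hwz⟩ := key (j + 1 - 1) (by ring)
    exact ⟨w, (congr_arg (σ _) hw).trans (map_zero _), hwz⟩
  · obtain ⟨-, ha, hh⟩ := hδ (j + 1) z hz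
    obtain ⟨b', hb'⟩ := (lof_mem_range_endDG rfl _).1 hb
    have hb'' : δ (j + 1) (j + 1 + 1) (ψ.comp (b'.map Φ') (add_comm 1 j)) =
        ψ.comp ((collageFst k ψ hψ (j + 1) z).map Φ') (add_comm 1 (j + 1)) := by
      rw [δ_comp_of_δ_eq_zero hψ' _ _ rfl rfl, δ_map, hb']
    refine (hσr j (j + 1) rfl _).2 (inj j (j + 1) (j + 1 + 1) rfl rfl (by omega) _ ha
      ⟨-(collageHom z + (j + 1 + 1).negOnePow • ψ.comp (b'.map Φ') (add_comm 1 j)), ?_⟩)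
    rw [δ_neg, δ_add, ← negOnePow_smul_δ, hb'']
    exact neg_eq_of_add_eq_zero_right (by rw [← hh]; abel)
  · obtain ⟨hb, -, hh⟩ := hδ (j + 1) z hz
    obtain ⟨a', ha'⟩ := (hσr j (j + 1) rfl _).1 ha
    have ha'' : δ (j + 1) (j + 1 + 1) ((a'.map Φ).comp ψ rfl) =
        -((collageSnd k ψ hψ (j + 1) z).map Φ).comp ψ rfl := by
      rw [δ_comp_of_δ_eq_zero_right _ hψ' _ rfl rfl, δ_map, ha', Int.negOnePow_one,
        Units.neg_smul, one_smul]
    refine (lof_mem_range_endDG rfl _).2 (inj' j (j + 1) (j + 1 + 1) (by ring) rfl (by omega) _ hb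
      ⟨-((j + 1 + 1).negOnePow • (collageHom z - (a'.map Φ).comp ψ rfl)), ?_⟩)
    rw [δ_neg, ← negOnePow_smul_δ, δ_sub, ha'', sub_neg_eq_add, eq_neg_of_add_eq_zero_left hh,
      smul_neg, neg_neg, smul_smul, Int.units_mul_self, one_smul]
  · have hb : δ (j + 1) (j + 1 + 1) b = 0 := hb
    -- Given `b`, write `ψ b = a ψ + δ y`. With suitable signs, `b`, `a` and `y` are the entries of
    -- a cocycle of the glued complex.
    obtain ⟨a, ha, y, hy⟩ := surj (j + 1) (j + 1 + 1) (j + 1 + 1 + 1) rfl rfl (by omega)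
      (ψ.comp (b.map Φ') (add_comm 1 (j + 1))) (by
        rw [δ_comp_of_δ_eq_zero hψ' _ _ rfl rfl, δ_map, hb, Cochain.map_zero, Cochain.comp_zero])
    refine ⟨collageMk hψ b (-((j + 1 + 1).negOnePow • a)) (-((j + 1 + 1).negOnePow • y)),
      collage_ext k ?_ ?_ ?_, ?_⟩
    · exact (collageFst_δ k _ rfl).trans ((congr_arg _ (collageFst_mk k _ _ _)).trans
        (hb.trans (map_zero _).symm))
    · refine (collageSnd_δ k _ rfl).trans ((congr_arg _ (collageSnd_mk k _ _ _)).trans ?_)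
      rw [δ_neg, ← negOnePow_smul_δ, ha, smul_zero, neg_zero]
      exact (map_zero _).symm
    · refine (collageHom_δ k _ rfl).trans ?_
      rw [collageHom_mk, collageSnd_mk, collageFst_mk, hy, Cochain.map_neg, map_units_smul,
        Cochain.neg_comp, Cochain.units_smul_comp, δ_neg, ← negOnePow_smul_δ, smul_add]
      refine Eq.trans (b := 0) (by abel) ?_
      ext; rfl
    · rw [collageFst_mk, sub_self]
      exact Submodule.zero_mem _

end

end AInf

namespace AInf

/-! ### Augmented and spherical complexes of projectives. -/

open CategoryTheory CochainComplex CochainComplex.HomComplex Limits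

universe v u

variable {C : Type u} [Category.{v} C] [Preadditive C]

/-- A cocycle all of whose components lie in given subgroups is a coboundary, up to some degree, if
this can be achieved one degree at a time. -/
theorem exists_δ_eq_of_step {K L : CochainComplex C ℤ} {i j m : ℤ} (hij : i + 1 = j) (hjm : j + 1 = m)
    (G : ∀ p q, AddSubgroup (K.X p ⟶ L.X q))
    (hGr : ∀ p q r (f : K.X p ⟶ L.X q), f ∈ G p q → f ≫ L.d q r ∈ G p r)
    (hGl : ∀ p q r (f : K.X q ⟶ L.X r), f ∈ G q r → K.d p q ≫ f ∈ G p r)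
    {p₀ t : ℤ} (hK : ∀ p, t < p → IsZero (K.X p))
    (step : ∀ p q r s, p₀ < p → p + i = q → q + 1 = r → r + 1 = s →
      ∀ f : K.X p ⟶ L.X r, f ∈ G p r → f ≫ L.d r s = 0 → ∃ g ∈ G p q, g ≫ L.d q r = f)
    (c : Cochain K L j) (hc : δ j m c = 0) (hcG : ∀ p q h, c.v p q h ∈ G p q) :
    ∃ β : Cochain K L i, (∀ p q h, β.v p q h ∈ G p q) ∧
      ∀ p q h, p₀ < p → (c - δ i j β).v p q h = 0 := by
  have hunit : ∀ (n : ℤˣ) p q (f : K.X p ⟶ L.X q), f ∈ G p q → n • f ∈ G p q := by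
    intro n p q f hf
    rcases Int.units_eq_one_or n with rfl | rfl
    · rwa [one_smul]
    · rw [Units.neg_smul, one_smul]; exact neg_mem hf
  have hδ : ∀ (β : Cochain K L i), (∀ p q h, β.v p q h ∈ G p q) →
      ∀ p q h, (δ i j β).v p q h ∈ G p q := by
    intro β hβ p q h
    rw [δ_v i j hij β p q h (q - 1) (p + 1) rfl rfl]
    exact add_mem (hGr _ _ _ _ (hβ _ _ _)) (hunit _ _ _ _ (hGl _ _ _ _ (hβ _ _ _)))
  -- Descending induction on the source degree, starting above `t`, where the source complex
  -- vanishes.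
  have main : ∀ N : ℕ, ∃ β : Cochain K L i, (∀ p q h, β.v p q h ∈ G p q) ∧
      ∀ p q h, p₀ < p → t - N < p → (c - δ i j β).v p q h = 0 := by
    intro N
    induction N with
    | zero =>
      refine ⟨0, fun p q h => zero_mem _, fun p q h _ hp => (hK p ?_).eq_of_src _ _⟩
      simpa using hp
    | succ N ih =>
      obtain ⟨β, hβ, hβ'⟩ := ih
      by_cases hp₁ : p₀ < t - N
      swap
      · exact ⟨β, hβ, fun p q h h₁ h₂ => hβ' p q h h₁ (by push_cast at h₂; omega)⟩
      have hcyc : δ j m (c - δ i j β) = 0 := by rw [δ_sub, hc, δ_δ, sub_zero]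
      have hf := Cochain.congr_v hcyc (t - N) (t - N + m) rfl
      rw [δ_v j m hjm _ _ _ rfl (t - N + j) (t - N + 1) (by omega) rfl,
        hβ' (t - N + 1) _ (by omega) (by omega) (by omega), comp_zero, smul_zero, add_zero] at hf
      obtain ⟨g, hg, hg'⟩ := step (t - N) (t - N + i) (t - N + j) (t - N + m) hp₁ rfl (by omega)
        (by omega) _ (sub_mem (hcG _ _ rfl) (hδ β hβ _ _ rfl)) hf
      -- A cochain supported in degree `t - N` changes `δ β` only in the degrees `t - N` and `t - N
      -- - 1`, so the degrees already settled are untouched.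
      refine ⟨β + Cochain.single g i, fun p q h => ?_, fun p q h h₁ h₂ => ?_⟩
      · rw [Cochain.add_v]
        refine add_mem (hβ p q h) ?_
        by_cases hp : p = t - N
        · subst hp
          obtain rfl : t - N + i = q := h
          rw [Cochain.single_v]; exact hg
        · rw [Cochain.single_v_eq_zero _ _ _ _ _ hp]; exact zero_mem _
      · rw [δ_add, ← sub_sub, Cochain.sub_v, δ_v i j hij _ p q h (q - 1) (p + 1) rfl rfl,
          Cochain.single_v_eq_zero _ _ _ _ _ (show p + 1 ≠ t - N by push_cast at h₂; omega),
          comp_zero, smul_zero, add_zero]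
        by_cases hp : p = t - N
        · subst hp
          obtain rfl : t - N + j = q := h
          obtain rfl : i = j - 1 := by omega
          have e : t - N + j - 1 = t - N + (j - 1) := by ring
          have key : ∀ q' (hq' : q' = t - N + (j - 1)) (hq'' : t - N + (j - 1) = q'),
              (Cochain.single g (j - 1)).v (t - N) q' hq'' ≫ L.d q' (t - N + j) =
                g ≫ L.d _ (t - N + j) := by
            rintro _ rfl _
            rw [Cochain.single_v]
          rw [key _ e, hg']
          exact sub_self _
        · rw [Cochain.single_v_eq_zero _ _ _ _ _ hp, zero_comp, sub_zero]
          exact hβ' p q h h₁ (by push_cast at h₂; omega)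
  obtain ⟨β, hβ, hβ'⟩ := main (t - p₀).toNat
  exact ⟨β, hβ, fun p q h hp => hβ' p q h hp (by omega)⟩

/-- A complex of projectives concentrated in degrees `≤ t` which is, in the degrees `> b`, a
resolution of `T` by projectives. The augmentation is extended by zero to all degrees. -/
structure IsAugmented (Q : CochainComplex C ℤ) (b t : ℤ) {T : C} (η : ∀ q, Q.X q ⟶ T) : Prop where
  isZero_of_gt : ∀ p, t < p → IsZero (Q.X p)
  isZero_of_lt : ∀ p, p < b → IsZero (Q.X p)
  projective : ∀ p, Projective (Q.X p)
  d_η : ∀ p q, Q.d p q ≫ η q = 0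
  η_eq_zero : ∀ q, q ≠ t → η q = 0
  exact : ∀ {K : C} [Projective K] (p q r : ℤ), p + 1 = q → q + 1 = r → b < q →
    ∀ f : K ⟶ Q.X q, f ≫ Q.d q r = 0 → f ≫ η q = 0 → ∃ g : K ⟶ Q.X p, g ≫ Q.d p q = f
  lift : ∀ {K : C} [Projective K] (f : K ⟶ T), ∃ g : K ⟶ Q.X t, g ≫ η t = f

namespace IsAugmented

variable {K Q : CochainComplex C ℤ} {b t t' : ℤ} {T : C} {η : ∀ q, Q.X q ⟶ T}

/-- The comparison theorem for projective resolutions, applied to components killed by the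
augmentation. It stops at target degree `b`, where exactness is not assumed; this is the bound `b -
j` on source degrees. -/
theorem exists_δ_eq (hQ : IsAugmented Q b t η) (hK : ∀ p, Projective (K.X p))
    (hK' : ∀ p, t' < p → IsZero (K.X p)) {i j m : ℤ} (hij : i + 1 = j) (hjm : j + 1 = m)
    (c : Cochain K Q j) (hc : δ j m c = 0) (hcη : ∀ p q h, c.v p q h ≫ η q = 0) :
    ∃ β : Cochain K Q i, (∀ p q h, β.v p q h ≫ η q = 0) ∧
      ∀ p q h, b < q → (c - δ i j β).v p q h = 0 := by
  obtain ⟨β, hβ, hβ'⟩ := exists_δ_eq_of_step hij hjm (p₀ := b - j)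
    (fun p q =>
      { carrier := {f : K.X p ⟶ Q.X q | f ≫ η q = 0}
        add_mem' := fun {f g} (hf : f ≫ η q = 0) (hg : g ≫ η q = 0) => by
          change (f + g) ≫ η q = 0
          rw [Preadditive.add_comp, hf, hg, add_zero]
        zero_mem' := zero_comp
        neg_mem' := fun {f} (hf : f ≫ η q = 0) => by
          change (-f) ≫ η q = 0
          rw [Preadditive.neg_comp, hf, neg_zero] })
    (fun p q r f _ => by change (f ≫ Q.d q r) ≫ η r = 0; rw [Category.assoc, hQ.d_η, comp_zero])
    (fun p q r f (hf : f ≫ η r = 0) => by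
      change (K.d p q ≫ f) ≫ η r = 0; rw [Category.assoc, hf, comp_zero])
    hK' (fun p q r s hp hpq hqr hrs f (hf : f ≫ η r = 0) hf' => by
      have := hK p
      -- For `q = t` the map to be lifted has a zero target. Otherwise `η q = 0`, so every lift is
      -- automatically killed by the augmentation.
      by_cases hq : q = t
      · refine ⟨0, zero_mem _, (hQ.isZero_of_gt r (by omega)).eq_of_tgt _ _⟩
      · obtain ⟨g, hg⟩ := hQ.exact q r s hqr hrs (by omega) f hf' hf
        refine ⟨g, ?_, hg⟩
        change g ≫ η q = 0
        rw [hQ.η_eq_zero q hq, comp_zero])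
    c hc hcη
  exact ⟨β, hβ, fun p q h hq => hβ' p q h (by omega)⟩

/-- Lift the augmentation in top degree and extend by zero. The coboundary of this cochain is killed
by `η`, so it has a primitive, up to the bottom, that is also killed by `η`; subtract it. -/
theorem exists_cocycle (hQ : IsAugmented Q b t η) {bK tK : ℤ} {ηK : ∀ q, K.X q ⟶ T}
    (hK : IsAugmented K bK tK ηK) {r : ℤ} (hb : bK + r = b) (ht : tK + r = t) :
    ∃ φ : Cochain K Q r, δ r (r + 1) φ = 0 ∧ ∀ p q h, φ.v p q h ≫ η q = ηK p := by
  have := hK.projective tK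
  obtain ⟨g, hg⟩ := hQ.lift (ηK tK)
  have hgη : ∀ p q h, (Cochain.single g r).v p q h ≫ η q = ηK p := by
    intro p q h
    by_cases hp : p = tK
    · subst hp
      obtain rfl : t = q := by omega
      rw [Cochain.single_v, hg]
    · rw [Cochain.single_v_eq_zero _ _ _ _ _ hp, zero_comp, hK.η_eq_zero p hp]
  obtain ⟨β, hβ, hβ'⟩ := hQ.exists_δ_eq hK.projective hK.isZero_of_gt rfl rfl
    (δ r (r + 1) (Cochain.single g r)) (δ_δ _ _ _ _) (fun p q h => by
      rw [δ_v r (r + 1) rfl _ p q h (q - 1) (p + 1) rfl rfl, Preadditive.add_comp, Category.assoc,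
        hQ.d_η, comp_zero, zero_add, Linear.units_smul_comp, Category.assoc, hgη, hK.d_η, smul_zero])
  refine ⟨Cochain.single g r - β, ?_, fun p q h => ?_⟩
  · rw [δ_sub]
    ext p q h
    -- From a source degree at least `bK`, a cochain of degree `r + 1` lands strictly above `b`,
    -- where the primitive is valid.
    by_cases hp : p < bK
    · exact (hK.isZero_of_lt p hp).eq_of_src _ _
    · exact hβ' p q h (by omega)
  · rw [Cochain.sub_v, Preadditive.sub_comp, hgη, hβ, sub_zero]

end IsAugmented

/-- A complex of projectives concentrated in degrees `b, …, t` with cohomology `T` in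
degrees `b` and `t`. -/
structure IsSpherical (P : CochainComplex C ℤ) (b t : ℤ) {T : C} (η : ∀ q, P.X q ⟶ T)
    (ι : T ⟶ P.X b) : Prop extends IsAugmented P b t η where
  le : b ≤ t
  mono_of_eq : b = t → ∀ {K : C} (f : K ⟶ P.X b), f ≫ η b = 0 → f = 0
  ι_d : b < t → ι ≫ P.d b (b + 1) = 0
  ι_mono : b < t → ∀ {K : C} (f : K ⟶ T), f ≫ ι = 0 → f = 0
  exists_ι : b < t → ∀ {K : C} (f : K ⟶ P.X b), f ≫ P.d b (b + 1) = 0 → ∃ g : K ⟶ T, g ≫ ι = f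

end AInf

namespace AInf

open CategoryTheory CochainComplex CochainComplex.HomComplex Limits

universe v u

variable {C : Type u} [Category.{v} C] [Preadditive C]

/-! ### Homotopy equivalence of spherical complexes. -/

namespace IsSpherical

variable {P P' : CochainComplex C ℤ} {b b' t t' : ℤ} {T : C} {η : ∀ q, P.X q ⟶ T}
  {η' : ∀ q, P'.X q ⟶ T} {ι : T ⟶ P.X b} {ι' : T ⟶ P'.X b'}

/-- A cocycle which vanishes on the top cohomology comes from the bottom cohomology. -/
theorem exists_eq_add_single (hP : IsSpherical P b t η ι) (hP' : IsSpherical P' b' t' η' ι')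
    {r s : ℤ} (hs : s + 1 = r) (hb : b + r = b') (ht : t + r = t') (h : b < t) (c : Cochain P P' r)
    (hc : δ r (r + 1) c = 0) (hcη : ∀ p q h, c.v p q h ≫ η' q = 0) :
    ∃ (β : Cochain P P' s) (u : P.X b ⟶ T), c = δ s r β + Cochain.single (u ≫ ι') r := by
  obtain ⟨β, -, hβ⟩ := hP'.exists_δ_eq hP.projective hP.isZero_of_gt hs rfl c hc hcη
  have hcyc : δ r (r + 1) (c - δ s r β) = 0 := by rw [δ_sub, hc, δ_δ, sub_zero]
  have hf := Cochain.congr_v hcyc b (b' + 1) (by omega)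
  rw [δ_v r (r + 1) rfl _ b (b' + 1) (by omega) b' (b + 1) (by omega) rfl,
    hβ (b + 1) (b' + 1) (by omega) (by omega), comp_zero, smul_zero, add_zero] at hf
  obtain ⟨u, hu⟩ := hP'.exists_ι (by omega) _ hf
  refine ⟨β, u, sub_eq_iff_eq_add'.1 ?_⟩
  ext p q hpq
  rcases lt_trichotomy p b with hp | rfl | hp
  · exact (hP.isZero_of_lt p hp).eq_of_src _ _
  · obtain rfl : q = b' := by omega
    rw [Cochain.single_v, hu]
  · rw [Cochain.single_v_eq_zero _ _ _ _ _ hp.ne', hβ p q hpq (by omega)]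

/-- A cocycle carries bottom cycles to bottom cycles, which are identified with `T` by `ι` and `ι'`.
-/
theorem exists_bottom (hP : IsSpherical P b t η ι) (hP' : IsSpherical P' b' t' η' ι') {r : ℤ}
    (hb : b + r = b') (ht : t + r = t') (h : b < t) (φ : Cochain P P' r)
    (hφ : δ r (r + 1) φ = 0) : ∃ a : T ⟶ T, ι ≫ φ.v b b' hb = a ≫ ι' := by
  have hf := Cochain.congr_v hφ b (b' + 1) (by omega)
  rw [δ_v r (r + 1) rfl _ b (b' + 1) (by omega) b' (b + 1) (by omega) rfl, Cochain.zero_v] at hf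
  obtain ⟨a, ha⟩ := hP'.exists_ι (by omega) (ι ≫ φ.v b b' hb) (by
    rw [Category.assoc, eq_neg_of_add_eq_zero_left hf, Preadditive.comp_neg,
      Linear.comp_units_smul, ← Category.assoc, hP.ι_d h, zero_comp, smul_zero, neg_zero])
  exact ⟨a, ha.symm⟩

/-- Homotopies are invisible on bottom cohomology: there is no term below `b`, and `ι` is killed by
the differential. -/
theorem ι_δ_v (hP : IsSpherical P b t η ι) (h : b < t) (β : Cochain P P (-1)) :
    ι ≫ (δ (-1) 0 β).v b b (add_zero b) = 0 := by
  rw [δ_v (-1) 0 rfl _ b b (add_zero b) (b - 1) (b + 1) (by omega) rfl,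
    (hP.isZero_of_lt (b - 1) (by omega)).eq_of_tgt (β.v b (b - 1) _) 0, zero_comp, zero_add,
    Linear.comp_units_smul, ← Category.assoc, hP.ι_d h, zero_comp, smul_zero]

/-- The composition of two comparison maps is homotopic to the identity up to a map which comes
from the bottom cohomology. -/
theorem exists_comp_eq (hP : IsSpherical P b t η ι)
    {r s : ℤ} (hrs : r + s = 0) (hb : b + r = b') (h : b < t)
    {φ : Cochain P P' r} {ψ : Cochain P' P s} (hφ : δ r (r + 1) φ = 0) (hψ : δ s (s + 1) ψ = 0)
    (hφη : ∀ p q h, φ.v p q h ≫ η' q = η p) (hψη : ∀ p q h, ψ.v p q h ≫ η q = η' p) {a a' : T ⟶ T}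
    (ha : ι ≫ φ.v b b' hb = a ≫ ι') (ha' : ι' ≫ ψ.v b' b (by omega) = a' ≫ ι) :
    ∃ (β : Cochain P P (-1)) (u : P.X b ⟶ T), a ≫ a' = 𝟙 T + ι ≫ u ∧
      φ.comp ψ hrs = Cochain.ofHom (𝟙 P) + δ (-1) 0 β + Cochain.single (u ≫ ι) 0 := by
  obtain ⟨β, u, hu⟩ := hP.exists_eq_add_single hP (r := 0) (s := -1) rfl (by omega) (by omega) h
    (φ.comp ψ hrs - Cochain.ofHom (𝟙 P))
    (by
      rw [δ_sub, δ_comp φ ψ hrs (r + 1) (s + 1) (0 + 1) rfl rfl rfl, hφ, hψ, Cochain.comp_zero,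
        Cochain.zero_comp, smul_zero, add_zero, zero_sub, zero_add, δ_ofHom, neg_zero])
    (fun p q hpq => by
      obtain rfl : p = q := by omega
      rw [Cochain.sub_v, Cochain.comp_v _ _ hrs p (p + r) p rfl (by omega), Cochain.ofHom_v,
        Preadditive.sub_comp, Category.assoc, hψη, hφη, HomologicalComplex.id_f, Category.id_comp,
        sub_self])
  refine ⟨β, u, ?_, by rw [add_assoc, ← hu, add_sub_cancel]⟩
  -- Restrict the identity of cochains along `ι` to the bottom cohomology; the homotopy term
  -- disappears and `ι` is cancellable.
  have e := congr_arg (fun f => ι ≫ f) (Cochain.congr_v hu b b (add_zero b))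
  simp only [Cochain.sub_v, Cochain.add_v, Cochain.comp_v _ _ hrs b b' b hb (by omega),
    Cochain.ofHom_v, Preadditive.comp_sub, Preadditive.comp_add, hP.ι_δ_v h, Cochain.single_v,
    zero_add, HomologicalComplex.id_f, Category.comp_id] at e
  rw [← Category.assoc, ha, Category.assoc, ha'] at e
  rw [← sub_eq_iff_eq_add', ← sub_eq_zero]
  refine hP.ι_mono h _ ?_
  rw [Preadditive.sub_comp, Preadditive.sub_comp, Category.assoc, Category.id_comp, e,
    Category.assoc, sub_self]

/-- There is a comparison map which is an isomorphism on bottom cohomology. -/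
theorem exists_isIso_bottom (hT : ∀ f : T ⟶ T, f = 0 ∨ IsIso f) (hP : IsSpherical P b t η ι)
    (hP' : IsSpherical P' b' t' η' ι') {r : ℤ} (hb : b + r = b') (ht : t + r = t') (h : b < t) :
    ∃ (φ : Cochain P P' r) (a : T ⟶ T), δ r (r + 1) φ = 0 ∧ (∀ p q h, φ.v p q h ≫ η' q = η p) ∧
      IsIso a ∧ ι ≫ φ.v b b' hb = a ≫ ι' := by
  obtain ⟨φ, hφ, hφη⟩ := hP'.exists_cocycle hP.toIsAugmented hb ht
  obtain ⟨ψ, hψ, hψη⟩ := hP.exists_cocycle hP'.toIsAugmented (r := -r) (by omega) (by omega)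
  obtain ⟨a, ha⟩ := hP.exists_bottom hP' hb ht h φ hφ
  obtain ⟨a', ha'⟩ := hP'.exists_bottom hP (by omega) (by omega) (by omega) ψ hψ
  obtain ⟨β, u, hu, -⟩ := hP.exists_comp_eq (by omega) hb h hφ hψ hφη hψη ha ha'
  rcases hT a with rfl | hai
  · refine ⟨φ - Cochain.single (u ≫ ι') r, 𝟙 T, ?_, fun p q hpq => ?_, inferInstance, ?_⟩
    · rw [δ_sub, hφ, Cochain.δ_single _ r (r + 1) rfl (b - 1) (b' + 1) (by omega) rfl,
        Category.assoc, hP'.ι_d (by omega), comp_zero,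
        (hP.isZero_of_lt (b - 1) (by omega)).eq_of_src (P.d (b - 1) b ≫ u ≫ ι') 0]
      simp
    · rw [Cochain.sub_v, Preadditive.sub_comp, hφη]
      by_cases hp : p = b
      · subst hp
        obtain rfl : q = b' := by omega
        rw [Cochain.single_v, hP'.η_eq_zero q (by omega), comp_zero, sub_zero]
      · rw [Cochain.single_v_eq_zero _ _ _ _ _ hp, zero_comp, sub_zero]
    · rw [zero_comp] at hu
      rw [Cochain.sub_v, Cochain.single_v, Preadditive.comp_sub, ha, zero_comp, zero_sub,
        ← Category.assoc, ← Preadditive.neg_comp, neg_eq_of_add_eq_zero_left hu.symm]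
  · exact ⟨φ, a, hφ, hφη, hai, ha⟩

/-- A comparison map which is an isomorphism on bottom cohomology has a right inverse with the same
property. -/
theorem exists_rightInverse (hT : ∀ f : T ⟶ T, f = 0 ∨ IsIso f) (hP : IsSpherical P b t η ι)
    (hP' : IsSpherical P' b' t' η' ι') {r s : ℤ} (hrs : r + s = 0) (hb : b + r = b')
    (ht : t + r = t') (h : b < t) {φ : Cochain P P' r} (hφ : δ r (r + 1) φ = 0)
    (hφη : ∀ p q h, φ.v p q h ≫ η' q = η p) {a : T ⟶ T} [IsIso a]
    (ha : ι ≫ φ.v b b' hb = a ≫ ι') :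
    ∃ (ψ : Cochain P' P s) (a' : T ⟶ T) (β : Cochain P P (-1)), δ s (s + 1) ψ = 0 ∧
      (∀ p q h, ψ.v p q h ≫ η q = η' p) ∧ IsIso a' ∧ ι' ≫ ψ.v b' b (by omega) = a' ≫ ι ∧
      φ.comp ψ hrs = Cochain.ofHom (𝟙 P) + δ (-1) 0 β := by
  obtain ⟨ψ, a', hψ, hψη, _, ha'⟩ := hP'.exists_isIso_bottom hT hP (r := s) (by omega) (by omega)
    (by omega)
  obtain ⟨β, u, hu, hβ⟩ := hP.exists_comp_eq hrs hb h hφ hψ hφη hψη ha ha'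
  have hu' : ι ≫ u = a ≫ a' - 𝟙 T := by rw [hu, add_sub_cancel_left]
  -- The error `u ι` in `φ ψ = 1 + δ β + u ι` is removed by subtracting `w ι` from `ψ`. Indeed `φ w
  -- = (1 + d β + u ι) u c`, and `ι u = a a' - 1` with `c` inverse to `a a'` turns this into `u + d
  -- β u c`. The remaining term is a coboundary.
  let c : T ⟶ T := inv (a ≫ a')
  let w : P'.X b' ⟶ T := ψ.v b' b (by omega) ≫ u ≫ c
  have hw : φ.v b b' hb ≫ w = u + P.d b (b + 1) ≫ β.v (b + 1) b (by omega) ≫ u ≫ c := by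
    have e := Cochain.congr_v hβ b b (add_zero b)
    rw [Cochain.comp_v _ _ hrs b b' b hb (by omega), Cochain.add_v, Cochain.add_v, Cochain.ofHom_v,
      Cochain.single_v, δ_v (-1) 0 rfl _ b b (add_zero b) (b - 1) (b + 1) (by omega) rfl,
      (hP.isZero_of_lt (b - 1) (by omega)).eq_of_tgt (β.v b (b - 1) _) 0, zero_comp, zero_add,
      Int.negOnePow_zero, one_smul, HomologicalComplex.id_f] at e
    rw [← Category.assoc, e]
    simp only [Preadditive.add_comp, Category.id_comp, Category.assoc]
    rw [← Category.assoc ι u c, hu', Preadditive.sub_comp, IsIso.hom_inv_id, Category.id_comp,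
      Preadditive.comp_sub, Category.comp_id]
    abel
  have hβ' : φ.comp (ψ - Cochain.single (w ≫ ι) s) hrs = Cochain.ofHom (𝟙 P) +
      δ (-1) 0 (β - Cochain.single (β.v (b + 1) b (by omega) ≫ u ≫ c ≫ ι) (-1)) := by
    have e : φ.comp (Cochain.single (w ≫ ι) s) hrs = Cochain.single (φ.v b b' hb ≫ w ≫ ι) 0 := by
      ext p
      rw [Cochain.comp_v _ _ hrs p (p + r) p rfl (by omega)]
      by_cases hp : p = b
      · subst hp
        subst hb
        rw [Cochain.single_v, Cochain.single_v]
      · rw [Cochain.single_v_eq_zero _ _ _ _ _ hp, Cochain.single_v_eq_zero _ _ _ _ _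
          (show p + r ≠ b' by omega), comp_zero]
    rw [Cochain.comp_sub, hβ, e, δ_sub, Cochain.δ_single _ (-1) 0 rfl b (b + 1) rfl rfl,
      ← Category.assoc (φ.v b b' hb), hw]
    simp only [Category.assoc, hP.ι_d h, comp_zero, Cochain.single_zero, zero_add,
      Int.negOnePow_zero, one_smul, Preadditive.add_comp]
    rw [show Cochain.single (u ≫ ι + P.d b (b + 1) ≫ β.v (b + 1) b (by omega) ≫ u ≫ c ≫ ι) 0 =
      Cochain.single (u ≫ ι) 0 +
        Cochain.single (P.d b (b + 1) ≫ β.v (b + 1) b (by omega) ≫ u ≫ c ≫ ι) 0 from ?_]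
    · abel
    · ext p
      by_cases hp : p = b
      · subst hp
        simp
      · simp only [Cochain.add_v, Cochain.single_v_eq_zero _ _ _ _ _ hp, add_zero]
  have hψ' : δ s (s + 1) (ψ - Cochain.single (w ≫ ι) s) = 0 := by
    rw [δ_sub, hψ, Cochain.δ_single _ s (s + 1) rfl (b' - 1) (b + 1) (by omega) rfl,
      Category.assoc, hP.ι_d h, comp_zero,
      (hP'.isZero_of_lt (b' - 1) (by omega)).eq_of_src (P'.d (b' - 1) b' ≫ w ≫ ι) 0]
    simp
  obtain ⟨a'', ha''⟩ := hP'.exists_bottom hP (by omega) (by omega) (by omega) _ hψ'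
  refine ⟨ψ - Cochain.single (w ≫ ι) s, a'', _, hψ', fun p q hpq => ?_, ?_, ha'', hβ'⟩
  · rw [Cochain.sub_v, Preadditive.sub_comp, hψη]
    by_cases hp : p = b'
    · subst hp
      obtain rfl : q = b := by omega
      rw [Cochain.single_v, hP.η_eq_zero q (by omega), comp_zero, sub_zero]
    · rw [Cochain.single_v_eq_zero _ _ _ _ _ hp, zero_comp, sub_zero]
  · have e := congr_arg (fun f => ι ≫ f) (Cochain.congr_v hβ' b b (add_zero b))
    simp only [Cochain.add_v, Cochain.comp_v _ _ hrs b b' b hb (by omega),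
      Cochain.ofHom_v, Preadditive.comp_add, hP.ι_δ_v h,
      add_zero, HomologicalComplex.id_f, Category.comp_id] at e
    rw [← Category.assoc, ha, Category.assoc, ha''] at e
    have : a ≫ a'' = 𝟙 T := by
      rw [← sub_eq_zero]
      refine hP.ι_mono h _ ?_
      rw [Preadditive.sub_comp, Category.assoc, e, Category.id_comp, sub_self]
    rw [(IsIso.eq_inv_of_hom_inv_id this : a'' = inv a)]
    infer_instance

/-- Two spherical complexes with the same cohomology are homotopy equivalent, up to a shift. -/
theorem exists_equiv (hT : ∀ f : T ⟶ T, f = 0 ∨ IsIso f) (hP : IsSpherical P b t η ι)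
    (hP' : IsSpherical P' b' t' η' ι') {r s : ℤ} (hrs : r + s = 0) (hsr : s + r = 0)
    (hb : b + r = b') (ht : t + r = t') :
    ∃ (φ : Cochain P P' r) (ψ : Cochain P' P s) (x : Cochain P P (-1)) (y : Cochain P' P' (-1)),
      δ r (r + 1) φ = 0 ∧ δ s (s + 1) ψ = 0 ∧ φ.comp ψ hrs = Cochain.ofHom (𝟙 P) + δ (-1) 0 x ∧
      ψ.comp φ hsr = Cochain.ofHom (𝟙 P') + δ (-1) 0 y := by
  have hle := hP.le
  rcases hle.eq_or_lt with h | h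
  -- When `b = t` there is a single term and maps into it are detected by the augmentation, so the
  -- comparison maps are mutually inverse with no homotopy.
  · obtain ⟨φ, hφ, hφη⟩ := hP'.exists_cocycle hP.toIsAugmented hb ht
    obtain ⟨ψ, hψ, hψη⟩ := hP.exists_cocycle hP'.toIsAugmented (r := s) (by omega) (by omega)
    refine ⟨φ, ψ, 0, 0, hφ, hψ, ?_, ?_⟩
    · rw [δ_zero, add_zero]
      ext p
      rcases lt_trichotomy p b with hp | rfl | hp
      · exact (hP.isZero_of_lt p hp).eq_of_src _ _
      · rw [← sub_eq_zero]
        refine hP.mono_of_eq h _ ?_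
        rw [Cochain.comp_v _ _ hrs p (p + r) p rfl (by omega), Cochain.ofHom_v,
          Preadditive.sub_comp, Category.assoc, hψη, hφη, HomologicalComplex.id_f,
          Category.id_comp, sub_self]
      · exact (hP.isZero_of_gt p (by omega)).eq_of_src _ _
    · rw [δ_zero, add_zero]
      ext p
      rcases lt_trichotomy p b' with hp | rfl | hp
      · exact (hP'.isZero_of_lt p hp).eq_of_src _ _
      · rw [← sub_eq_zero]
        refine hP'.mono_of_eq (by omega) _ ?_
        rw [Cochain.comp_v _ _ hsr p (p + s) p rfl (by omega), Cochain.ofHom_v,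
          Preadditive.sub_comp, Category.assoc, hφη, hψη, HomologicalComplex.id_f,
          Category.id_comp, sub_self]
      · exact (hP'.isZero_of_gt p (by omega)).eq_of_src _ _
  · obtain ⟨φ, a, hφ, hφη, _, ha⟩ := hP.exists_isIso_bottom hT hP' hb ht h
    obtain ⟨ψ, a', x, hψ, hψη, _, ha', hx⟩ := hP.exists_rightInverse hT hP' hrs hb ht h hφ hφη ha
    obtain ⟨χ, a'', y, hχ, -, -, -, hy⟩ :=
      hP'.exists_rightInverse hT hP hsr (by omega) (by omega) (by omega) hψ hψη ha'
    refine ⟨φ, ψ, x, y + r.negOnePow • ψ.comp (x.comp χ (neg_add_eq_sub 1 r)) (by omega) -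
      (ψ.comp φ hsr).comp y (zero_add (-1)), hφ, hψ, hx, ?_⟩
    have hψφ : δ 0 (0 + 1) (ψ.comp φ hsr) = 0 := by
      rw [δ_comp ψ φ hsr (s + 1) (r + 1) (0 + 1) rfl rfl rfl, hφ, hψ, Cochain.comp_zero,
        Cochain.zero_comp, smul_zero, add_zero]
    -- The right inverse `ψ` of `φ` itself has a right inverse `χ`. Comparing `(ψ φ)(ψ χ)` with `ψ
    -- (φ ψ) χ` shows that `ψ φ` is homotopic to `ψ χ`, hence to the identity.
    have e₁ : (ψ.comp φ hsr).comp (ψ.comp χ hsr) (add_zero 0) =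
        ψ.comp ((φ.comp ψ hrs).comp χ (zero_add r)) hsr := by
      rw [Cochain.comp_assoc ψ φ _ hsr (show r + 0 = r by omega) (by omega),
        Cochain.comp_assoc φ ψ χ hrs hsr (by omega)]
    rw [hx, hy, Cochain.comp_add, Cochain.add_comp, Cochain.comp_add, Cochain.comp_id,
      Cochain.id_comp, hy] at e₁
    refine (eq_sub_of_add_eq e₁).trans ?_
    rw [δ_sub, δ_add, δ_units_smul,
      δ_comp_of_δ_eq_zero hψφ y (zero_add (-1)) (show -1 + 1 = (0 : ℤ) by rfl)
        (show -1 + 1 = (0 : ℤ) by rfl),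
      δ_comp_of_δ_eq_zero hψ _ _ (show r - 1 + 1 = r by omega) (show -1 + 1 = (0 : ℤ) by rfl),
      δ_comp_of_δ_eq_zero_right x hχ (neg_add_eq_sub 1 r) (show -1 + 1 = (0 : ℤ) by rfl) (by omega),
      Cochain.comp_units_smul, smul_smul, Int.units_mul_self, one_smul]
    abel

end IsSpherical

end AInf

namespace AInf

open CategoryTheory CochainComplex CochainComplex.HomComplex Limits

universe v v' v'' u u' u''

/-! ### Cancelling homotopy equivalences on cohomology. -/

section Coboundaries

variable {C : Type u} [Category.{v} C] [Preadditive C]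

theorem exists_δ_eq_comp_left {K L M : CochainComplex C ℤ} {n i j m : ℤ} {z : Cochain K L n}
    (hz : δ n (n + 1) z = 0) (y : Cochain L M i) (hij : i + 1 = j) (h : n + j = m) {l : ℤ}
    (hl : l + 1 = m) : ∃ x, δ l m x = z.comp (δ i j y) h :=
  ⟨z.comp y (by omega), δ_comp_of_δ_eq_zero hz y _ hij hl⟩

theorem exists_δ_eq_comp_right {K L M : CochainComplex C ℤ} {n i j m : ℤ} {z : Cochain L M n}
    (hz : δ n (n + 1) z = 0) (y : Cochain K L i) (hij : i + 1 = j) (h : j + n = m) {l : ℤ}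
    (hl : l + 1 = m) : ∃ x, δ l m x = (δ i j y).comp z h :=
  ⟨n.negOnePow • y.comp z (show i + n = l by omega), by
    rw [δ_units_smul, δ_comp_of_δ_eq_zero_right y hz _ hij hl, smul_smul, Int.units_mul_self,
      one_smul]⟩

variable {K L : CochainComplex C ℤ} {r s : ℤ} {φ : Cochain K L r} {ψ : Cochain L K s}

theorem δ_comp_eq_zero {M : CochainComplex C ℤ} {n₁ n₂ n m : ℤ} {x : Cochain K L n₁}
    {y : Cochain L M n₂} (hx : δ n₁ (n₁ + 1) x = 0) (hy : δ n₂ (n₂ + 1) y = 0) (h : n₁ + n₂ = n)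
    (hm : n + 1 = m) : δ n m (x.comp y h) = 0 := by
  rw [δ_comp_of_δ_eq_zero hx y h rfl hm, hy, Cochain.comp_zero]

/-- If `z φ` is a coboundary and `φ` has a right inverse up to homotopy then `z` is a
coboundary. -/
theorem exists_δ_eq_of_comp (hψ : δ s (s + 1) ψ = 0) (hrs : r + s = 0) {x : Cochain K K (-1)}
    (hx : φ.comp ψ hrs = Cochain.ofHom (𝟙 K) + δ (-1) 0 x) {M : CochainComplex C ℤ} {h i j : ℤ}
    (z : Cochain M K i) (hz : δ i (i + 1) z = 0) (hij : i + r = j) (hi : h + 1 = i)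
    {w : Cochain M L (j - 1)} (hw : δ (j - 1) j w = z.comp φ hij) : ∃ y, δ h i y = z := by
  obtain ⟨y₁, hy₁⟩ := exists_δ_eq_comp_right hψ w (sub_add_cancel j 1) (show j + s = i by omega) hi
  obtain ⟨y₂, hy₂⟩ := exists_δ_eq_comp_left hz x (show -1 + 1 = (0 : ℤ) by rfl) (add_zero i) hi
  refine ⟨y₁ - y₂, ?_⟩
  rw [δ_sub, hy₁, hy₂, hw, Cochain.comp_assoc z φ ψ hij hrs (by omega), hx, Cochain.comp_add,
    Cochain.comp_id, add_sub_cancel_right]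

theorem exists_δ_eq_of_comp' (hψ : δ s (s + 1) ψ = 0) (hsr : s + r = 0) {x : Cochain L L (-1)}
    (hx : ψ.comp φ hsr = Cochain.ofHom (𝟙 L) + δ (-1) 0 x) {M : CochainComplex C ℤ} {h i j : ℤ}
    (z : Cochain L M i) (hz : δ i (i + 1) z = 0) (hij : r + i = j) (hi : h + 1 = i)
    {w : Cochain K M (j - 1)} (hw : δ (j - 1) j w = φ.comp z hij) : ∃ y, δ h i y = z := by
  obtain ⟨y₁, hy₁⟩ := exists_δ_eq_comp_left hψ w (sub_add_cancel j 1) (show s + j = i by omega) hi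
  obtain ⟨y₂, hy₂⟩ := exists_δ_eq_comp_right hz x (show -1 + 1 = (0 : ℤ) by rfl) (zero_add i) hi
  refine ⟨y₁ - y₂, ?_⟩
  rw [δ_sub, hy₁, hy₂, hw, ← Cochain.comp_assoc ψ φ z hsr hij (by omega), hx, Cochain.add_comp,
    Cochain.id_comp, add_sub_cancel_right]

end Coboundaries

/-! ### Resolutions whose image is spherical. -/

variable {C : Type u} [Category.{v} C] {C' : Type u'} [Category.{v'} C']
  {E : Type u''} [Category.{v''} E] [Preadditive C] [Preadditive C'] [Preadditive E]

theorem IsSpherical.ofIso {P : CochainComplex E ℤ} {b t : ℤ} {T T' : E} {η : ∀ q, P.X q ⟶ T}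
    {ι : T ⟶ P.X b} (hP : IsSpherical P b t η ι) (e : T ≅ T') :
    IsSpherical P b t (fun q => η q ≫ e.hom) (e.inv ≫ ι) where
  isZero_of_gt := hP.isZero_of_gt
  isZero_of_lt := hP.isZero_of_lt
  projective := hP.projective
  d_η p q := by rw [← Category.assoc, hP.d_η, zero_comp]
  η_eq_zero q hq := by rw [hP.η_eq_zero q hq, zero_comp]
  exact p q r hpq hqr hq f hf hf' := hP.exact p q r hpq hqr hq f hf (by
    rwa [← Category.assoc, Preadditive.IsIso.comp_right_eq_zero] at hf')
  lift f := by
    obtain ⟨g, hg⟩ := hP.lift (f ≫ e.inv)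
    exact ⟨g, by rw [← Category.assoc, hg, Category.assoc, e.inv_hom_id, Category.comp_id]⟩
  le := hP.le
  mono_of_eq hb _ f hf := hP.mono_of_eq hb f (by
    rwa [← Category.assoc, Preadditive.IsIso.comp_right_eq_zero] at hf)
  ι_d hb := by rw [Category.assoc, hP.ι_d hb, comp_zero]
  ι_mono hb _ f hf := by
    rw [← Category.assoc] at hf
    have := hP.ι_mono hb _ hf
    rwa [Preadditive.IsIso.comp_right_eq_zero] at this
  exists_ι hb _ f hf := by
    obtain ⟨g, hg⟩ := hP.exists_ι hb f hf
    exact ⟨g ≫ e.hom, by rw [Category.assoc, e.hom_inv_id_assoc, hg]⟩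

/-- A projective resolution of `S` whose image under the functor `Φ` is spherical, where `Φ` is full
on projectives and faithful on morphisms to `S`. -/
structure IsSphericalResolution (Φ : C ⥤ E) [Φ.Additive] (Q : CochainComplex C ℤ) (b₀ b t : ℤ)
    {S : C} (η : ∀ q, Q.X q ⟶ S) (ι : Φ.obj S ⟶ Φ.obj (Q.X b)) : Prop
    extends IsAugmented Q b₀ t η where
  -- `b₀` is one below the lowest possible nonzero term, so exactness above `b₀` includes the bottom
  -- of `Q`, whereas its image is only required to be exact above `b`.
  succ : b₀ + 1 = b
  isZero : IsZero (Q.X b₀)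
  spherical : IsSpherical (P := (Φ.mapHomologicalComplex _).obj Q) b t
    (fun q => Φ.map (η q)) ι
  faithful : ∀ {X : C} (f : X ⟶ S), Φ.map f = 0 → f = 0
  full : ∀ {X Y : C} [Projective X] (g : Φ.obj X ⟶ Φ.obj Y), ∃ f, Φ.map f = g

namespace IsSphericalResolution

variable {Φ : C ⥤ E} [Φ.Additive] {Q : CochainComplex C ℤ} {b₀ b t : ℤ} {S : C}
  {η : ∀ q, Q.X q ⟶ S} {ι : Φ.obj S ⟶ Φ.obj (Q.X b)}

/-- Since `Q` is exact down to its bottom term, the comparison argument never stops: the cohomology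
of `End Q` embeds into that of `Hom(Q, S)`. -/
theorem exists_δ_eq_of_η (hQ : IsSphericalResolution Φ Q b₀ b t η ι) {i j m : ℤ} (hij : i + 1 = j)
    (hjm : j + 1 = m) (c : Cochain Q Q j) (hc : δ j m c = 0)
    (hcη : ∀ p q h, c.v p q h ≫ η q = 0) : ∃ β, δ i j β = c := by
  obtain ⟨β, -, hβ⟩ := hQ.exists_δ_eq hQ.projective hQ.isZero_of_gt hij hjm c hc hcη
  refine ⟨β, (sub_eq_zero.1 ?_).symm⟩
  ext p q hpq
  rcases lt_trichotomy q b₀ with hq | rfl | hq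
  · exact (hQ.isZero_of_lt q hq).eq_of_tgt _ _
  · exact hQ.isZero.eq_of_tgt _ _
  · exact hβ p q hpq hq

/-- A cocycle of the endomorphism algebra is a coboundary if its image is one. -/
theorem exists_δ_eq_of_map (hQ : IsSphericalResolution Φ Q b₀ b t η ι) {i j m : ℤ}
    (hij : i + 1 = j) (hjm : j + 1 = m) (c : Cochain Q Q j) (hc : δ j m c = 0)
    {x} (hx : δ i j x = c.map Φ) : ∃ β, δ i j β = c := by
  obtain ⟨p₁, hp₁⟩ : ∃ p₁, p₁ + i = t := ⟨t - i, by ring⟩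
  have := hQ.projective p₁
  -- Only the component of the primitive ending in top degree matters. Followed by the augmentation
  -- it descends along `Φ` to a map to `S`, which lifts through `η`; subtracting the resulting
  -- coboundary leaves a cocycle whose composite with `η` vanishes by faithfulness.
  let x₂ : Φ.obj (Q.X p₁) ⟶ Φ.obj (Q.X t) := x.v p₁ t hp₁
  obtain ⟨y, hy⟩ := hQ.full (x₂ ≫ Φ.map (η t))
  obtain ⟨g, hg⟩ := hQ.lift y
  obtain ⟨β, hβ⟩ := hQ.exists_δ_eq_of_η hij hjm (c - δ i j (Cochain.single g i))
    (by rw [δ_sub, hc, δ_δ, sub_zero]) (fun p q hpq => by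
      by_cases hq : q = t
      swap
      · rw [hQ.η_eq_zero q hq, comp_zero]
      subst hq
      obtain rfl : p₁ = p + 1 := by omega
      let x₁ : Φ.obj (Q.X p) ⟶ Φ.obj (Q.X (q - 1)) := x.v p (q - 1) (by omega)
      have e : Φ.map (c.v p q hpq) = x₁ ≫ Φ.map (Q.d (q - 1) q) +
          j.negOnePow • Φ.map (Q.d p (p + 1)) ≫ x₂ :=
        (Cochain.congr_v hx p q hpq).symm.trans (δ_v i j hij x p q hpq (q - 1) (p + 1) rfl rfl)
      refine hQ.faithful _ ?_
      rw [Cochain.sub_v, δ_v i j hij _ p q hpq (q - 1) (p + 1) rfl rfl, Cochain.single_v,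
        Cochain.single_v_eq_zero _ _ _ _ _ (by omega), zero_comp, zero_add, Φ.map_comp, Φ.map_sub,
        Functor.map_units_smul, e, Φ.map_comp, Preadditive.sub_comp, Preadditive.add_comp,
        Linear.units_smul_comp, Linear.units_smul_comp, Category.assoc, Category.assoc,
        Category.assoc, ← Φ.map_comp g, hg, hy, add_sub_cancel_right, ← Φ.map_comp, hQ.d_η,
        Φ.map_zero, comp_zero])
  exact ⟨β + Cochain.single g i, by rw [δ_add, hβ, sub_add_cancel]⟩

/-- Cocycles of positive degree lift along `Φ`. -/
theorem exists_map_eq (hQ : IsSphericalResolution Φ Q b₀ b t η ι) {j m : ℤ} (hj : 1 ≤ j)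
    (hjm : j + 1 = m) (x : Cochain ((Φ.mapHomologicalComplex _).obj Q)
      ((Φ.mapHomologicalComplex _).obj Q) j) (hx : δ j m x = 0) :
    ∃ a : Cochain Q Q j, δ j m a = 0 ∧ a.map Φ = x := by
  have hfull : ∀ p q (h : p + j = q), ∃ f : Q.X p ⟶ Q.X q, Φ.map f = x.v p q h := fun p q h =>
    have := hQ.projective p
    hQ.full _
  choose f hf using hfull
  -- Lift componentwise by fullness. The coboundary of the lift is killed by `Φ`, and it remains to
  -- find a primitive that is also killed by `Φ`.
  let c : Cochain Q Q j := Cochain.mk f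
  have hc : c.map Φ = x := by ext p q h; exact hf p q h
  obtain ⟨β, hβ, hβ'⟩ := exists_δ_eq_of_step (K := Q) (L := Q) hjm rfl (p₀ := b₀ - 1)
    (fun p q =>
      { carrier := {f : Q.X p ⟶ Q.X q | Φ.map f = 0}
        add_mem' := fun {f g} (hf : Φ.map f = 0) (hg : Φ.map g = 0) => by
          change Φ.map (f + g) = 0
          rw [Φ.map_add, hf, hg, add_zero]
        zero_mem' := Φ.map_zero _ _
        neg_mem' := fun {f} (hf : Φ.map f = 0) => by
          change Φ.map (-f) = 0
          rw [Φ.map_neg, hf, neg_zero] })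
    (fun p q r f (hf : Φ.map f = 0) => by
      change Φ.map (f ≫ Q.d q r) = 0; rw [Φ.map_comp, hf, zero_comp])
    (fun p q r f (hf : Φ.map f = 0) => by
      change Φ.map (Q.d p q ≫ f) = 0; rw [Φ.map_comp, hf, comp_zero])
    hQ.isZero_of_gt (fun p q r s hp hpq hqr hrs f (hf : Φ.map f = 0) hf' => by
      have := hQ.projective p
      have hs := hQ.succ
      by_cases hr : r ≤ b₀
      · refine ⟨0, zero_mem _, ?_⟩
        rcases hr.eq_or_lt with rfl | hr
        · exact hQ.isZero.eq_of_tgt _ _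
        · exact (hQ.isZero_of_lt r hr).eq_of_tgt _ _
      by_cases hr' : t < r
      · exact ⟨0, zero_mem _, (hQ.isZero_of_gt r hr').eq_of_tgt _ _⟩
      by_cases hp' : p ≤ b₀
      · refine ⟨0, zero_mem _, ?_⟩
        obtain rfl : p = b₀ := by omega
        exact hQ.isZero.eq_of_src _ _
      obtain ⟨g, hg⟩ := hQ.exact q r s hqr hrs (by omega) f hf'
        (hQ.faithful _ (by rw [Φ.map_comp, hf, zero_comp]))
      have hP := hQ.spherical.projective p
      have hP : Projective (Φ.obj (Q.X p)) := hP
      -- The lift `g` through `Q` need not be killed by `Φ`, but `Φ g` is a cycle of `ΦQ`. From `p ≥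
      -- b` and `j ≥ 1` its target degree exceeds `b`, where `ΦQ` is exact, so it is a boundary and
      -- can be subtracted. This is where positivity of the degree enters.
      obtain ⟨u, hu⟩ := hQ.spherical.exact (q - 1) q r (by omega) hqr
        (by omega) (Φ.map g) ((Φ.map_comp _ _).symm.trans (by rw [hg, hf]; rfl))
        (by rw [hQ.η_eq_zero q (by omega), Φ.map_zero]; exact comp_zero)
      obtain ⟨w, hw⟩ := hQ.full u
      refine ⟨g - w ≫ Q.d (q - 1) q, ?_, ?_⟩
      · change Φ.map _ = 0
        rw [Φ.map_sub, Φ.map_comp, hw]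
        exact sub_eq_zero.2 hu.symm
      · rw [Preadditive.sub_comp, hg, Category.assoc, Q.d_comp_d, comp_zero, sub_zero])
    (δ j m c) (δ_δ _ _ _ _) (fun p q h => by
      have e : (δ j m c).map Φ = 0 := by rw [← δ_map, hc, hx]
      exact Cochain.congr_v e p q h)
  refine ⟨c - β, ?_, ?_⟩
  · rw [δ_sub]
    ext p q h
    by_cases hp : p < b₀
    · exact (hQ.isZero_of_lt p hp).eq_of_src _ _
    · exact hβ' p q h (by omega)
  · rw [Cochain.map_sub, hc, sub_eq_self]
    ext p q h
    exact hβ p q h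

/-- The endomorphism algebra of a resolution of a simple object is connected. -/
theorem isConnected {k : Type*} [Field k] [Linear k C]
    (hQ : IsSphericalResolution Φ Q b₀ b t η ι) (hS : ∀ f : S ⟶ S, ∃ r : k, f = r • 𝟙 S)
    (hη : η t ≠ 0) (hdesc : ∀ f : Q.X t ⟶ S, Q.d (t - 1) t ≫ f = 0 → ∃ g : S ⟶ S, f = η t ≫ g) :
    (endDG k Q).IsConnected where
  neg i hi x hx := by
    have hx : δ i (i + 1) x = 0 := hx
    obtain ⟨y, hy⟩ := hQ.exists_δ_eq_of_η (sub_add_cancel i 1) rfl x hx (fun p q hpq => by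
      by_cases hq : q = t
      · exact (hQ.isZero_of_gt p (by omega)).eq_of_src _ _
      · rw [hQ.η_eq_zero q hq, comp_zero])
    exact ⟨y, by rw [endDG_D_lof (sub_add_cancel i 1), hy]⟩
  zero x hx := by
    have hx : δ 0 (0 + 1) x = 0 := hx
    -- The top component of a cocycle of degree `0`, followed by the augmentation, factors through
    -- `S`, where every endomorphism is a scalar.
    have hd : Q.d (t - 1) t ≫ Cochain.v x t t (add_zero t) ≫ η t = 0 := by
      have e := Cochain.congr_v hx (t - 1) t (by omega)
      rw [δ_v 0 (0 + 1) rfl _ (t - 1) t (by omega) (t - 1) t rfl (by omega), Cochain.zero_v] at e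
      rw [← Category.assoc]
      have := congr_arg (fun f => f ≫ η t) e
      simpa only [Preadditive.add_comp, Category.assoc, hQ.d_η, comp_zero, zero_add, zero_comp,
        Linear.units_smul_comp, smul_eq_zero_iff_eq] using this
    obtain ⟨g, hg⟩ := hdesc _ hd
    obtain ⟨r, rfl⟩ := hS g
    have hc : δ 0 (0 + 1) (x - r • Cochain.ofHom (𝟙 Q)) = 0 := by
      rw [δ_sub, hx, δ_smul, δ_ofHom, smul_zero, sub_zero]
    obtain ⟨y, hy⟩ := hQ.exists_δ_eq_of_η (show -1 + 1 = (0 : ℤ) by rfl) rfl _ hc (fun p q hpq => by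
      by_cases hq : q = t
      · subst hq
        obtain rfl : p = q := by omega
        rw [Cochain.sub_v, Cochain.smul_v, Cochain.ofHom_v, Preadditive.sub_comp, hg,
          HomologicalComplex.id_f, Linear.smul_comp, Category.id_comp, Linear.comp_smul,
          Category.comp_id, sub_self]
      · rw [hQ.η_eq_zero q hq, comp_zero])
    refine ⟨r, y, ?_⟩
    have h1 : (1 : DirectSum ℤ (EndGr Q)) = DirectSum.lof k ℤ (EndGr Q) 0 (Cochain.ofHom (𝟙 Q)) := rfl
    rw [endDG_D_lof (show -1 + 1 = (0 : ℤ) by rfl), h1, ← map_smul, hy, ← map_add]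
    congr 1
    exact (add_sub_cancel _ _).symm
  one y hy := by
    have h1 : (1 : DirectSum ℤ (EndGr Q)) = DirectSum.lof k ℤ (EndGr Q) 0 (Cochain.ofHom (𝟙 Q)) := rfl
    obtain ⟨z, hz⟩ := (lof_mem_range_endDG (k := k) (show -1 + 1 = (0 : ℤ) by rfl)
      (Cochain.ofHom (𝟙 Q))).1 ⟨y, hy.trans h1⟩
    -- In top degree a null-homotopic endomorphism followed by the augmentation is zero, while the
    -- identity gives `η t ≠ 0`.
    have e := Cochain.congr_v hz t t (add_zero t)
    rw [δ_v (-1) 0 rfl _ t t (add_zero t) (t - 1) (t + 1) rfl rfl, Cochain.ofHom_v,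
      (hQ.isZero_of_gt (t + 1) (by omega)).eq_of_tgt (Q.d t (t + 1)) 0, zero_comp, smul_zero,
      add_zero, HomologicalComplex.id_f] at e
    apply hη
    rw [← Category.id_comp (η t), ← e, Category.assoc, hQ.d_η, comp_zero]

end IsSphericalResolution

/-- Two resolutions with the same spherical image, up to a shift of degrees, have
`A∞`-quasi-isomorphic endomorphism algebras. -/
theorem exists_isQuasiIso_of_isSphericalResolution {Φ : C ⥤ E} {Φ' : C' ⥤ E} [Φ.Additive]
    [Φ'.Additive] {k : Type*} [Field k] [Linear k C] [Linear k C'] [Linear k E] [Φ.Linear k]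
    [Φ'.Linear k] {A : ℤ → Type*} [∀ i, AddCommGroup (A i)] [∀ i, Module k (A i)]
    [DirectSum.GRing A] [DirectSum.GAlgebra k A] {𝒟 : DGStructure k A}
    {Q : CochainComplex C ℤ} {Q' : CochainComplex C' ℤ} (σ : ∀ i, EndGr Q i ≃ₗ[k] A i)
    (hσ : ∀ i x, σ (i + 1) (δ i (i + 1) x) = 𝒟.d i (σ i x))
    (hσ' : ∀ i j (x : EndGr Q i) (y : EndGr Q j), σ (i + j) (GradedMonoid.GMul.mul x y) =
      GradedMonoid.GMul.mul (σ i x) (σ j y))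
    (h𝒟 : 𝒟.IsConnected) (h𝒟' : (endDG k Q').IsConnected)
    {b₀ b₀' b b' t t' : ℤ} {S : C} {S' : C'}
    {η : ∀ q, Q.X q ⟶ S} {ι : Φ.obj S ⟶ Φ.obj (Q.X b)} {η' : ∀ q, Q'.X q ⟶ S'}
    {ι' : Φ'.obj S' ⟶ Φ'.obj (Q'.X b')}
    (hQ : IsSphericalResolution Φ Q b₀ b t η ι) (hQ' : IsSphericalResolution Φ' Q' b₀' b' t' η' ι')
    (hb : b + 1 = b') (ht : t + 1 = t') (e : Φ'.obj S' ≅ Φ.obj S)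
    (hT : ∀ f : Φ.obj S ⟶ Φ.obj S, f = 0 ∨ IsIso f) :
    ∃ F : AInfinityHom 𝒟.toAInfinity (endDG k Q').toAInfinity, F.IsQuasiIso := by
  obtain ⟨φ, ψ, x, y, hφ, hψ, hx, hy⟩ := hQ.spherical.exists_equiv hT (hQ'.spherical.ofIso e)
    (r := 1) (s := -1) rfl rfl hb ht
  refine exists_isQuasiIso_of_cocycle σ hσ hσ' h𝒟 h𝒟' hφ ?_ ?_ ?_ ?_
  · rintro h i j hij hi hi' a ha ⟨z, hz⟩
    obtain rfl : i = j - 1 := by omega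
    -- Cancel the homotopy equivalence to make the image of `a` a coboundary in `End (ΦQ)`, then
    -- descend along `Φ`.
    obtain ⟨w, hw⟩ := exists_δ_eq_of_comp hψ rfl hx (a.map Φ)
      (by rw [δ_map, sub_add_cancel, ha, Cochain.map_zero]) hij hi hz
    exact hQ.exists_δ_eq_of_map hi hij a ha hw
  · rintro h i j hij hi hi' b hb ⟨z, hz⟩
    obtain rfl : i = j - 1 := by omega
    obtain ⟨w, hw⟩ := exists_δ_eq_of_comp' hψ rfl hy (b.map Φ')
      (by rw [δ_map, sub_add_cancel, hb, Cochain.map_zero]) hij hi hz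
    exact hQ'.exists_δ_eq_of_map hi (by omega) b hb hw
  · intro i j m hij hjm hi z hz
    subst hjm
    obtain ⟨a, ha, ha'⟩ := hQ.exists_map_eq hi hij (z.comp ψ (show j + -1 = i by omega))
      (δ_comp_eq_zero hz hψ _ hij)
    obtain ⟨w, hw⟩ := exists_δ_eq_comp_left hz y (show -1 + 1 = (0 : ℤ) by rfl) (add_zero j) hij
    refine ⟨a, ha, -w, ?_⟩
    rw [ha', Cochain.comp_assoc z ψ φ _ rfl (by omega), hy, Cochain.comp_add, Cochain.comp_id,
      δ_neg, hw]
    abel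
  · intro i j m hij hjm hi z hz
    subst hjm
    have hij' : i + 1 = j := by omega
    obtain ⟨a, ha, ha'⟩ := hQ'.exists_map_eq hi hij' (ψ.comp z (show -1 + j = i by omega))
      (δ_comp_eq_zero hψ hz _ hij')
    obtain ⟨w, hw⟩ := exists_δ_eq_comp_right hz x (show -1 + 1 = (0 : ℤ) by rfl) (zero_add j) hij'
    refine ⟨a, ha, -w, ?_⟩
    rw [ha', ← Cochain.comp_assoc φ ψ z rfl _ (by omega), hx, Cochain.add_comp, Cochain.id_comp,
      δ_neg, hw]
    abel

end AInf

namespace AInf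

/-! ### Projective resolutions as cochain complexes. -/

open CategoryTheory CochainComplex CochainComplex.HomComplex Limits

universe v v' v'' u u' u''

variable {C : Type u} [Category.{v} C] [Abelian C] {E : Type u''} [Category.{v''} E] [Abelian E]

/-- An identification of the cochain complex `K` with the chain complex `P`, placed in the
degrees `≤ t`. -/
structure ReversedIso (K : CochainComplex C ℤ) (P : ChainComplex C ℕ) (t : ℤ) where
  /-- the components -/
  iso : ∀ (p : ℤ) (j : ℕ), p + j = t → (K.X p ≅ P.X j)
  d_eq : ∀ p q i j hp hq, K.d p q = (iso p i hp).hom ≫ P.d i j ≫ (iso q j hq).inv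
  isZero_of_gt : ∀ p, t < p → IsZero (K.X p)

namespace ReversedIso

variable {K : CochainComplex C ℤ} {P : ChainComplex C ℕ} {t : ℤ}

/-- The image of an identification under an additive functor. -/
def map (α : ReversedIso K P t) (Φ : C ⥤ E) [Φ.Additive] :
    ReversedIso ((Φ.mapHomologicalComplex _).obj K) ((Φ.mapHomologicalComplex _).obj P) t where
  iso p j h := Φ.mapIso (α.iso p j h)
  d_eq p q i j hp hq := by
    change Φ.map _ = Φ.map _ ≫ Φ.map _ ≫ Φ.map _
    rw [α.d_eq p q i j hp hq, Φ.map_comp, Φ.map_comp]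
  isZero_of_gt p hp := Φ.map_isZero (α.isZero_of_gt p hp)

theorem exists_eq (_ : ReversedIso K P t) (p : ℤ) : t < p ∨ ∃ j : ℕ, p + j = t := by
  rcases lt_or_ge t p with h | h
  · exact Or.inl h
  · exact Or.inr ⟨(t - p).toNat, by omega⟩

theorem isZero (α : ReversedIso K P t) (p : ℤ) (h : ∀ j : ℕ, p + j = t → IsZero (P.X j)) :
    IsZero (K.X p) := by
  rcases α.exists_eq p with hp | ⟨j, hj⟩
  · exact α.isZero_of_gt p hp
  · exact (h j hj).of_iso (α.iso p j hj)

theorem projective (α : ReversedIso K P t) (h : ∀ j, Projective (P.X j)) (p : ℤ) :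
    Projective (K.X p) := by
  rcases α.exists_eq p with hp | ⟨j, hj⟩
  · exact (α.isZero_of_gt p hp).projective
  · have := h j
    exact Projective.of_iso (α.iso p j hj).symm inferInstance

/-- An augmentation of a chain complex, extended by zero. -/
noncomputable def aug (α : ReversedIso K P t) {T : C} (ε : P.X 0 ⟶ T) (q : ℤ) : K.X q ⟶ T :=
  if h : q = t then (α.iso q 0 (by omega)).hom ≫ ε else 0

theorem aug_self (α : ReversedIso K P t) {T : C} (ε : P.X 0 ⟶ T) (h : t + (0 : ℕ) = t) :
    α.aug ε t = (α.iso t 0 h).hom ≫ ε := dif_pos rfl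

theorem aug_of_ne (α : ReversedIso K P t) {T : C} (ε : P.X 0 ⟶ T) {q : ℤ} (h : q ≠ t) :
    α.aug ε q = 0 := dif_neg h

theorem map_aug (α : ReversedIso K P t) (Φ : C ⥤ E) [Φ.Additive] {T : C} (ε : P.X 0 ⟶ T) (q : ℤ) :
    Φ.map (α.aug ε q) = (α.map Φ).aug (Φ.map ε) q := by
  by_cases h : q = t
  · subst h
    rw [aug_self _ _ (by simp), Φ.map_comp]
    exact ((α.map Φ).aug_self _ (by simp)).symm
  · rw [aug_of_ne _ _ h, Φ.map_zero]
    exact ((α.map Φ).aug_of_ne _ h).symm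

/-- The complex obtained from a truncated resolution is augmented. -/
theorem isAugmented (α : ReversedIso K P t) {T : C} (ε : P.X 0 ⟶ T) [Epi ε]
    (w : P.d 1 0 ≫ ε = 0) {N : ℕ} {b : ℤ} (hb : b + N = t) (hP : ∀ j, Projective (P.X j))
    (hN : ∀ j, N < j → IsZero (P.X j)) (hex : ∀ j, j ≠ 0 → j < N → P.ExactAt j)
    (hex₀ : 0 < N → (ShortComplex.mk _ _ w).Exact) : IsAugmented K b t (α.aug ε) where
  isZero_of_gt := α.isZero_of_gt
  isZero_of_lt p hp := α.isZero p fun j hj => hN j (by omega)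
  projective := α.projective hP
  d_η p q := by
    by_cases hq : q = t
    swap
    · rw [aug_of_ne _ _ hq, comp_zero]
    subst hq
    by_cases hp : p + 1 = q
    · rw [aug_self _ _ (by simp), α.d_eq p q 1 0 (by simpa using hp) (by simp), Category.assoc,
        Category.assoc, Iso.inv_hom_id_assoc, w, comp_zero]
    · rw [K.shape _ _ hp, zero_comp]
  η_eq_zero q hq := α.aug_of_ne ε hq
  exact {M} _ p q r hpq hqr hq f hf hf' := by
    rcases α.exists_eq q with h | ⟨j, hj⟩
    · exact ⟨0, (α.isZero_of_gt q h).eq_of_tgt _ _⟩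
    have hp : p + (j + 1 : ℕ) = t := by push_cast; omega
    suffices ∃ g : M ⟶ P.X (j + 1), g ≫ P.d (j + 1) j = f ≫ (α.iso q j hj).hom by
      obtain ⟨g, hg⟩ := this
      refine ⟨g ≫ (α.iso p (j + 1) hp).inv, ?_⟩
      rw [α.d_eq p q (j + 1) j hp hj, Category.assoc, Iso.inv_hom_id_assoc, ← Category.assoc, hg,
        Category.assoc, Iso.hom_inv_id, Category.comp_id]
    rcases j with _ | j
    · obtain rfl : q = t := by simpa using hj
      exact ⟨_, (hex₀ (by omega)).liftFromProjective_comp (f ≫ (α.iso q 0 hj).hom)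
        (by rw [Category.assoc]; rwa [aug_self _ _ hj] at hf')⟩
    · have hr : r + j = t := by push_cast at hj; omega
      have h := hex (j + 1) (by omega) (by omega)
      rw [P.exactAt_iff' (j + 1 + 1) (j + 1) j (by simp) (by simp)] at h
      refine ⟨_, h.liftFromProjective_comp (f ≫ (α.iso q (j + 1) hj).hom) ?_⟩
      rw [α.d_eq q r (j + 1) j hj hr, ← Category.assoc, ← Category.assoc,
        Preadditive.IsIso.comp_right_eq_zero] at hf
      exact hf
  lift f := ⟨Projective.factorThru f ε ≫ (α.iso t 0 (by simp)).inv, by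
    rw [aug_self _ _ (by simp), Category.assoc, Iso.inv_hom_id_assoc, Projective.factorThru_comp]⟩

/-- A complex with the same cohomology at both ends is spherical. -/
theorem exists_isSpherical (α : ReversedIso K P t) {T : C} (ε : P.X 0 ⟶ T) [Epi ε]
    (w : P.d 1 0 ≫ ε = 0) {N : ℕ} {b : ℤ} (hb : b + N = t) (hP : ∀ j, Projective (P.X j))
    (hN : ∀ j, N < j → IsZero (P.X j)) (hex : ∀ j, j ≠ 0 → j < N → P.ExactAt j)
    (hex₀ : (ShortComplex.mk _ _ w).Exact) (e : P.homology N ≅ T) :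
    ∃ ι : T ⟶ K.X b, IsSpherical K b t (α.aug ε) ι := by
  have hd : P.d (N + 1) N = 0 := (hN (N + 1) (by omega)).eq_of_src _ _
  -- There is no term above `N` in homological degree, so the homology at `N` is the object of
  -- cycles; this supplies the inclusion of `T`.
  let i : T ⟶ P.X N := e.inv ≫ (P.isoHomologyπ (N + 1) N (by simp) hd).inv ≫ P.iCycles N
  refine ⟨i ≫ (α.iso b N hb).inv,
    { toIsAugmented := α.isAugmented ε w hb hP hN hex fun _ => hex₀
      le := by omega
      mono_of_eq := ?_
      ι_d := ?_
      ι_mono := ?_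
      exists_ι := ?_ }⟩
  · rintro rfl M f hf
    obtain rfl : N = 0 := by omega
    have : Mono ε := (ShortComplex.exact_iff_mono _ hd).1 hex₀
    rw [aug_self _ _ (by simp)] at hf
    exact zero_of_comp_mono _ hf
  · intro h
    obtain ⟨m, rfl⟩ : ∃ m, N = m + 1 := ⟨N - 1, by omega⟩
    rw [α.d_eq b (b + 1) (m + 1) m hb (by push_cast at hb; omega)]
    simp [i]
  · intro h M f hf
    exact zero_of_comp_mono (i ≫ (α.iso b N hb).inv) hf
  · intro h M f hf
    obtain ⟨m, rfl⟩ : ∃ m, N = m + 1 := ⟨N - 1, by omega⟩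
    rw [α.d_eq b (b + 1) (m + 1) m hb (by push_cast at hb; omega), ← Category.assoc,
      ← Category.assoc, Preadditive.IsIso.comp_right_eq_zero] at hf
    refine ⟨P.liftCycles (f ≫ (α.iso b (m + 1) hb).hom) m (by simp) hf ≫
      (P.isoHomologyπ (m + 1 + 1) (m + 1) (by simp) hd).hom ≫ e.hom, ?_⟩
    simp [i]

end ReversedIso

/-- The cochain complex of a projective resolution. -/
noncomputable def reversedIso {S : C} (Q : ProjectiveResolution S) :
    ReversedIso Q.cochainComplex Q.complex 0 where
  iso p j h := Q.cochainComplexXIso p j (by omega)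
  d_eq p q i j hp hq := Q.cochainComplex_d p q i j (by omega) (by omega)
  isZero_of_gt p hp := CochainComplex.isZero_of_isStrictlyLE _ 0 _ (by omega)

theorem ReversedIso.exists_isSphericalResolution {S : C} {Q : ProjectiveResolution S}
    {K : CochainComplex C ℤ} {t : ℤ} (α : ReversedIso K Q.complex t) (Φ : C ⥤ E) [Φ.Additive]
    [PreservesFiniteColimits Φ] [Φ.PreservesProjectiveObjects]
    (faithful : ∀ {X : C} (f : X ⟶ S), Φ.map f = 0 → f = 0)
    (full : ∀ {X Y : C} [Projective X] (g : Φ.obj X ⟶ Φ.obj Y), ∃ f, Φ.map f = g) {n : ℕ}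
    (length : ∀ j, n ≤ j → IsZero (Q.complex.X j)) (hS : ¬ IsZero S)
    (homology_iso : ∀ j, j + 1 = n →
      Nonempty ((((Φ.mapHomologicalComplex _).obj Q.complex).homology j) ≅ Φ.obj S))
    (homology_zero : ∀ j, ¬ (j = 0 ∨ j + 1 = n) →
      IsZero (((Φ.mapHomologicalComplex _).obj Q.complex).homology j)) :
    ∃ ι, IsSphericalResolution Φ K (t - n) (t - n + 1) t (α.aug (Q.π.f 0)) ι := by
  let ε : Q.complex.X 0 ⟶ S := Q.π.f 0
  have hε : Epi ε := inferInstanceAs (Epi (Q.π.f 0))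
  have w : Q.complex.d 1 0 ≫ ε = 0 := Q.complex_d_comp_π_f_zero
  have hex : (ShortComplex.mk _ _ w).Exact := Q.exact₀
  -- Length zero would make the resolution, and with it `S`, vanish.
  obtain ⟨N, rfl⟩ : ∃ N, n = N + 1 := Nat.exists_eq_succ_of_ne_zero (by
    rintro rfl
    exact hS (IsZero.of_epi ε (length 0 le_rfl)))
  obtain ⟨e⟩ := homology_iso N rfl
  let ε' : ((Φ.mapHomologicalComplex _).obj Q.complex).X 0 ⟶ Φ.obj S := Φ.map ε
  have hΦε : Epi ε' := Φ.map_epi ε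
  obtain ⟨ι, hι⟩ := (α.map Φ).exists_isSpherical ε'
    (w := by change Φ.map _ ≫ _ = 0; rw [← Φ.map_comp, w, Φ.map_zero])
    (N := N) (b := t - (N + 1 : ℕ) + 1) (by push_cast; ring)
    (fun j => Φ.projective_obj (Q.complex.X j)) (fun j hj => Φ.map_isZero (length j hj))
    (fun j hj hj' => by
      rw [HomologicalComplex.exactAt_iff_isZero_homology]
      exact homology_zero j (by omega))
    (hex.map_of_epi_of_preservesCokernel Φ hε inferInstance) e
  refine ⟨ι,
    { toIsAugmented := α.isAugmented ε w (by ring) Q.projective (fun j hj => length j hj.le)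
        (fun j hj _ => by
          obtain ⟨i, rfl⟩ := Nat.exists_eq_succ_of_ne_zero hj
          exact Q.complex_exactAt_succ i) (fun _ => hex)
      succ := rfl
      isZero := α.isZero _ fun j hj => length j (by omega)
      spherical := ?_
      faithful := faithful
      full := full }⟩
  have h : (fun q => Φ.map (α.aug (Q.π.f 0) q)) = (α.map Φ).aug (Φ.map ε) :=
    funext fun q => α.map_aug Φ _ q
  rw [h]
  exact hι

end AInf

namespace AInf

/-! ### Degree shift, turning the homotopy equivalence into a cocycle of degree one. -/

open CategoryTheory CochainComplex CochainComplex.HomComplex Limits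

universe v u

variable {C : Type u} [Category.{v} C] [Preadditive C]

/-- The complex `K` moved to the left by one degree, without changing the sign of the
differential. -/
def unsignedShift (K : CochainComplex C ℤ) : CochainComplex C ℤ where
  X p := K.X (p + 1)
  d p q := K.d (p + 1) (q + 1)
  shape p q h := K.shape _ _ fun h' => h (by simpa using h')
  d_comp_d' p q r _ _ := K.d_comp_d _ _ _

variable (k : Type*) [Field k] [Linear k C] (K : CochainComplex C ℤ)

/-- The identification of the cochains of a complex with those of the shifted complex. -/
def shiftCochain (i : ℤ) : EndGr K i →ₗ[k] EndGr (unsignedShift K) i where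
  toFun x := Cochain.mk fun p q h => x.v (p + 1) (q + 1) (by omega)
  map_add' _ _ := rfl
  map_smul' _ _ := rfl

theorem shiftCochain_v {i : ℤ} (x : EndGr K i) (p q : ℤ) (h : p + i = q) :
    (shiftCochain k K i x).v p q h = x.v (p + 1) (q + 1) (by omega) := rfl

theorem shiftCochain_injective (i : ℤ) : Function.Injective (shiftCochain k K i) := by
  intro x y hxy
  ext p q h
  obtain ⟨p, rfl⟩ : ∃ p', p = p' + 1 := ⟨p - 1, by omega⟩
  obtain ⟨q, rfl⟩ : ∃ q', q = q' + 1 := ⟨q - 1, by omega⟩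
  exact Cochain.congr_v hxy p q (by omega)

theorem shiftCochain_surjective (i : ℤ) : Function.Surjective (shiftCochain k K i) := by
  intro y
  refine ⟨Cochain.mk fun p q h => eqToHom (congr_arg K.X (show p = p - 1 + 1 by ring)) ≫
    y.v (p - 1) (q - 1) (by omega) ≫ eqToHom (congr_arg K.X (show q - 1 + 1 = q by ring)), ?_⟩
  ext p q h
  have key : ∀ p' q' (hp : p' = p) (hq : q' = q) (h' : p' + i = q'),
      eqToHom (congr_arg K.X (show p + 1 = p' + 1 by rw [hp])) ≫ y.v p' q' h' ≫
        eqToHom (congr_arg K.X (show q' + 1 = q + 1 by rw [hq])) = y.v p q h := by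
    rintro _ _ rfl rfl h'
    exact (Category.id_comp _).trans (Category.comp_id _)
  exact key (p + 1 - 1) (q + 1 - 1) (by ring) (by ring) (by omega)

/-- The inverse of the identification of cochains. -/
noncomputable def unshiftCochain (i : ℤ) : EndGr (unsignedShift K) i ≃ₗ[k] EndGr K i :=
  (LinearEquiv.ofBijective (shiftCochain k K i)
    ⟨shiftCochain_injective k K i, shiftCochain_surjective k K i⟩).symm

theorem shiftCochain_unshiftCochain (i : ℤ) (x : EndGr (unsignedShift K) i) :
    shiftCochain k K i (unshiftCochain k K i x) = x :=
  (LinearEquiv.ofBijective (shiftCochain k K i)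
    ⟨shiftCochain_injective k K i, shiftCochain_surjective k K i⟩).apply_symm_apply x

/-- Since the shifted differential carries no sign, reindexing commutes with `δ` literally; together
with `shiftCochain_mul` this gives an isomorphism of DG-algebras. -/
theorem δ_shiftCochain (i : ℤ) (x : EndGr K i) :
    δ i (i + 1) (shiftCochain k K i x) = shiftCochain k K (i + 1) (δ i (i + 1) x) := by
  ext p q h
  rw [shiftCochain_v, δ_v i (i + 1) rfl _ p q h (q - 1) (p + 1) rfl rfl,
    δ_v i (i + 1) rfl _ (p + 1) (q + 1) (by omega) (q - 1 + 1) (p + 1 + 1) (by omega) rfl]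
  rfl

theorem shiftCochain_mul (i j : ℤ) (x : EndGr K i) (y : EndGr K j) :
    shiftCochain k K (i + j) (GradedMonoid.GMul.mul x y) =
      GradedMonoid.GMul.mul (shiftCochain k K i x) (shiftCochain k K j y) := by
  change shiftCochain k K (i + j) (y.comp x (add_comm j i)) =
    (shiftCochain k K j y).comp (shiftCochain k K i x) (add_comm j i)
  ext p q h
  rw [shiftCochain_v, Cochain.comp_v _ _ _ p (p + j) q rfl (by omega),
    Cochain.comp_v _ _ _ (p + 1) (p + j + 1) (q + 1) (by omega) (by omega)]
  rfl

theorem unshiftCochain_δ (i : ℤ) (x : EndGr (unsignedShift K) i) :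
    unshiftCochain k K (i + 1) (δ i (i + 1) x) = δ i (i + 1) (unshiftCochain k K i x) :=
  shiftCochain_injective k K _ (by
    rw [shiftCochain_unshiftCochain, ← δ_shiftCochain, shiftCochain_unshiftCochain])

theorem unshiftCochain_mul (i j : ℤ) (x : EndGr (unsignedShift K) i)
    (y : EndGr (unsignedShift K) j) :
    unshiftCochain k K (i + j) (GradedMonoid.GMul.mul x y) =
      GradedMonoid.GMul.mul (unshiftCochain k K i x) (unshiftCochain k K j y) :=
  shiftCochain_injective k K _ (by
    rw [shiftCochain_unshiftCochain, shiftCochain_mul, shiftCochain_unshiftCochain,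
      shiftCochain_unshiftCochain])

/-- The shift of an identification with a chain complex. -/
def ReversedIso.shift {C : Type u} [Category.{v} C] [Abelian C] {K : CochainComplex C ℤ}
    {P : ChainComplex C ℕ} {t : ℤ} (α : ReversedIso K P (t + 1)) :
    ReversedIso (unsignedShift K) P t where
  iso p j h := α.iso (p + 1) j (by omega)
  d_eq p q i j hp hq := α.d_eq (p + 1) (q + 1) i j (by omega) (by omega)
  isZero_of_gt p hp := α.isZero_of_gt (p + 1) (by omega)

end AInf

namespace AInf

open CategoryTheory CochainComplex CochainComplex.HomComplex Limits MulOpposite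

universe v v' v'' u u' u''

/-! ### Simple modules over local rings. -/

section LocalRing

variable {R : Type*} [Ring R]

theorem IsLocalRing.mulOpposite [IsLocalRing R] : IsLocalRing Rᵐᵒᵖ where
  isUnit_or_isUnit_of_add_one {a b} h := by
    rw [← isUnit_unop, ← isUnit_unop (m := b)]
    exact IsLocalRing.isUnit_or_isUnit_of_add_one (congr_arg unop h)

/-- The element `b a` is idempotent, so it is `0` or `1` in a local ring; the value `0` would force
`1 = (a b)(a b) = 0`. -/
theorem isUnit_of_mul_eq_one_left [IsLocalRing R] {a b : R} (h : a * b = 1) : IsUnit b := by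
  have hid : b * a * (b * a) = b * a := by rw [mul_assoc, ← mul_assoc a, h, one_mul]
  rcases IsLocalRing.isUnit_or_isUnit_of_add_one (add_sub_cancel (b * a) 1) with hu | hu
  · have : b * a = 1 := hu.mul_left_cancel (by rw [hid, mul_one])
    exact ⟨⟨b, a, this, h⟩, rfl⟩
  · have h0 : b * a = 0 := hu.mul_left_cancel (by rw [sub_mul, hid, one_mul, sub_self, mul_zero])
    have : (1 : R) = 0 := by
      rw [← h, ← mul_one (a * b), ← h, mul_assoc, ← mul_assoc b, h0, zero_mul, mul_zero]
    exact absurd this one_ne_zero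

variable {M N : Type*} [AddCommGroup M] [AddCommGroup N] [Module R M] [Module R N]

/-- Over a local ring the annihilator of a nonzero element of a simple module consists of the
nonunits. -/
theorem smul_eq_zero_iff_not_isUnit [IsLocalRing R] [IsSimpleModule R M] {m : M} (hm : m ≠ 0)
    (r : R) : r • m = 0 ↔ ¬ IsUnit r := by
  refine ⟨fun h hr => hm ?_, fun hr => ?_⟩
  · obtain ⟨u, rfl⟩ := hr
    exact (smul_eq_zero_iff_eq u).1 h
  · by_contra h
    obtain ⟨c, hc⟩ := IsSimpleModule.toSpanSingleton_surjective R h m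
    have hc : (c * r) • m = m := by rw [mul_smul]; exact hc
    rcases IsLocalRing.isUnit_or_isUnit_of_add_one (add_sub_cancel (c * r) 1) with hu | hu
    · obtain ⟨u, hu⟩ := hu
      exact hr (isUnit_of_mul_eq_one_left (a := ↑u⁻¹ * c) (by rw [mul_assoc, ← hu, Units.inv_mul]))
    · obtain ⟨u, hu⟩ := hu
      refine hm ((smul_eq_zero_iff_eq u).1 ?_)
      change (u : R) • m = 0
      rw [hu, sub_smul, hc, one_smul, sub_self]

/-- A local ring has only one simple module. -/
theorem nonempty_linearEquiv_of_isLocalRing [IsLocalRing R] [IsSimpleModule R M]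
    [IsSimpleModule R N] : Nonempty (M ≃ₗ[R] N) := by
  have := IsSimpleModule.nontrivial R M
  have := IsSimpleModule.nontrivial R N
  obtain ⟨m, hm⟩ := exists_ne (0 : M)
  obtain ⟨x, hx⟩ := exists_ne (0 : N)
  refine ⟨(LinearMap.quotKerEquivOfSurjective _
    (IsSimpleModule.toSpanSingleton_surjective R hm)).symm.trans
    ((Submodule.quotEquivOfEq _ _ ?_).trans (LinearMap.quotKerEquivOfSurjective _
      (IsSimpleModule.toSpanSingleton_surjective R hx)))⟩
  ext r
  rw [LinearMap.mem_ker, LinearMap.mem_ker, LinearMap.toSpanSingleton_apply,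
    LinearMap.toSpanSingleton_apply, smul_eq_zero_iff_not_isUnit hm, smul_eq_zero_iff_not_isUnit hx]

/-- Simplicity is tested on cyclic submodules, so it suffices that every scalar action is realized
over the new ring; `f` need not be a homomorphism. -/
theorem IsSimpleModule.of_surjective {R' : Type*} [Ring R'] [Module R' M] (f : R → R')
    (hf : ∀ r (m : M), f r • m = r • m) [IsSimpleModule R M] : IsSimpleModule R' M := by
  rw [isSimpleModule_iff_toSpanSingleton_surjective]
  refine ⟨IsSimpleModule.nontrivial R M, fun x hx y => ?_⟩
  obtain ⟨r, hr⟩ := IsSimpleModule.toSpanSingleton_surjective R hx y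
  exact ⟨f r, (hf r x).trans hr⟩

end LocalRing

/-! ### Extension of scalars to the contraction algebra. -/

section IStar

variable {A : Type u} [Ring A] (e : A)

instance : PreservesFiniteColimits (iStar.{u, u} e) :=
  have : PreservesColimitsOfSize.{u, u} (iStar.{u, u} e) :=
    (iStarAdjunction.{u, u} e).leftAdjoint_preservesColimits
  PreservesColimitsOfSize.preservesFiniteColimits _

instance : (iStar.{u, u} e).PreservesProjectiveObjects :=
  Functor.preservesProjectiveObjects_of_adjunction_of_preservesEpimorphisms (iStarAdjunction e)

instance [Algebra ℂ A] : (iStar.{u, v} e).Linear ℂ where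
  map_smul _ _ := ModuleCat.hom_ext (conTensor_ext e _ _ fun _ => rfl)

/-- By adjunction `g` is a map from `X` to the restriction of `i^* Y`; projectivity of `X` lifts it
through the surjective unit at `Y`. -/
theorem iStar_full {X Y : ModuleCat.{u} Aᵐᵒᵖ} [Projective X]
    (g : (iStar e).obj X ⟶ (iStar e).obj Y) : ∃ f, (iStar e).map f = g := by
  have : Epi ((iStarAdjunction e).unit.app Y) := by
    rw [ModuleCat.epi_iff_surjective]
    exact Submodule.Quotient.mk_surjective _
  refine ⟨Projective.factorThru ((iStarAdjunction e).homEquiv _ _ g)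
    ((iStarAdjunction e).unit.app Y), ((iStarAdjunction e).homEquiv _ _).injective ?_⟩
  rw [Adjunction.homEquiv_unit, Adjunction.homEquiv_unit]
  refine ((iStarAdjunction e).unit_naturality _).trans ?_
  rw [Projective.factorThru_comp]

variable {e} {S : ModuleCat.{u} Aᵐᵒᵖ}

/-- A submodule of a simple module is zero or everything, and the second case would make `i^* S`
zero. Hence `S` is already a module over the contraction algebra. -/
theorem conSubmodule_eq_bot [IsSimpleModule Aᵐᵒᵖ S] [h : Nontrivial ((iStar e).obj S)] :
    conSubmodule e S = ⊥ := by
  have : Nontrivial (ConTensor e S) := h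
  refine (eq_bot_or_eq_top (conSubmodule e S)).resolve_right fun h => ?_
  obtain ⟨x, hx⟩ := exists_ne (0 : ConTensor e S)
  obtain ⟨m, rfl⟩ := Submodule.Quotient.mk_surjective _ x
  exact hx ((Submodule.Quotient.mk_eq_zero _).2 (h ▸ Submodule.mem_top))

theorem iStar_faithful [IsSimpleModule Aᵐᵒᵖ S] [Nontrivial ((iStar e).obj S)]
    {X : ModuleCat.{u} Aᵐᵒᵖ} (f : X ⟶ S) (hf : (iStar e).map f = 0) : f = 0 := by
  ext x
  have h : (Submodule.Quotient.mk (f.hom x) : ConTensor e S) = 0 :=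
    congr_arg (fun g => g.hom (Submodule.Quotient.mk x : ConTensor e X)) hf
  rw [Submodule.Quotient.mk_eq_zero, conSubmodule_eq_bot, Submodule.mem_bot] at h
  exact h

theorem isSimpleModule_iStar [IsSimpleModule Aᵐᵒᵖ S] [Nontrivial ((iStar e).obj S)] :
    IsSimpleModule (ConAlg e)ᵐᵒᵖ ((iStar e).obj S) := by
  have : IsSimpleModule Aᵐᵒᵖ (ConTensor e S) :=
    IsSimpleModule.congr (Submodule.quotEquivOfEqBot _ conSubmodule_eq_bot)
  exact IsSimpleModule.of_surjective (M := ConTensor e S) (fun a : Aᵐᵒᵖ => op (conMk e (unop a)))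
    fun r m => con_smul e S (unop r) m

end IStar

end AInf

namespace AInf

/-! ### The setup over the complex numbers and the conclusion. -/

open CategoryTheory CochainComplex CochainComplex.HomComplex Limits MulOpposite

universe u u' u₂ v₂

namespace IsContractionSetup

variable {A : Type u} [Ring A] [Algebra ℂ A] {e : A} {n : ℕ} {S : ModuleCat.{u} Aᵐᵒᵖ}
  {Q : ProjectiveResolution S}

theorem not_isZero (hA : IsContractionSetup e n Q) : ¬ IsZero S := fun h => by
  have := hA.simple
  have := IsSimpleModule.nontrivial Aᵐᵒᵖ S
  have := ModuleCat.subsingleton_of_isZero h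
  exact not_subsingleton S this

/-- The auxiliary `G` carries modules over the contraction algebra into a category shared by both
sides; being exact, fully faithful and compatible with projectives, it preserves all the conditions.
-/
theorem exists_isSphericalResolution (hA : IsContractionSetup e n Q) {E : Type u₂}
    [Category.{v₂} E] [Abelian E] (G : ModuleCat.{u} (ConAlg e)ᵐᵒᵖ ⥤ E) [G.Additive] [G.Full]
    [G.Faithful] [PreservesFiniteLimits G] [PreservesFiniteColimits G]
    [G.PreservesProjectiveObjects] {K : CochainComplex (ModuleCat.{u} Aᵐᵒᵖ) ℤ} {t : ℤ}
    (α : ReversedIso K Q.complex t) :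
    ∃ ι, IsSphericalResolution (iStar e ⋙ G) K (t - n) (t - n + 1) t (α.aug (Q.π.f 0)) ι := by
  have := hA.simple
  have := hA.nontrivial
  have iso : ∀ j, ((((iStar e ⋙ G).mapHomologicalComplex _).obj Q.complex).homology j) ≅
      G.obj ((((iStar e).mapHomologicalComplex _).obj Q.complex).homology j) := fun j =>
    ((((iStar e).mapHomologicalComplex _).obj Q.complex).sc j).mapHomologyIso G
  refine α.exists_isSphericalResolution _ (fun f hf => iStar_faithful (e := e) f ?_) (fun g => ?_)
    hA.length hA.not_isZero (fun j hj => ?_) fun j hj => ?_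
  · exact G.map_injective (hf.trans (G.map_zero _ _).symm)
  · obtain ⟨g, rfl⟩ := G.map_surjective g
    obtain ⟨f, rfl⟩ := iStar_full e g
    exact ⟨f, rfl⟩
  · obtain ⟨i⟩ := hA.homology_iso j (Or.inr hj)
    exact ⟨iso j ≪≫ G.mapIso i⟩
  · exact (G.map_isZero (hA.homology_zero j hj)).of_iso (iso j)

/-- Schur's lemma over an algebraically closed field, using finite dimensionality of `S`. -/
theorem exists_eq_smul_id (hA : IsContractionSetup e n Q) (f : S ⟶ S) : ∃ r : ℂ, f = r • 𝟙 S := by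
  let := ModuleCat.moduleOfAlgebraModule (k := ℂ) S
  have := ModuleCat.isScalarTower_of_algebra_moduleCat (k := ℂ) S
  have := hA.simple
  have := hA.finiteDimensional
  obtain ⟨r, hr⟩ := (IsSimpleModule.algebraMap_end_bijective_of_isAlgClosed (A := Aᵐᵒᵖ) (V := S)
    ℂ).2 f.hom
  exact ⟨r, ModuleCat.hom_ext hr.symm⟩

theorem isConnected (hA : IsContractionSetup e n Q) : (resolutionEndDG Q).IsConnected := by
  obtain ⟨ι, h⟩ := hA.exists_isSphericalResolution (𝟭 _) (reversedIso Q)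
  refine h.isConnected hA.exists_eq_smul_id (fun h0 => hA.not_isZero ?_) fun f hf => ?_
  · rw [ReversedIso.aug_self _ _ (by simp)] at h0
    let ε : Q.complex.X 0 ⟶ S := Q.π.f 0
    have : Epi ε := inferInstanceAs (Epi (Q.π.f 0))
    exact IsZero.of_epi_eq_zero (((reversedIso Q).iso 0 0 (by simp)).hom ≫ ε) h0
  · let i := (reversedIso Q).iso 0 0 (by simp)
    have w : Q.complex.d 1 0 ≫ i.inv ≫ f = 0 := by
      rw [(reversedIso Q).d_eq (0 - 1) 0 1 0 (by simp) (by simp), Category.assoc, Category.assoc,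
        Preadditive.IsIso.comp_left_eq_zero] at hf
      exact hf
    have : Epi (ShortComplex.mk _ _ Q.complex_d_comp_π_f_zero).g := inferInstanceAs (Epi (Q.π.f 0))
    refine ⟨Q.exact₀.desc (i.inv ≫ f) w, ?_⟩
    rw [ReversedIso.aug_self _ _ (by simp), Category.assoc]
    have := Q.exact₀.g_desc (i.inv ≫ f) w
    dsimp only at this
    rw [this, Iso.hom_inv_id_assoc]

end IsContractionSetup

theorem eq_zero_or_isIso {R : Type*} [Ring R] {M N : ModuleCat.{u} R} [IsSimpleModule R M]
    [IsSimpleModule R N] (f : M ⟶ N) : f = 0 ∨ IsIso f := by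
  rcases LinearMap.bijective_or_eq_zero f.hom with h | h
  · exact Or.inr ((ConcreteCategory.isIso_iff_bijective f).2 h)
  · exact Or.inl (ModuleCat.hom_ext h)

theorem isSimpleModule_restrictScalars {R R' : Type*} [Ring R] [Ring R'] (f : R ≃+* R')
    (M : ModuleCat.{u} R') [IsSimpleModule R' M] :
    IsSimpleModule R ((ModuleCat.restrictScalars f.toRingHom).obj M) := by
  let : Module R' ((ModuleCat.restrictScalars f.toRingHom).obj M) := inferInstanceAs (Module R' M)
  have : IsSimpleModule R' ((ModuleCat.restrictScalars f.toRingHom).obj M) :=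
    inferInstanceAs (IsSimpleModule R' M)
  refine IsSimpleModule.of_surjective f.symm fun r m => ?_
  change f (f.symm r) • m = r • m
  rw [f.apply_symm_apply]

instance {R : Type u} [Ring R] [Algebra ℂ R] :
    (ModuleCat.uliftFunctor.{u₂, v₂} R).Linear ℂ where
  map_smul _ _ := rfl

instance {R : Type*} {R' : Type*} [Ring R] [Ring R'] [Algebra ℂ R] [Algebra ℂ R'] (f : R ≃ₐ[ℂ] R') :
    (ModuleCat.restrictScalars.{u} f.toRingEquiv.toRingHom).Linear ℂ where
  map_smul g r := by
    ext m
    exact congr_arg (· • g.hom m) (f.commutes r).symm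

/-- The endomorphism algebras of two such resolutions are `A∞`-quasi-isomorphic if the contraction
algebras are isomorphic and local. -/
theorem IsContractionSetup.exists_isQuasiIso {A : Type u} {B : Type u'} [Ring A] [Algebra ℂ A] [Ring B] [Algebra ℂ B]
    (e : A) (e' : B) (n : ℕ) {S : ModuleCat.{u} Aᵐᵒᵖ} {S' : ModuleCat.{u'} Bᵐᵒᵖ}
    (Q : ProjectiveResolution S) (Q' : ProjectiveResolution S')
    (hA : IsContractionSetup e n Q) (hB : IsContractionSetup e' n Q')
    (hiso : Nonempty (ConAlg e ≃ₐ[ℂ] ConAlg e'))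
    (hlocA : IsLocalRing (ConAlg e)) :
    ∃ F : AInfinityHom (resolutionEndDG Q).toAInfinity
        (resolutionEndDG Q').toAInfinity,
      F.IsQuasiIso := by
  obtain ⟨θ⟩ := hiso
  -- The two module categories differ in ring and universe. Both are mapped to modules over the
  -- first contraction algebra in a common universe, the second also by restriction along `θ`.
  let G := ModuleCat.uliftFunctor.{u', u} (ConAlg e)ᵐᵒᵖ
  let H := ModuleCat.restrictScalars.{max u u'} (AlgEquiv.op θ).toRingEquiv.toRingHom
  let G' := ModuleCat.uliftFunctor.{u, u'} (ConAlg e')ᵐᵒᵖ ⋙ H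
  have hH : H.IsEquivalence := inferInstance
  have hH' : H.Additive := inferInstance
  have hH'' : H.Linear ℂ := inferInstance
  have := hA.simple
  have := hA.nontrivial
  have := hB.simple
  have := hB.nontrivial
  have := isSimpleModule_iStar (e := e) (S := S)
  have := isSimpleModule_iStar (e := e') (S := S')
  have : IsSimpleModule (ConAlg e)ᵐᵒᵖ ((iStar e ⋙ G).obj S) :=
    IsSimpleModule.congr (ULift.moduleEquiv (M := (iStar e).obj S))
  have : IsSimpleModule (ConAlg e')ᵐᵒᵖ (ULift.{u} ((iStar e').obj S')) :=
    IsSimpleModule.congr ULift.moduleEquiv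
  have : IsSimpleModule (ConAlg e)ᵐᵒᵖ ((iStar e' ⋙ G').obj S') :=
    isSimpleModule_restrictScalars (AlgEquiv.op θ).toRingEquiv
      (ModuleCat.of (ConAlg e')ᵐᵒᵖ (ULift.{u} ((iStar e').obj S')))
  have := IsLocalRing.mulOpposite (R := ConAlg e)
  -- Here locality makes the images of `S` and `S'` isomorphic: both are the unique simple module.
  obtain ⟨i⟩ := nonempty_linearEquiv_of_isLocalRing (R := (ConAlg e)ᵐᵒᵖ)
    (M := (iStar e' ⋙ G').obj S') (N := (iStar e ⋙ G).obj S)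
  -- The first resolution is placed with top degree `-1`, the second with top degree `0`, so the
  -- comparison map has the degree `1` needed for gluing.
  obtain ⟨ι, h⟩ := hA.exists_isSphericalResolution G (ReversedIso.shift (t := -1) (reversedIso Q))
  obtain ⟨ι', h'⟩ := hB.exists_isSphericalResolution G' (reversedIso Q')
  exact exists_isQuasiIso_of_isSphericalResolution (k := ℂ) (S := S) (S' := S') (unshiftCochain ℂ Q.cochainComplex)
    (unshiftCochain_δ ℂ Q.cochainComplex) (unshiftCochain_mul ℂ Q.cochainComplex) hA.isConnected
    hB.isConnected h h' (by ring) (by ring) i.toModuleIso eq_zero_or_isIso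

end AInf

theorem corollary5 {A : Type*} {B : Type*} [Ring A] [Algebra ℂ A] [Ring B] [Algebra ℂ B]
    (e : A) (e' : B) (n : ℕ) {S : ModuleCat Aᵐᵒᵖ} {S' : ModuleCat Bᵐᵒᵖ}
    (Q : CategoryTheory.ProjectiveResolution S) (Q' : CategoryTheory.ProjectiveResolution S')
    (hA : AInf.IsContractionSetup e n Q) (hB : AInf.IsContractionSetup e' n Q')
    (hiso : Nonempty (AInf.ConAlg e ≃ₐ[ℂ] AInf.ConAlg e'))
    (hlocA : IsLocalRing (AInf.ConAlg e)) (hlocB : IsLocalRing (AInf.ConAlg e')) :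
    ∃ F : AInf.AInfinityHom (AInf.resolutionEndDG Q).toAInfinity
        (AInf.resolutionEndDG Q').toAInfinity,
      F.IsQuasiIso := by
  exact hA.exists_isQuasiIso e e' n Q Q' hB hiso hlocA
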